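/- **Setting.** Let $H=\sum_k c_k P_k$ be a real linear combination of distinct $n$-qubit Pauli words $P_k\in\{\mathbb I,X,Y,Z\}^{\otimes n}$, let $\rho$ be an $n$-qubit density matrix, and let $\mathcal U_1,\dots,\mathcal U_L$ be the layers of a parametrized circuit. Layer $\mathcal U_i$ consists of rotations $\exp(-i\tfrac{\theta_{i,j}}2\sigma_{i,j})$, with $\sigma_{i,j}\neq\mathbb I^{\otimes n}$ a Pauli word, and of Clifford gates from $\{\mathrm H(a),\mathrm S(a),\mathrm{CNOT}(a,b)\}$ ($a\ne b$); all gates of one layer act on mutually disjoint sets of qubits. Let $\mathcal V_i$ be the product of the Clifford gates of layer $i$, and $\overline\sigma_{i,j}=\mathcal V_1^\dagger\cdots\mathcal V_{i-1}^\dagger\,\sigma_{i,j}\,\mathcal V_{i-1}\cdots\mathcal V_1$. For $\lambda\in(0,1]$ let $\mathcal N(\phi)=(1-\lambda)\phi+\lambda\frac{\mathrm{Tr}\,\phi}{2}\mathbb I$ be the single-qubit depolarizing channel. The noisy cost function is $$\widehat{\mathcal L}(\theta)=\mathrm{Tr}\big[H\,\mathcal N^{\otimes n}(\mathcal U_L\mathcal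 N^{\otimes n}(\cdots\mathcal U_1\mathcal N^{\otimes n}(\rho)\,\mathcal U_1^\dagger\cdots)\,\mathcal U_L^\dagger)\big].$$ A Pauli path is a sequence $s=(s_0,\dots,s_L)$ of normalized Pauli words $s_i\in\{\tfrac{\mathbb I}{\sqrt2},\tfrac X{\sqrt2},\tfrac Y{\sqrt2},\tfrac Z{\sqrt2}\}^{\otimes n}$; its Hamming weight $|s|$ is the total number of non-identity tensor factors of $s_0,\dots,s_L$. For $M\in\mathbb N$ the truncated Pauli-path sum is $$\widetilde{\mathcal L}_M(\theta)=\sum_{|s|\le M}\mathrm{Tr}\big[H\mathcal N^{\otimes n}(s_L)\big]\Big(\prod_{i=1}^{L}\mathrm{Tr}\big[s_i\,\mathcal U_i\,\mathcal N^{\otimes n}(s_{i-1})\,\mathcal U_i^\dagger\big]\Big)\mathrm{Tr}\big[s_0\rho\big].$$ The parameters $\theta_{i,j}$ are independent and uniformly distributed on $[-\pi,\pi]$; $\|H\|_\infty$ denotes the operator norm. Algorithms work with exact real numbers; building or taking apart a pair of data, a conditional, a function call, an addition, subtraction, multiplication or comparison of real numbers, and reading off $\cos\theta_{i,j}$ or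 $\sin\theta_{i,j}$ each cost one step. **Theorem 1.** There is a classical algorithm with the following property. Fix $\lambda\in(0,1]$ and a polynomial $p$. Then there is a polynomial $Q$ in five variables such that for all $n$ and $L$, every circuit as above for which the words $\overline\sigma_{i,j}$ generate all $n$-qubit Pauli words up to phases in $\{1,i,-1,-i\}$, every $H$ with at most $p(n)$ Pauli words, every $\rho$ with at most $p(n)$ non-zero entries in the computational basis, every $\varepsilon>0$ and every $0<\delta\le1$, there is an $M\in\mathbb N$ (not depending on $\theta$) such that: 1. for every $\theta$, on input of $\lambda,\varepsilon,\delta,n$, the circuit with its parameters $\theta$, the list of the Pauli words of $H$ with their coefficients and the list of the non-zero entries of $\rho$, the algorithm outputs $\widetilde{\mathcal L}_M(\theta)$ after at most $Q\big(n,L,\tfrac1\varepsilon,\tfrac1{\sqrt\delta},\|H\|_\infty\big)$ steps; 2. $|\widetilde{\mathcal L}_M(\theta)-\widehat{\mathcal L}(\theta)|\le\varepsilon$ with probability at least $1-\delta$ over $\theta$. -/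

import Mathlib

noncomputable section

namespace NoisyVQA

/-! ### Qubits, tensor products, Pauli words -/

/-- Matrices acting on one qubit. -/
abbrev QubitMat := Matrix (Fin 2) (Fin 2) ℂ

/-- Computational basis labels of `n` qubits. -/
abbrev Bits (n : ℕ) := Fin n → Fin 2

/-- Matrices acting on `n` qubits, written in the computational basis. -/
abbrev QMat (n : ℕ) := Matrix (Bits n) (Bits n) ℂ

/-- The tensor (Kronecker) product `A 0 ⊗ A 1 ⊗ ⋯ ⊗ A (n-1)`. -/
def tensor {n : ℕ} (A : Fin n → QubitMat) : QMat n :=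
  Matrix.of fun x y => ∏ j, A j (x j) (y j)

/-- Labels of the four single-qubit Pauli matrices. -/
inductive Pauli
  | I | X | Y | Z
  deriving DecidableEq

instance : Fintype Pauli where
  elems := {.I, .X, .Y, .Z}
  complete := by intro p; cases p <;> simp

/-- The Pauli matrices. -/
def Pauli.mat : Pauli → QubitMat
  | .I => 1
  | .X => !![0, 1; 1, 0]
  | .Y => !![0, -Complex.I; Complex.I, 0]
  | .Z => !![1, 0; 0, -1]

/-- `n`-qubit Pauli words (without phase). -/
abbrev PauliWord (n : ℕ) := Fin n → Pauli

/-- The matrix of a Pauli word. -/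
def PauliWord.mat {n : ℕ} (w : PauliWord n) : QMat n := tensor fun j => (w j).mat

/-- The normalized Pauli word, an element of `{𝕀/√2, X/√2, Y/√2, Z/√2}^{⊗n}`. -/
def PauliWord.normMat {n : ℕ} (w : PauliWord n) : QMat n :=
  tensor fun j => ((Real.sqrt 2 : ℂ)⁻¹) • (w j).mat

/-- The qubits on which a Pauli word is not the identity. -/
def PauliWord.support {n : ℕ} (w : PauliWord n) : Finset (Fin n) :=
  Finset.univ.filter fun j => w j ≠ Pauli.I

/-- The Hamming weight of a Pauli word. -/
def PauliWord.weight {n : ℕ} (w : PauliWord n) : ℕ := (PauliWord.support w).card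

/-! ### Gates -/

/-- The Clifford gates `H(a)`, `S(a)` and `CNOT(a,b)` (control `a`, target `b`). -/
inductive CliffordGate (n : ℕ)
  | hadamard (a : Fin n)
  | phase (a : Fin n)
  | cnot (a b : Fin n) (h : a ≠ b)

/-- The unitary matrix of a Clifford gate. -/
def CliffordGate.mat {n : ℕ} : CliffordGate n → QMat n
  | .hadamard a =>
      tensor fun j => if j = a then ((Real.sqrt 2 : ℂ)⁻¹) • !![1, 1; 1, -1] else 1
  | .phase a => tensor fun j => if j = a then !![1, 0; 0, Complex.I] else 1
  | .cnot a b _ => Matrix.of fun x y => if x = Function.update y b (y a + y b) then 1 else 0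

/-- The qubits on which a Clifford gate acts. -/
def CliffordGate.support {n : ℕ} : CliffordGate n → Finset (Fin n)
  | .hadamard a => {a}
  | .phase a => {a}
  | .cnot a b _ => {a, b}

/-- The Pauli rotation `exp(-i (θ/2) σ)`. -/
def pauliRotation {n : ℕ} (w : PauliWord n) (θ : ℝ) : QMat n :=
  NormedSpace.exp ((-(Complex.I * ((θ / 2 : ℝ) : ℂ))) • PauliWord.mat w)

/-! ### Parametrized circuits -/

/-- A parametrized circuit on `n` qubits with `L` layers. Layer `i` (counted from `0`) consists of
`numRot i` Pauli rotations and `numCliff i` Clifford gates; all gates of one layer act on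
non-empty, mutually disjoint sets of qubits. -/
structure Circuit (n L : ℕ) where
  numRot : Fin L → ℕ
  numCliff : Fin L → ℕ
  word : (i : Fin L) → Fin (numRot i) → PauliWord n
  gate : (i : Fin L) → Fin (numCliff i) → CliffordGate n
  word_nontrivial : ∀ i j, (PauliWord.support (word i j)).Nonempty
  disjoint : ∀ i, Pairwise (Function.onFun Disjoint
    (Sum.elim (fun j => PauliWord.support (word i j)) fun k => (gate i k).support))

namespace Circuit

variable {n L : ℕ} (c : Circuit n L)

/-- Indices `(i, j)` of the rotation parameters. -/
abbrev ParamIndex := (i : Fin L) × Fin (c.numRot i)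

/-- Values of all parameters `θ_{i,j}`. -/
abbrev Params := c.ParamIndex → ℝ

/-- The product of the Clifford gates of layer `i`. -/
def cliffordLayer (i : Fin L) : QMat n := (List.ofFn fun k => (c.gate i k).mat).prod

/-- The unitary of layer `i`. -/
def layerUnitary (θ : c.Params) (i : Fin L) : QMat n :=
  (List.ofFn fun j => pauliRotation (c.word i j) (θ ⟨i, j⟩)).prod * c.cliffordLayer i

/-- The product of the Clifford gates of the first `k` layers (later layers on the left). -/
def cliffordUpTo : ℕ → QMat n
  | 0 => 1
  | k + 1 => if h : k < L then c.cliffordLayer ⟨k, h⟩ * cliffordUpTo k else cliffordUpTo k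

/-- The rotation Pauli word `(i, j)`, conjugated by all Clifford gates of the earlier layers. -/
def effectedWord (p : c.ParamIndex) : QMat n :=
  (c.cliffordUpTo p.1).conjTranspose * PauliWord.mat (c.word p.1 p.2) * c.cliffordUpTo p.1

/-- The Clifford-conjugated rotation words generate all Pauli words up to a phase in
`{1, i, -1, -i}`. Every generator squares to the identity, so finite products of generators are
the same as products of generators and their inverses. -/
def Generates : Prop :=
  ∀ w : PauliWord n, ∃ k : ℕ,
    (Complex.I ^ k) • PauliWord.mat w ∈ Submonoid.closure (Set.range c.effectedWord)

/-- The parameters are independent and uniform on `[-π, π]`. -/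
def paramMeasure : MeasureTheory.Measure c.Params :=
  MeasureTheory.Measure.pi fun _ =>
    ProbabilityTheory.cond (MeasureTheory.volume : MeasureTheory.Measure ℝ)
      (Set.Icc (-Real.pi) Real.pi)

end Circuit

/-! ### Hamiltonians and input states, given by their non-zero components -/

/-- A real linear combination of distinct Pauli words. -/
structure Hamiltonian (n : ℕ) where
  terms : List (PauliWord n × ℝ)
  nodup : (terms.map Prod.fst).Nodup

/-- The matrix of a Hamiltonian. -/
def Hamiltonian.mat {n : ℕ} (H : Hamiltonian n) : QMat n :=
  (H.terms.map fun t => (t.2 : ℂ) • PauliWord.mat t.1).sum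

/-- The operator norm (largest singular value) of the Hamiltonian. -/
def Hamiltonian.opNorm {n : ℕ} (H : Hamiltonian n) : ℝ :=
  ‖Matrix.toEuclideanCLM (n := Bits n) (𝕜 := ℂ) H.mat‖

/-- The matrix `∑ ρ_{a,b} |a⟩⟨b|` with the listed entries. -/
def entriesMat {n : ℕ} (l : List ((Bits n × Bits n) × ℂ)) : QMat n :=
  (l.map fun e => Matrix.single e.1.1 e.1.2 e.2).sum

open scoped ComplexOrder in
/-- A density matrix, given by a list of its entries at distinct positions which contains all
non-zero entries. -/
structure InputState (n : ℕ) where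
  entries : List ((Bits n × Bits n) × ℂ)
  nodup : (entries.map Prod.fst).Nodup
  posSemidef : (entriesMat entries).PosSemidef
  trace_eq_one : (entriesMat entries).trace = 1

/-- The density matrix. -/
def InputState.mat {n : ℕ} (ρ : InputState n) : QMat n := entriesMat ρ.entries

/-! ### Depolarizing noise, noisy cost function, Pauli paths -/

/-- The single-qubit depolarizing channel `φ ↦ (1-λ) φ + λ (Tr φ / 2) 𝕀`. -/
def depolarize (lam : ℝ) (φ : QubitMat) : QubitMat :=
  ((1 - lam : ℝ) : ℂ) • φ + ((lam : ℂ) * (φ.trace / 2)) • (1 : QubitMat)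

/-- The channel `𝒩^{⊗n}`: the linear map which sends a tensor product of matrix units
`|u⟩⟨v| = ⊗_j |u_j⟩⟨v_j|` to `⊗_j 𝒩(|u_j⟩⟨v_j|)`. -/
def noise {n : ℕ} (lam : ℝ) (φ : QMat n) : QMat n :=
  ∑ u, ∑ v, φ u v • tensor fun j => depolarize lam (Matrix.single (u j) (v j) 1)

variable {n L : ℕ}

/-- The noisy state after the first `k` layers; noise acts before each layer. -/
def noisyState (lam : ℝ) (c : Circuit n L) (ρ : InputState n) (θ : c.Params) : ℕ → QMat n
  | 0 => ρ.mat
  | k + 1 =>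
      if h : k < L then
        c.layerUnitary θ ⟨k, h⟩ * noise lam (noisyState lam c ρ θ k) *
          (c.layerUnitary θ ⟨k, h⟩).conjTranspose
      else noisyState lam c ρ θ k

/-- The noisy cost function `Tr[H 𝒩^{⊗n}(𝒰_L 𝒩^{⊗n}(⋯ 𝒰_1 𝒩^{⊗n}(ρ) 𝒰_1† ⋯) 𝒰_L†)]`. -/
def noisyCost (lam : ℝ) (c : Circuit n L) (H : Hamiltonian n) (ρ : InputState n)
    (θ : c.Params) : ℂ :=
  (H.mat * noise lam (noisyState lam c ρ θ L)).trace

/-- Pauli paths `(s_0, …, s_L)`. -/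
abbrev PauliPath (n L : ℕ) := Fin (L + 1) → PauliWord n

/-- The Hamming weight of a Pauli path. -/
def PauliPath.weight (s : PauliPath n L) : ℕ := ∑ i, PauliWord.weight (s i)

/-- The contribution of a Pauli path to the noisy cost function. -/
def noisyContribution (lam : ℝ) (c : Circuit n L) (H : Hamiltonian n) (ρ : InputState n)
    (θ : c.Params) (s : PauliPath n L) : ℂ :=
  (H.mat * noise lam (PauliWord.normMat (s (Fin.last L)))).trace *
    (∏ i : Fin L, (PauliWord.normMat (s i.succ) *
      (c.layerUnitary θ i * noise lam (PauliWord.normMat (s i.castSucc)) *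
        (c.layerUnitary θ i).conjTranspose)).trace) *
    (PauliWord.normMat (s 0) * ρ.mat).trace

/-- The truncated Pauli-path sum over all paths of Hamming weight at most `M`. -/
def truncatedCost (lam : ℝ) (c : Circuit n L) (H : Hamiltonian n) (ρ : InputState n) (M : ℕ)
    (θ : c.Params) : ℂ :=
  ∑ s : PauliPath n L with PauliPath.weight s ≤ M, noisyContribution lam c H ρ θ s

/-! ### A model of computation with a step count

First-order recursive programs over binary trees (pure LISP with call-by-value), with exact real
numbers as atoms. Building and taking apart a pair, a conditional, a function call, and
`+`, `-`, `*`, `<` on real numbers all count as one step. The only real constants are `0` and `1`,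
and there is neither rounding nor division. Angles are a separate kind of atom: a program can only
read off their cosine and their sine. -/

/-- Data: binary trees with real numbers and angles as atoms. -/
inductive Val
  | nil
  | real (r : ℝ)
  | angle (θ : ℝ)
  | pair (a b : Val)

/-- The real number stored in an atom (`0` for all other data). -/
def Val.toReal : Val → ℝ
  | .real r => r
  | _ => 0

/-- Truth values: `nil` is false, all other data count as true. -/
def Val.ofBool : Bool → Val
  | false => .nil
  | true => .pair .nil .nil

/-- Constants. -/
inductive Const
  | nil | zero | one

/-- The value of a constant. -/
def Const.val : Const → Val
  | .nil => .nil
  | .zero => .real 0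
  | .one => .real 1

/-- Unary operations. -/
inductive UnOp
  | fst | snd | cos | sin

/-- Effect of a unary operation (`nil` on data of the wrong kind). -/
def UnOp.apply : UnOp → Val → Val
  | .fst, .pair a _ => a
  | .snd, .pair _ b => b
  | .cos, .angle θ => .real (Real.cos θ)
  | .sin, .angle θ => .real (Real.sin θ)
  | _, _ => .nil

/-- Binary operations. -/
inductive BinOp
  | pair | add | sub | mul | lt

/-- Effect of a binary operation. -/
def BinOp.apply : BinOp → Val → Val → Val
  | .pair, a, b => .pair a b
  | .add, a, b => .real (a.toReal + b.toReal)
  | .sub, a, b => .real (a.toReal - b.toReal)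
  | .mul, a, b => .real (a.toReal * b.toReal)
  | .lt, a, b => Val.ofBool (decide (a.toReal < b.toReal))

/-- Expressions; variables are de Bruijn indices into the environment. -/
inductive Expr
  | var (i : ℕ)
  | const (k : Const)
  | un (o : UnOp) (e : Expr)
  | bin (o : BinOp) (e₁ e₂ : Expr)
  | cond (e e₁ e₂ : Expr)
  | bind (e₁ e₂ : Expr)
  | call (f : ℕ) (e : Expr)

/-- A program is a finite list of bodies of mutually recursive functions of one argument. The
argument is variable `0` of the body; function `0` is the main function. -/
abbrev Program := List Expr

/-- `Eval P env e v t`: in the environment `env`, the expression `e` evaluates to `v` in exactly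
`t` steps. Every node of the expression that is visited counts as one step. -/
inductive Eval (P : Program) : List Val → Expr → Val → ℕ → Prop
  | var (env : List Val) (i : ℕ) : Eval P env (.var i) (env.getD i .nil) 1
  | const (env : List Val) (k : Const) : Eval P env (.const k) k.val 1
  | un {env : List Val} {e : Expr} {v : Val} {t : ℕ} (o : UnOp) (h : Eval P env e v t) :
      Eval P env (.un o e) (o.apply v) (t + 1)
  | bin {env : List Val} {e₁ e₂ : Expr} {v₁ v₂ : Val} {t₁ t₂ : ℕ} (o : BinOp)
      (h₁ : Eval P env e₁ v₁ t₁) (h₂ : Eval P env e₂ v₂ t₂) :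
      Eval P env (.bin o e₁ e₂) (o.apply v₁ v₂) (t₁ + t₂ + 1)
  | condTrue {env : List Val} {e e₁ e₂ : Expr} {b v : Val} {t t₁ : ℕ}
      (h : Eval P env e b t) (hb : b ≠ .nil) (h₁ : Eval P env e₁ v t₁) :
      Eval P env (.cond e e₁ e₂) v (t + t₁ + 1)
  | condFalse {env : List Val} {e e₁ e₂ : Expr} {v : Val} {t t₂ : ℕ}
      (h : Eval P env e .nil t) (h₂ : Eval P env e₂ v t₂) :
      Eval P env (.cond e e₁ e₂) v (t + t₂ + 1)
  | bind {env : List Val} {e₁ e₂ : Expr} {v₁ v₂ : Val} {t₁ t₂ : ℕ}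
      (h₁ : Eval P env e₁ v₁ t₁) (h₂ : Eval P (v₁ :: env) e₂ v₂ t₂) :
      Eval P env (.bind e₁ e₂) v₂ (t₁ + t₂ + 1)
  | call {env : List Val} {f : ℕ} {e body : Expr} {v₁ v₂ : Val} {t₁ t₂ : ℕ}
      (h₁ : Eval P env e v₁ t₁) (hf : P[f]? = some body) (h₂ : Eval P [v₁] body v₂ t₂) :
      Eval P env (.call f e) v₂ (t₁ + t₂ + 1)

/-- On the given input, the program `P` halts with the given output after `t` steps. -/
def Program.Runs (P : Program) (input output : Val) (t : ℕ) : Prop :=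
  Eval P [input] (.call 0 (.var 0)) output t

/-! ### Encoding of the input -/

/-- Lists as right-nested pairs. -/
def encList : List Val → Val
  | [] => .nil
  | v :: l => .pair v (encList l)

/-- Natural numbers in unary. -/
def encNat (k : ℕ) : Val := encList (List.replicate k .nil)

/-- A Pauli matrix as a pair of bits (`X`-part, `Z`-part). -/
def encPauli : Pauli → Val
  | .I => .pair (Val.ofBool false) (Val.ofBool false)
  | .X => .pair (Val.ofBool true) (Val.ofBool false)
  | .Y => .pair (Val.ofBool true) (Val.ofBool true)
  | .Z => .pair (Val.ofBool false) (Val.ofBool true)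

/-- A Pauli word as a list of length `n`. -/
def encWord (w : PauliWord n) : Val := encList (List.ofFn fun j => encPauli (w j))

/-- A basis label as a list of `n` bits. -/
def encBits (x : Bits n) : Val := encList (List.ofFn fun j => Val.ofBool (decide (x j = 1)))

/-- A Clifford gate as a tag followed by the qubits it acts on. -/
def encGate : CliffordGate n → Val
  | .hadamard a => encList [encNat 0, encNat a]
  | .phase a => encList [encNat 1, encNat a]
  | .cnot a b _ => encList [encNat 2, encNat a, encNat b]

/-- A layer: the list of its rotations (Pauli word and angle) and the list of its Clifford
gates. -/
def encLayer (c : Circuit n L) (θ : c.Params) (i : Fin L) : Val :=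
  .pair (encList (List.ofFn fun j => .pair (encWord (c.word i j)) (.angle (θ ⟨i, j⟩))))
    (encList (List.ofFn fun k => encGate (c.gate i k)))

/-- The Hamiltonian as a list of Pauli words with coefficients. -/
def encHamiltonian (H : Hamiltonian n) : Val :=
  encList (H.terms.map fun t => .pair (encWord t.1) (.real t.2))

/-- The input state as a list of positions with the real and imaginary part of the entry. -/
def encState (ρ : InputState n) : Val :=
  encList (ρ.entries.map fun e =>
    .pair (.pair (encBits e.1.1) (encBits e.1.2)) (.pair (.real e.2.re) (.real e.2.im)))

/-- The complete input of the algorithm: the noise rate, the accuracy, the failure probability, the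
number of qubits, the circuit with its parameters, the Hamiltonian and the input state. -/
def encInput (lam ε δ : ℝ) (c : Circuit n L) (H : Hamiltonian n) (ρ : InputState n)
    (θ : c.Params) : Val :=
  encList [.real lam, .real ε, .real δ, encNat n, encList (List.ofFn fun i => encLayer c θ i),
    encHamiltonian H, encState ρ]

end NoisyVQA

end

/-! In the Heisenberg picture a Pauli word `w` passes through Clifford gates as a single signed
word. Through `exp(-iθσ/2)` it passes unchanged if it commutes with `σ`, and becomes `cos θ · w ±
sin θ · σw` otherwise. The depolarizing channel is diagonal in the Pauli basis, with eigenvalue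
`(1-λ)^weight`. Hence the noisy cost is exactly the sum over Pauli paths of `(1-λ)^|s|` times a
noiseless amplitude (`noisyCost_eq_sum`), and truncation discards only strongly damped paths.

Error: every amplitude is a constant times a monomial with one factor `1`, `cos θ_p` or `sin θ_p`
per parameter (`pathAmplitude_eq_prod`). If two paths with non-zero constants have the same
monomial, their wordwise product is a sequence of words which commutes with all rotations and is
transported by the Clifford gates alone. Since the conjugated rotation words generate all words,
this sequence is trivial and the paths agree (`path_eq_of_kind_eq`). So distinct paths are
orthogonal in `L²` of the parameters, and the mean square error is at most `(1-λ)^(2M+2)` times the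
sum of the squared amplitudes. That sum is at most `∑ c_k²`, because layers act orthogonally on the
Pauli basis, and `∑ c_k² ≤ ‖H‖²`. Chebyshev's inequality gives the probability bound as soon as
`(1-λ)^(2M+2) ∑ c_k² ≤ ε²δ`.

Running time: the algorithm takes the least such `M` and propagates a list of weighted words back
through the layers, each word with a remaining weight budget. The rotations of a layer have disjoint
supports, so a word of weight `k` anticommutes with at most `k` of them and splits into at most
`2^k` words, while its budget drops by `k`. Thus the sum of `2^budget` over the list never increases
(`potential_layersFold`), and the list never has more than `2^M` items per term of `H`. Minimality
of `M` bounds `2^M` by `1 + (‖H‖/(ε√δ))^κ`, where `(1-λ)^κ < 1/2` (`two_pow_le`); for fixed `λ` this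
is polynomial. -/

noncomputable section

/-! ### Algebra of Pauli words: products, orthogonality, commutation. -/

namespace NoisyVQA

/-! ### Multiplication of Pauli words up to phases -/

/-- The product of two Pauli matrices up to a phase. -/
def Pauli.mul : Pauli → Pauli → Pauli
  | .I, p => p
  | p, .I => p
  | .X, .X => .I
  | .X, .Y => .Z
  | .X, .Z => .Y
  | .Y, .X => .Z
  | .Y, .Y => .I
  | .Y, .Z => .X
  | .Z, .X => .Y
  | .Z, .Y => .X
  | .Z, .Z => .I

/-- The phase of the product of two Pauli matrices. -/
def Pauli.phase : Pauli → Pauli → ℂ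
  | .X, .Y => Complex.I
  | .Y, .Z => Complex.I
  | .Z, .X => Complex.I
  | .Y, .X => -Complex.I
  | .Z, .Y => -Complex.I
  | .X, .Z => -Complex.I
  | _, _ => 1

theorem Pauli.mat_mul_mat (p q : Pauli) : p.mat * q.mat = p.phase q • (p.mul q).mat := by
  cases p <;> cases q <;> ext i j <;> fin_cases i <;> fin_cases j <;>
    simp [Pauli.mat, Pauli.phase, Pauli.mul, Matrix.mul_apply]

theorem Pauli.mul_assoc : ∀ a b c : Pauli, (a.mul b).mul c = a.mul (b.mul c) := by decide

theorem Pauli.mul_comm : ∀ a b : Pauli, a.mul b = b.mul a := by decide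

theorem Pauli.mul_self : ∀ a : Pauli, a.mul a = .I := by decide

theorem Pauli.mul_I : ∀ a : Pauli, a.mul .I = a := by decide

theorem Pauli.mul_eq_I : ∀ a b : Pauli, a.mul b = .I → a = b := by decide

theorem Pauli.mul_mul_mul_comm :
    ∀ a b c d : Pauli, (a.mul b).mul (c.mul d) = (a.mul c).mul (b.mul d) := by decide

theorem Pauli.conjTranspose_mat (p : Pauli) : p.mat.conjTranspose = p.mat := by
  cases p <;> ext i j <;> fin_cases i <;> fin_cases j <;> simp [Pauli.mat]

theorem Pauli.trace_mat (p : Pauli) : p.mat.trace = if p = .I then 2 else 0 := by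
  cases p <;> simp [Pauli.mat, Matrix.trace]

theorem Pauli.phase_self (p : Pauli) : p.phase p = 1 := by cases p <;> rfl

theorem Pauli.sum_univ {M : Type*} [AddCommMonoid M] (f : Pauli → M) :
    ∑ p, f p = f .I + (f .X + (f .Y + f .Z)) := by
  have h : (Finset.univ : Finset Pauli) = {.I, .X, .Y, .Z} := rfl
  rw [h, Finset.sum_insert (by decide), Finset.sum_insert (by decide),
    Finset.sum_insert (by decide), Finset.sum_singleton]

/-- This is `∑ P ⊗ P = 2 · SWAP` in coordinates, the one-qubit completeness relation from which the
`n`-qubit one follows by taking products. -/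
theorem Pauli.sum_mat_mul_mat (a b c d : Fin 2) :
    ∑ p : Pauli, p.mat a b * p.mat c d = if a = d ∧ b = c then 2 else 0 := by
  rw [Pauli.sum_univ]
  fin_cases a <;> fin_cases b <;> fin_cases c <;> fin_cases d <;> norm_num [Pauli.mat]

/-- The product of two Pauli words up to a phase. -/
def PauliWord.mul {n : ℕ} (v w : PauliWord n) : PauliWord n := fun j => (v j).mul (w j)

/-- The phase of the product of two Pauli words. -/
def PauliWord.phase {n : ℕ} (v w : PauliWord n) : ℂ := ∏ j, (v j).phase (w j)

/-- The identity word. -/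
def PauliWord.one (n : ℕ) : PauliWord n := fun _ => .I

variable {n : ℕ}

theorem PauliWord.mul_self (w : PauliWord n) : w.mul w = PauliWord.one n :=
  funext fun _ => Pauli.mul_self _

theorem PauliWord.mul_one (w : PauliWord n) : w.mul (PauliWord.one n) = w :=
  funext fun _ => Pauli.mul_I _

theorem PauliWord.mul_comm (v w : PauliWord n) : v.mul w = w.mul v :=
  funext fun _ => Pauli.mul_comm _ _

theorem PauliWord.mul_assoc (u v w : PauliWord n) : (u.mul v).mul w = u.mul (v.mul w) :=
  funext fun _ => Pauli.mul_assoc _ _ _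

theorem PauliWord.eq_of_mul_eq_one {v w : PauliWord n} (h : v.mul w = PauliWord.one n) : v = w :=
  funext fun j => Pauli.mul_eq_I _ _ (congrFun h j)

/-! ### Tensor products -/

theorem tensor_mul (A B : Fin n → QubitMat) :
    tensor A * tensor B = tensor fun j => A j * B j := by
  ext x y
  simp only [tensor, Matrix.mul_apply, Matrix.of_apply, Finset.prod_univ_sum,
    Fintype.piFinset_univ, Finset.prod_mul_distrib]

theorem conjTranspose_tensor (A : Fin n → QubitMat) :
    (tensor A).conjTranspose = tensor fun j => (A j).conjTranspose := by
  ext x y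
  simp [tensor, Matrix.conjTranspose_apply]

theorem trace_tensor (A : Fin n → QubitMat) : (tensor A).trace = ∏ j, (A j).trace := by
  simp only [tensor, Matrix.trace, Matrix.diag_apply, Matrix.of_apply, Finset.prod_univ_sum,
    Fintype.piFinset_univ]

theorem tensor_smul (s : Fin n → ℂ) (A : Fin n → QubitMat) :
    (tensor fun j => s j • A j) = (∏ j, s j) • tensor A := by
  ext x y
  simp [tensor, Finset.prod_mul_distrib]

theorem tensor_one : (tensor fun _ : Fin n => (1 : QubitMat)) = 1 := by
  ext x y
  simp only [tensor, Matrix.of_apply, Matrix.one_apply, Finset.prod_ite_zero, funext_iff]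
  simp

theorem PauliWord.mat_one : (PauliWord.one n).mat = 1 := tensor_one

theorem PauliWord.mat_mul_mat (v w : PauliWord n) :
    v.mat * w.mat = v.phase w • (v.mul w).mat := by
  simp only [PauliWord.mat, tensor_mul, Pauli.mat_mul_mat, tensor_smul]
  rfl

theorem PauliWord.mat_mul_self (w : PauliWord n) : w.mat * w.mat = 1 := by
  rw [PauliWord.mat_mul_mat, PauliWord.mul_self, PauliWord.mat_one]
  simp [PauliWord.phase, Pauli.phase_self]

theorem PauliWord.conjTranspose_mat (w : PauliWord n) : w.mat.conjTranspose = w.mat := by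
  simp [PauliWord.mat, conjTranspose_tensor, Pauli.conjTranspose_mat]

theorem PauliWord.trace_mat (w : PauliWord n) :
    w.mat.trace = if w = PauliWord.one n then 2 ^ n else 0 := by
  simp only [PauliWord.mat, trace_tensor, Pauli.trace_mat, Finset.prod_ite_zero, funext_iff,
    PauliWord.one]
  simp

theorem PauliWord.phase_self (w : PauliWord n) : w.phase w = 1 := by
  simp [PauliWord.phase, Pauli.phase_self]

/-- The product of two distinct words is a phase times a non-identity word, and such a word has a
traceless tensor factor. -/
theorem PauliWord.trace_mat_mul_mat (v w : PauliWord n) :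
    (v.mat * w.mat).trace = if v = w then 2 ^ n else 0 := by
  rw [PauliWord.mat_mul_mat, Matrix.trace_smul, PauliWord.trace_mat]
  by_cases h : v = w
  · subst h
    simp [PauliWord.mul_self, PauliWord.phase_self]
  · rw [if_neg h, if_neg fun h' => h (PauliWord.eq_of_mul_eq_one h'), smul_zero]

theorem PauliWord.mat_ne_zero (w : PauliWord n) : w.mat ≠ 0 := by
  intro h
  have := w.trace_mat_mul_mat w
  rw [h, zero_mul, Matrix.trace_zero, if_pos rfl] at this
  exact pow_ne_zero n two_ne_zero this.symm

/-- Completeness of the Pauli basis, entrywise. -/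
theorem PauliWord.sum_mat_mul_mat (x y u v : Bits n) :
    ∑ w : PauliWord n, w.mat x y * w.mat u v = if x = v ∧ y = u then 2 ^ n else 0 := by
  have h : ∑ w : PauliWord n, w.mat x y * w.mat u v =
      ∏ j, ∑ p : Pauli, p.mat (x j) (y j) * p.mat (u j) (v j) := by
    rw [Finset.prod_univ_sum, Fintype.piFinset_univ]
    simp only [PauliWord.mat, tensor, Matrix.of_apply, Finset.prod_mul_distrib]
  rw [h]
  simp only [Pauli.sum_mat_mul_mat, Finset.prod_ite_zero, funext_iff, ← forall_and]
  simp

/-- Expansion of a matrix in the Pauli basis. -/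
theorem PauliWord.sum_trace_smul (A : QMat n) :
    ∑ w : PauliWord n, (w.mat * A).trace • w.mat = (2 ^ n : ℂ) • A := by
  ext u v
  simp only [Matrix.sum_apply, Matrix.smul_apply, smul_eq_mul, Matrix.trace, Matrix.diag_apply,
    Matrix.mul_apply, Finset.sum_mul]
  rw [Finset.sum_comm]
  have : ∀ x : Bits n, ∑ w : PauliWord n, ∑ y, w.mat x y * A y x * w.mat u v =
      ∑ y, A y x * if x = v ∧ y = u then 2 ^ n else 0 := by
    intro x
    rw [Finset.sum_comm]
    refine Finset.sum_congr rfl fun y _ => ?_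
    rw [← PauliWord.sum_mat_mul_mat, Finset.mul_sum]
    exact Finset.sum_congr rfl fun w _ => by ring
  simp only [this, ite_and]
  simp [_root_.mul_comm]

/-- Parseval's identity for the Pauli basis. -/
theorem PauliWord.sum_trace_mul_trace (A B : QMat n) :
    ∑ w : PauliWord n, (w.mat * A).trace * (w.mat * B).trace = 2 ^ n * (A * B).trace := by
  rw [← smul_eq_mul (2 ^ n : ℂ), ← Matrix.trace_smul, ← Matrix.smul_mul,
    ← PauliWord.sum_trace_smul, Finset.sum_mul, Matrix.trace_sum]
  simp only [Matrix.smul_mul, Matrix.trace_smul, smul_eq_mul]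

/-! ### Commutation of Pauli words -/

theorem PauliWord.phase_mem (v w : PauliWord n) :
    v.phase w = 1 ∨ v.phase w = -1 ∨ v.phase w = Complex.I ∨ v.phase w = -Complex.I := by
  unfold PauliWord.phase
  refine Finset.prod_induction _
    (fun z : ℂ => z = 1 ∨ z = -1 ∨ z = Complex.I ∨ z = -Complex.I) ?_ (by simp) ?_
  · rintro a b (rfl | rfl | rfl | rfl) (rfl | rfl | rfl | rfl) <;> simp
  · intro j _
    cases v j <;> cases w j <;> simp [Pauli.phase]

theorem Pauli.phase_comm (p q : Pauli) : q.phase p = starRingEnd ℂ (p.phase q) := by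
  cases p <;> cases q <;> simp [Pauli.phase]

theorem PauliWord.phase_comm (v w : PauliWord n) : w.phase v = starRingEnd ℂ (v.phase w) := by
  simp only [PauliWord.phase, map_prod]
  exact Finset.prod_congr rfl fun j _ => Pauli.phase_comm _ _

/-- The sign of the Pauli word `i v w` if `v` and `w` anticommute, and zero if they commute. -/
def PauliWord.sgn (v w : PauliWord n) : ℝ := (Complex.I * v.phase w).re

/-- Phases lie in `{±1, ±i}`, and exchanging the factors conjugates them: two words commute if the
phase is real and anticommute if it is imaginary. `sgn` is minus the imaginary part of the phase. -/
theorem PauliWord.mat_comm_of_sgn_eq_zero {v w : PauliWord n} (h : v.sgn w = 0) :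
    v.mat * w.mat = w.mat * v.mat := by
  rw [PauliWord.mat_mul_mat, PauliWord.mat_mul_mat, PauliWord.mul_comm w v,
    PauliWord.phase_comm v w]
  rcases v.phase_mem w with h' | h' | h' | h' <;> simp [PauliWord.sgn, h'] at h ⊢

theorem PauliWord.mat_anticomm_of_sgn_ne_zero {v w : PauliWord n} (h : v.sgn w ≠ 0) :
    v.mat * w.mat = -(w.mat * v.mat) := by
  rw [PauliWord.mat_mul_mat, PauliWord.mat_mul_mat, PauliWord.mul_comm w v,
    PauliWord.phase_comm v w]
  rcases v.phase_mem w with h' | h' | h' | h' <;> simp [PauliWord.sgn, h'] at h ⊢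

/-- In the anticommuting case `i` times the phase is already real, so taking the real part loses
nothing. This is why all coefficients of the evolution are real. -/
theorem PauliWord.I_mul_phase {v w : PauliWord n} (h : v.sgn w ≠ 0) :
    Complex.I * v.phase w = (v.sgn w : ℂ) := by
  rcases v.phase_mem w with h' | h' | h' | h' <;> simp [PauliWord.sgn, h'] at h ⊢

theorem PauliWord.sgn_eq_zero_iff {v w : PauliWord n} :
    v.sgn w = 0 ↔ v.mat * w.mat = w.mat * v.mat := by
  refine ⟨PauliWord.mat_comm_of_sgn_eq_zero, fun h => ?_⟩
  by_contra h'
  have h1 := PauliWord.mat_anticomm_of_sgn_ne_zero h'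
  -- Words that both commute and anticommute would have a vanishing product, but a product is a
  -- phase times a word.
  rw [h, eq_neg_iff_add_eq_zero, ← two_smul ℂ, PauliWord.mat_mul_mat] at h1
  rcases w.phase_mem v with h2 | h2 | h2 | h2 <;>
    simp [h2, PauliWord.mat_ne_zero] at h1

/-- Words with disjoint supports commute. -/
theorem PauliWord.sgn_eq_zero_of_disjoint {v w : PauliWord n}
    (h : Disjoint v.support w.support) : v.sgn w = 0 := by
  have : v.phase w = 1 := by
    refine Finset.prod_eq_one fun j _ => ?_
    have hj : v j = .I ∨ w j = .I := by
      by_contra! hj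
      exact Finset.disjoint_left.1 h (by simpa [PauliWord.support] using hj.1)
        (by simpa [PauliWord.support] using hj.2)
    rcases hj with hj | hj <;> rw [hj]
    · rfl
    · cases v j <;> rfl
  simp [PauliWord.sgn, this]

/-- Commutation with `v` only depends on the class of a product. -/
theorem PauliWord.sgn_mul_eq_zero {u v w : PauliWord n} (h : u.sgn v = 0 ↔ u.sgn w = 0) :
    u.sgn (v.mul w) = 0 := by
  have key : u.mat * (v.mat * w.mat) = (v.mat * w.mat) * u.mat := by
    by_cases hv : u.sgn v = 0
    · rw [← _root_.mul_assoc, PauliWord.mat_comm_of_sgn_eq_zero hv, _root_.mul_assoc,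
        PauliWord.mat_comm_of_sgn_eq_zero (h.1 hv), _root_.mul_assoc]
    · rw [← _root_.mul_assoc, PauliWord.mat_anticomm_of_sgn_ne_zero hv, neg_mul, _root_.mul_assoc,
        PauliWord.mat_anticomm_of_sgn_ne_zero (mt h.2 hv), mul_neg, neg_neg, _root_.mul_assoc]
  rw [PauliWord.mat_mul_mat, Matrix.mul_smul, Matrix.smul_mul] at key
  rw [PauliWord.sgn_eq_zero_iff]
  rcases v.phase_mem w with h2 | h2 | h2 | h2 <;> simpa [h2, Complex.I_ne_zero] using key

/-- Multiplication with `v` is an involution that preserves commutation with `u`. Applied to the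
disjoint rotations of one layer, it shows that a branching at one rotation does not affect which
others branch. -/
theorem PauliWord.sgn_mul_of_sgn_eq_zero {u v w : PauliWord n} (h : u.sgn v = 0) :
    u.sgn (v.mul w) = 0 ↔ u.sgn w = 0 := by
  refine ⟨fun h' => ?_, fun h' => PauliWord.sgn_mul_eq_zero (by simp [h, h'])⟩
  have := PauliWord.sgn_mul_eq_zero (u := u) (v := v) (w := v.mul w) (by simp [h, h'])
  rwa [← PauliWord.mul_assoc, PauliWord.mul_self, PauliWord.mul_comm, PauliWord.mul_one] at this

/-- A word which commutes with every word is the identity. -/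
theorem PauliWord.eq_one_of_forall_comm {w : PauliWord n}
    (h : ∀ v : PauliWord n, w.mat * v.mat = v.mat * w.mat) : w = PauliWord.one n := by
  funext j
  by_contra hj
  -- Testing with words supported on the qubit `j` alone reduces the claim to one qubit, where only
  -- the identity commutes with both `X` and `Z`.
  have key : ∀ p : Pauli, (w j).phase p = p.phase (w j) := by
    intro p
    have h1 := h (Function.update (PauliWord.one n) j p)
    rw [← PauliWord.sgn_eq_zero_iff] at h1
    have h2 : w.phase (Function.update (PauliWord.one n) j p) = (w j).phase p := by
      rw [PauliWord.phase, Finset.prod_eq_single j, Function.update_self]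
      · intro i _ hi
        rw [Function.update_of_ne hi]
        cases w i <;> rfl
      · simp
    rw [Pauli.phase_comm (w j) p, ← h2]
    rcases w.phase_mem (Function.update (PauliWord.one n) j p) with h' | h' | h' | h' <;>
      simp [PauliWord.sgn, h'] at h1 ⊢
  change w j ≠ .I at hj
  have hX := key .X
  have hZ := key .Z
  cases hw : w j <;> simp_all [Pauli.phase, self_eq_neg, neg_eq_self]

end NoisyVQA
end

/-! ### Heisenberg action of single gates on Pauli words. -/

noncomputable section

namespace NoisyVQA

variable {n : ℕ}

/-! ### Conjugation of Pauli words with Clifford gates -/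

/-- Conjugation with the Hadamard gate, up to sign. -/
def Pauli.hadamardAct : Pauli → Pauli
  | .I => .I
  | .X => .Z
  | .Y => .Y
  | .Z => .X

/-- The sign of the conjugation with the Hadamard gate. -/
def Pauli.hadamardSign : Pauli → ℝ
  | .Y => -1
  | _ => 1

/-- Conjugation with the phase gate, up to sign. -/
def Pauli.phaseAct : Pauli → Pauli
  | .I => .I
  | .X => .Y
  | .Y => .X
  | .Z => .Z

/-- The sign of the conjugation with the phase gate. -/
def Pauli.phaseSign : Pauli → ℝ
  | .X => -1
  | _ => 1

/-- The factor at the control qubit after conjugation with the CNOT gate. -/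
def Pauli.controlAct : Pauli → Pauli → Pauli
  | p, .Y => Pauli.Z.mul p
  | p, .Z => Pauli.Z.mul p
  | p, _ => p

/-- The factor at the target qubit after conjugation with the CNOT gate. -/
def Pauli.targetAct : Pauli → Pauli → Pauli
  | .X, q => Pauli.X.mul q
  | .Y, q => Pauli.X.mul q
  | _, q => q

/-- The sign of the conjugation with the CNOT gate. -/
def Pauli.cnotSign : Pauli → Pauli → ℝ
  | .X, .Z => -1
  | .Y, .Y => -1
  | _, _ => 1

/-- Conjugation of a Pauli word with a Clifford gate, up to sign. -/
def CliffordGate.act : CliffordGate n → PauliWord n → PauliWord n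
  | .hadamard a, w => Function.update w a (w a).hadamardAct
  | .phase a, w => Function.update w a (w a).phaseAct
  | .cnot a b _, w =>
      Function.update (Function.update w b ((w a).targetAct (w b))) a ((w a).controlAct (w b))

/-- The sign of the conjugation of a Pauli word with a Clifford gate. -/
def CliffordGate.sign : CliffordGate n → PauliWord n → ℝ
  | .hadamard a, w => (w a).hadamardSign
  | .phase a, w => (w a).phaseSign
  | .cnot a b _, w => (w a).cnotSign (w b)

/-- The phase gate is not an involution, but its square `Z` changes only signs, which `act` forgets.
Injectivity of `gatesAct` rests on this. -/
theorem CliffordGate.act_act (g : CliffordGate n) (w : PauliWord n) : g.act (g.act w) = w := by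
  cases g with
  | hadamard a =>
    have h : ∀ p : Pauli, p.hadamardAct.hadamardAct = p := by decide
    simp [CliffordGate.act, h]
  | phase a =>
    have h : ∀ p : Pauli, p.phaseAct.phaseAct = p := by decide
    simp [CliffordGate.act, h]
  | cnot a b hab =>
    have h1 : ∀ p q : Pauli, (p.controlAct q).controlAct (p.targetAct q) = p := by decide
    have h2 : ∀ p q : Pauli, (p.controlAct q).targetAct (p.targetAct q) = q := by decide
    funext j
    by_cases hj : j = a
    · subst hj
      simp [CliffordGate.act, h1, Function.update_of_ne hab.symm]
    · by_cases hj' : j = b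
      · subst hj'
        simp [CliffordGate.act, h2, Function.update_of_ne hj]
      · simp [CliffordGate.act, Function.update_of_ne hj, Function.update_of_ne hj']

/-- Conjugation is multiplicative, and this survives dropping signs. It makes the wordwise product
of two paths evolve like a path. -/
theorem CliffordGate.act_mul (g : CliffordGate n) (v w : PauliWord n) :
    g.act (v.mul w) = (g.act v).mul (g.act w) := by
  cases g with
  | hadamard a =>
    have h : ∀ p q : Pauli, (p.mul q).hadamardAct = p.hadamardAct.mul q.hadamardAct := by decide
    funext j
    by_cases hj : j = a
    · subst hj
      simp [CliffordGate.act, PauliWord.mul, h]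
    · simp [CliffordGate.act, PauliWord.mul, Function.update_of_ne hj]
  | phase a =>
    have h : ∀ p q : Pauli, (p.mul q).phaseAct = p.phaseAct.mul q.phaseAct := by decide
    funext j
    by_cases hj : j = a
    · subst hj
      simp [CliffordGate.act, PauliWord.mul, h]
    · simp [CliffordGate.act, PauliWord.mul, Function.update_of_ne hj]
  | cnot a b hab =>
    have h1 : ∀ p q p' q' : Pauli, (p.mul p').controlAct (q.mul q') =
        (p.controlAct q).mul (p'.controlAct q') := by decide
    have h2 : ∀ p q p' q' : Pauli, (p.mul p').targetAct (q.mul q') =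
        (p.targetAct q).mul (p'.targetAct q') := by decide
    funext j
    by_cases hj : j = a
    · subst hj
      simp [CliffordGate.act, PauliWord.mul, h1]
    · by_cases hj' : j = b
      · subst hj'
        simp [CliffordGate.act, PauliWord.mul, h2, Function.update_of_ne hj]
      · simp [CliffordGate.act, PauliWord.mul, Function.update_of_ne hj, Function.update_of_ne hj']

theorem CliffordGate.act_eq_self {g : CliffordGate n} {w : PauliWord n}
    (h : Disjoint w.support g.support) : g.act w = w ∧ g.sign w = 1 := by
  have hI : ∀ j ∈ g.support, w j = .I := by
    intro j hj
    by_contra hw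
    exact Finset.disjoint_left.1 h (by simpa [PauliWord.support] using hw) hj
  cases g with
  | hadamard a =>
    have ha := hI a (by simp [CliffordGate.support])
    have h1 : Pauli.hadamardAct .I = .I := rfl
    refine ⟨?_, by simp [CliffordGate.sign, ha, Pauli.hadamardSign]⟩
    simp only [CliffordGate.act, ha, h1]
    rw [← ha, Function.update_eq_self]
  | phase a =>
    have ha := hI a (by simp [CliffordGate.support])
    have h1 : Pauli.phaseAct .I = .I := rfl
    refine ⟨?_, by simp [CliffordGate.sign, ha, Pauli.phaseSign]⟩
    simp only [CliffordGate.act, ha, h1]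
    rw [← ha, Function.update_eq_self]
  | cnot a b hab =>
    have ha := hI a (by simp [CliffordGate.support])
    have hb := hI b (by simp [CliffordGate.support])
    have h1 : Pauli.controlAct .I .I = .I := rfl
    have h2 : Pauli.targetAct .I .I = .I := rfl
    refine ⟨?_, by simp [CliffordGate.sign, ha, hb, Pauli.cnotSign]⟩
    simp only [CliffordGate.act, ha, hb, h1, h2]
    rw [← hb, Function.update_eq_self, hb, ← ha, Function.update_eq_self]

/-- The single-qubit Hadamard matrix. -/
def hadamardMat : QubitMat := ((Real.sqrt 2 : ℂ)⁻¹) • !![1, 1; 1, -1]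

theorem inv_sqrt_two_mul_self : ((Real.sqrt 2 : ℂ)⁻¹) * ((Real.sqrt 2 : ℂ)⁻¹) = 2⁻¹ := by
  rw [← mul_inv, ← Complex.ofReal_mul, Real.mul_self_sqrt (by norm_num)]
  norm_num

theorem hadamardMat_conj (p : Pauli) :
    hadamardMat.conjTranspose * p.mat * hadamardMat = (p.hadamardSign : ℂ) • p.hadamardAct.mat := by
  have h := inv_sqrt_two_mul_self
  simp only [hadamardMat, Matrix.conjTranspose_smul, Matrix.smul_mul, Matrix.mul_smul, smul_smul]
  have h' : star ((Real.sqrt 2 : ℂ)⁻¹) = (Real.sqrt 2 : ℂ)⁻¹ := by simp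
  rw [h', h]
  cases p <;> ext i j <;> fin_cases i <;> fin_cases j <;>
    simp [Pauli.mat, Pauli.hadamardAct, Pauli.hadamardSign, Matrix.mul_apply] <;> ring

theorem phaseMat_conj (p : Pauli) :
    (!![1, 0; 0, Complex.I] : QubitMat).conjTranspose * p.mat * !![1, 0; 0, Complex.I] =
      (p.phaseSign : ℂ) • p.phaseAct.mat := by
  cases p <;> ext i j <;> fin_cases i <;> fin_cases j <;>
    simp [Pauli.mat, Pauli.phaseAct, Pauli.phaseSign, Matrix.mul_apply]

theorem tensor_single_conj (a : Fin n) (A : QubitMat) (s : ℝ) (w : PauliWord n)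
    (p : Pauli) (h : A.conjTranspose * (w a).mat * A = (s : ℂ) • p.mat) :
    (tensor fun j => if j = a then A else 1).conjTranspose * w.mat *
      (tensor fun j => if j = a then A else 1) = (s : ℂ) • PauliWord.mat (Function.update w a p) := by
  rw [conjTranspose_tensor, PauliWord.mat, tensor_mul, tensor_mul]
  have h1 : (fun j => (if j = a then A else 1).conjTranspose * (w j).mat *
      (if j = a then A else 1)) = fun j => (if j = a then (s : ℂ) else 1) •
        (Function.update w a p j).mat := by
    funext j
    by_cases hj : j = a
    · subst hj
      simp [h]
    · simp [hj]
  rw [h1, tensor_smul, Finset.prod_ite_eq' Finset.univ a, if_pos (Finset.mem_univ _)]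
  rfl

/-- Here `x`, `y` are the row and column bits at the control and `u`, `v` those at the target; the
other qubits play no role. -/
theorem cnot_entry (p q : Pauli) (x y u v : Fin 2) :
    p.mat x y * q.mat (x + u) (y + v) =
      (p.cnotSign q : ℂ) * ((p.controlAct q).mat x y * (p.targetAct q).mat u v) := by
  cases p <;> cases q <;> fin_cases x <;> fin_cases y <;> fin_cases u <;> fin_cases v <;>
    simp [Pauli.mat, Pauli.cnotSign, Pauli.controlAct, Pauli.targetAct, Pauli.mul,
      Matrix.one_apply]

/-- The CNOT matrix is a permutation matrix, so conjugation only relabels rows and columns. -/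
theorem cnot_conj_apply (a b : Fin n) (h : a ≠ b) (A : QMat n) (x y : Bits n) :
    ((CliffordGate.cnot a b h).mat.conjTranspose * A * (CliffordGate.cnot a b h).mat) x y =
      A (Function.update x b (x a + x b)) (Function.update y b (y a + y b)) := by
  simp [CliffordGate.mat, Matrix.mul_apply, Matrix.conjTranspose_apply, apply_ite]

theorem CliffordGate.conj_mat (g : CliffordGate n) (w : PauliWord n) :
    g.mat.conjTranspose * w.mat * g.mat = (g.sign w : ℂ) • (g.act w).mat := by
  cases g with
  | hadamard a => exact tensor_single_conj a _ _ w _ (hadamardMat_conj (w a))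
  | phase a => exact tensor_single_conj a _ _ w _ (phaseMat_conj (w a))
  | cnot a b hab =>
    ext x y
    rw [cnot_conj_apply]
    simp only [PauliWord.mat, tensor, Matrix.smul_apply, Matrix.of_apply, smul_eq_mul,
      CliffordGate.act, CliffordGate.sign]
    -- Splitting the factors at `a` and `b` off the products over all qubits leaves the two-qubit
    -- identity `cnot_entry`.
    have hb : b ∈ Finset.univ.erase a := by simp [hab.symm]
    rw [← Finset.mul_prod_erase _ _ (Finset.mem_univ a), ← Finset.mul_prod_erase _ _ hb,
      ← Finset.mul_prod_erase _ _ (Finset.mem_univ a), ← Finset.mul_prod_erase _ _ hb]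
    simp only [Function.update_self, Function.update_of_ne hab, Function.update_of_ne hab.symm]
    rw [← _root_.mul_assoc, ← _root_.mul_assoc, ← _root_.mul_assoc, cnot_entry,
      _root_.mul_assoc (_ : ℂ) ((Pauli.controlAct _ _).mat _ _)]
    congr 1
    refine Finset.prod_congr rfl fun j hj => ?_
    simp only [Finset.mem_erase, Finset.mem_univ, and_true] at hj
    simp [Function.update_of_ne hj.1, Function.update_of_ne hj.2]

/-- Unitarity is the conjugation rule for the identity word. -/
theorem CliffordGate.conjTranspose_mul_mat (g : CliffordGate n) :
    g.mat.conjTranspose * g.mat = 1 := by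
  have h := g.conj_mat (PauliWord.one n)
  obtain ⟨h1, h2⟩ := CliffordGate.act_eq_self (g := g) (w := PauliWord.one n)
    (by simp [PauliWord.support, PauliWord.one])
  rwa [h1, h2, PauliWord.mat_one, Matrix.mul_one, Complex.ofReal_one, one_smul] at h

/-! ### Pauli rotations -/

/-- An involution splits the identity into the idempotents `(1 ± σ)/2`, so `(s, t) ↦ s(1+σ)/2 +
t(1-σ)/2` is a continuous ring homomorphism on `ℂ × ℂ`. The exponential commutes with it, and `z •
σ` is the image of `(z, -z)`. The norm on matrices is an auxiliary choice. -/
theorem exp_smul_involution (σ : QMat n) (h : σ * σ = 1) (z : ℂ) :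
    NormedSpace.exp (z • σ) = Complex.cosh z • (1 : QMat n) + Complex.sinh z • σ := by
  let _ : NormedRing (QMat n) := Matrix.linftyOpNormedRing
  let _ : NormedAlgebra ℂ (QMat n) := Matrix.linftyOpNormedAlgebra
  let f : ℂ × ℂ →+* QMat n :=
    { toFun := fun t => ((t.1 + t.2) / 2) • (1 : QMat n) + ((t.1 - t.2) / 2) • σ
      map_one' := by simp
      map_mul' := by
        intro s t
        simp only [Matrix.add_mul, Matrix.mul_add, Matrix.smul_mul, Matrix.mul_smul, Matrix.one_mul,
          Matrix.mul_one, h, Prod.fst_mul, Prod.snd_mul]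
        module
      map_zero' := by simp
      map_add' := by
        intro s t
        simp only [Prod.fst_add, Prod.snd_add]
        module }
  have hf : Continuous f := by
    change Continuous fun t : ℂ × ℂ => ((t.1 + t.2) / 2) • (1 : QMat n) + ((t.1 - t.2) / 2) • σ
    fun_prop
  have h1 : z • σ = f (z, -z) := by
    change z • σ = ((z + -z) / 2) • (1 : QMat n) + ((z - -z) / 2) • σ
    module
  rw [h1]
  refine (NormedSpace.map_exp f hf (z, -z)).symm.trans ?_
  change (((NormedSpace.exp (z, -z)).1 + (NormedSpace.exp (z, -z)).2) / 2) • (1 : QMat n) +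
    (((NormedSpace.exp (z, -z)).1 - (NormedSpace.exp (z, -z)).2) / 2) • σ = _
  rw [Prod.fst_exp, Prod.snd_exp, ← Complex.exp_eq_exp_ℂ, Complex.cosh, Complex.sinh]

theorem pauliRotation_eq (σ : PauliWord n) (θ : ℝ) :
    pauliRotation σ θ = (Real.cos (θ / 2) : ℂ) • (1 : QMat n) -
      (Complex.I * (Real.sin (θ / 2) : ℂ)) • σ.mat := by
  rw [pauliRotation, exp_smul_involution _ σ.mat_mul_self, Complex.cosh_neg, Complex.sinh_neg,
    _root_.mul_comm Complex.I, Complex.cosh_mul_I, Complex.sinh_mul_I, Complex.ofReal_cos,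
    Complex.ofReal_sin, neg_smul, ← sub_eq_add_neg, _root_.mul_comm Complex.I]

theorem conjTranspose_pauliRotation (σ : PauliWord n) (θ : ℝ) :
    (pauliRotation σ θ).conjTranspose = (Real.cos (θ / 2) : ℂ) • (1 : QMat n) +
      (Complex.I * (Real.sin (θ / 2) : ℂ)) • σ.mat := by
  rw [pauliRotation_eq, Matrix.conjTranspose_sub, Matrix.conjTranspose_smul,
    Matrix.conjTranspose_smul, Matrix.conjTranspose_one, σ.conjTranspose_mat]
  simp only [star_mul', Complex.star_def, Complex.conj_ofReal, Complex.conj_I, neg_mul, neg_smul,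
    sub_neg_eq_add]

theorem cos_half_sq (θ : ℝ) :
    (Real.cos (θ / 2) : ℂ) * Real.cos (θ / 2) + (Real.sin (θ / 2) : ℂ) * Real.sin (θ / 2) = 1 := by
  exact_mod_cast (by nlinarith [Real.sin_sq_add_cos_sq (θ / 2)] :
    Real.cos (θ / 2) * Real.cos (θ / 2) + Real.sin (θ / 2) * Real.sin (θ / 2) = 1)

theorem conjTranspose_mul_pauliRotation (σ : PauliWord n) (θ : ℝ) :
    (pauliRotation σ θ).conjTranspose * pauliRotation σ θ = 1 := by
  rw [conjTranspose_pauliRotation, pauliRotation_eq]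
  simp only [Matrix.add_mul, Matrix.mul_sub, Matrix.smul_mul, Matrix.mul_smul, Matrix.one_mul,
    Matrix.mul_one, σ.mat_mul_self]
  have h := cos_half_sq θ
  generalize (Real.cos (θ / 2) : ℂ) = c at *
  generalize (Real.sin (θ / 2) : ℂ) = s at *
  have h2 : Complex.I * s * (Complex.I * s) = -(s * s) := by
    linear_combination (s * s) * Complex.I_mul_I
  simp only [smul_add, smul_smul, h2]
  calc _ = (c * c + s * s) • (1 : QMat n) := by module
    _ = 1 := by rw [h, one_smul]

theorem pauliRotation_conj_of_comm {σ w : PauliWord n} (h : σ.sgn w = 0) (θ : ℝ) :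
    (pauliRotation σ θ).conjTranspose * w.mat * pauliRotation σ θ = w.mat := by
  have h1 : w.mat * pauliRotation σ θ = pauliRotation σ θ * w.mat := by
    rw [pauliRotation_eq, Matrix.mul_sub, Matrix.sub_mul, Matrix.mul_smul, Matrix.mul_smul,
      Matrix.smul_mul, Matrix.smul_mul, PauliWord.mat_comm_of_sgn_eq_zero h, Matrix.one_mul,
      Matrix.mul_one]
  rw [Matrix.mul_assoc, h1, ← Matrix.mul_assoc, conjTranspose_mul_pauliRotation, Matrix.one_mul]

/-- Moving `w` past the rotation `R` inverts `R`, so `R† w R = (R†)² w = exp(iθσ) w`; the half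
angles recombine to `θ`, and `i` times the phase of `σw` is the real number `sgn`. -/
theorem pauliRotation_conj_of_anticomm {σ w : PauliWord n} (h : σ.sgn w ≠ 0) (θ : ℝ) :
    (pauliRotation σ θ).conjTranspose * w.mat * pauliRotation σ θ =
      (Real.cos θ : ℂ) • w.mat + ((Real.sin θ * σ.sgn w : ℝ) : ℂ) • (σ.mul w).mat := by
  have h1 : w.mat * σ.mat = -(σ.mat * w.mat) := by
    rw [PauliWord.mat_anticomm_of_sgn_ne_zero h, neg_neg]
  have h2 : σ.mat * w.mat * σ.mat = -w.mat := by
    rw [Matrix.mul_assoc, h1, mul_neg, ← Matrix.mul_assoc, σ.mat_mul_self, Matrix.one_mul]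
  have h3 : ((Real.sin θ * σ.sgn w : ℝ) : ℂ) • (σ.mul w).mat =
      (Complex.I * Real.sin θ) • (σ.mat * w.mat) := by
    rw [Complex.ofReal_mul, ← PauliWord.I_mul_phase h, PauliWord.mat_mul_mat, smul_smul]
    congr 1
    ring
  have h4 : (Real.cos θ : ℂ) = Real.cos (θ / 2) * Real.cos (θ / 2) -
      Real.sin (θ / 2) * Real.sin (θ / 2) := by
    have : Real.cos θ = Real.cos (θ / 2 + θ / 2) := by ring_nf
    rw [this, Real.cos_add]
    push_cast
    ring
  have h5 : (Real.sin θ : ℂ) = 2 * Real.sin (θ / 2) * Real.cos (θ / 2) := by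
    have : Real.sin θ = Real.sin (2 * (θ / 2)) := by ring_nf
    rw [this, Real.sin_two_mul]
    push_cast
    ring
  rw [h3, h4, h5, conjTranspose_pauliRotation, pauliRotation_eq]
  simp only [Matrix.add_mul, Matrix.mul_sub, Matrix.smul_mul, Matrix.mul_smul, Matrix.one_mul,
    Matrix.mul_one, h1, h2]
  generalize (Real.cos (θ / 2) : ℂ) = c
  generalize (Real.sin (θ / 2) : ℂ) = s
  have h6 : Complex.I * s * (Complex.I * s) = -(s * s) := by
    linear_combination (s * s) * Complex.I_mul_I
  simp only [smul_add, smul_neg, smul_smul, h6]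
  module

end NoisyVQA
end

/-! ### One layer, the noise, the Hamiltonian and the state in the Pauli basis. -/

noncomputable section

namespace NoisyVQA

variable {n L : ℕ} {ι : Type*}

/-! ### Heisenberg evolution through one layer -/

/-- The value of a linear functional with values `f` on the Pauli words at the word `w`, evolved
through a list of rotations. -/
def rotVal (θ : ι → ℝ) : List (PauliWord n × ι) → (PauliWord n → ℝ) → PauliWord n → ℝ
  | [], f, w => f w
  | r :: rs, f, w =>
      if r.1.sgn w = 0 then rotVal θ rs f w
      else Real.cos (θ r.2) * rotVal θ rs f w +
        Real.sin (θ r.2) * r.1.sgn w * rotVal θ rs f (r.1.mul w)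

/-- The value of a linear functional with values `f` on the Pauli words at the word `w`, evolved
through a list of Clifford gates. -/
def gatesVal : List (CliffordGate n) → (PauliWord n → ℝ) → PauliWord n → ℝ
  | [], f, w => f w
  | g :: gs, f, w => g.sign w * gatesVal gs f (g.act w)

/-- Conjugation of a Pauli word with a list of Clifford gates, up to sign. -/
def gatesAct : List (CliffordGate n) → PauliWord n → PauliWord n
  | [], w => w
  | g :: gs, w => gatesAct gs (g.act w)

/-- The sign of the conjugation of a Pauli word with a list of Clifford gates. -/
def gatesSign : List (CliffordGate n) → PauliWord n → ℝ
  | [], _ => 1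
  | g :: gs, w => g.sign w * gatesSign gs (g.act w)

theorem gatesVal_eq (gs : List (CliffordGate n)) (f : PauliWord n → ℝ) (w : PauliWord n) :
    gatesVal gs f w = gatesSign gs w * f (gatesAct gs w) := by
  induction gs generalizing w with
  | nil => simp [gatesVal, gatesSign, gatesAct]
  | cons g gs ih => rw [gatesVal, gatesSign, gatesAct, ih, mul_assoc]

theorem gatesAct_injective (gs : List (CliffordGate n)) : Function.Injective (gatesAct gs) := by
  induction gs with
  | nil => exact fun _ _ h => h
  | cons g gs ih =>
    intro v w h
    have := congrArg g.act (ih h)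
    rwa [g.act_act, g.act_act] at this

theorem gatesAct_mul (gs : List (CliffordGate n)) (v w : PauliWord n) :
    gatesAct gs (v.mul w) = (gatesAct gs v).mul (gatesAct gs w) := by
  induction gs generalizing v w with
  | nil => rfl
  | cons g gs ih => rw [gatesAct, g.act_mul, ih]; rfl

theorem CliffordGate.sign_ne_zero (g : CliffordGate n) (w : PauliWord n) : g.sign w ≠ 0 := by
  cases g with
  | hadamard a => simp only [CliffordGate.sign]; cases w a <;> simp [Pauli.hadamardSign]
  | phase a => simp only [CliffordGate.sign]; cases w a <;> simp [Pauli.phaseSign]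
  | cnot a b h =>
    simp only [CliffordGate.sign]; cases w a <;> cases w b <;> simp [Pauli.cnotSign]

theorem gatesSign_ne_zero (gs : List (CliffordGate n)) (w : PauliWord n) :
    gatesSign gs w ≠ 0 := by
  induction gs generalizing w with
  | nil => exact one_ne_zero
  | cons g gs ih => exact mul_ne_zero (g.sign_ne_zero w) (ih _)

theorem gates_conj_mat (gs : List (CliffordGate n)) (w : PauliWord n) :
    (gs.map CliffordGate.mat).prod.conjTranspose * w.mat * (gs.map CliffordGate.mat).prod =
      (gatesSign gs w : ℂ) • (gatesAct gs w).mat := by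
  induction gs generalizing w with
  | nil => simp [gatesSign, gatesAct]
  | cons g gs ih =>
    rw [List.map_cons, List.prod_cons, Matrix.conjTranspose_mul]
    calc _ = (gs.map CliffordGate.mat).prod.conjTranspose *
          (g.mat.conjTranspose * w.mat * g.mat) * (gs.map CliffordGate.mat).prod := by
            simp only [Matrix.mul_assoc]
      _ = _ := by
        rw [g.conj_mat, Matrix.mul_smul, Matrix.smul_mul, ih, smul_smul, gatesSign, gatesAct]
        push_cast
        rfl

theorem gatesAct_eq_self (gs : List (CliffordGate n)) (w : PauliWord n)
    (h : ∀ g ∈ gs, Disjoint w.support g.support) :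
    gatesAct gs w = w ∧ gatesSign gs w = 1 := by
  induction gs with
  | nil => exact ⟨rfl, rfl⟩
  | cons g gs ih =>
    obtain ⟨h1, h2⟩ := CliffordGate.act_eq_self (h g (by simp))
    obtain ⟨h3, h4⟩ := ih fun g' hg' => h g' (by simp [hg'])
    rw [gatesAct, gatesSign, h1, h2, h3, h4, one_mul]
    exact ⟨rfl, rfl⟩

theorem List.prod_conjTranspose_mul_self (l : List (QMat n))
    (h : ∀ A ∈ l, A.conjTranspose * A = 1) : l.prod.conjTranspose * l.prod = 1 := by
  induction l with
  | nil => simp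
  | cons A l ih =>
    rw [List.prod_cons, Matrix.conjTranspose_mul]
    calc _ = l.prod.conjTranspose * (A.conjTranspose * A) * l.prod := by
            simp only [Matrix.mul_assoc]
      _ = 1 := by
        rw [h A (by simp), Matrix.mul_one, ih fun B hB => h B (by simp [hB])]

/-- In the Heisenberg picture the leftmost factor of the product meets `w` first, so the recursion
consumes the list from its head. `V` stands for the Clifford part, which is reached last. -/
theorem rotVal_eq_apply (Λ : QMat n →ₗ[ℂ] ℂ) (f : PauliWord n → ℝ) (V : QMat n)
    (hΛ : ∀ w : PauliWord n, Λ (V.conjTranspose * w.mat * V) = f w) (θ : ι → ℝ)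
    (rs : List (PauliWord n × ι)) (w : PauliWord n) :
    Λ (((rs.map fun r => pauliRotation r.1 (θ r.2)).prod * V).conjTranspose * w.mat *
      ((rs.map fun r => pauliRotation r.1 (θ r.2)).prod * V)) = (rotVal θ rs f w : ℂ) := by
  induction rs generalizing w with
  | nil => simp [rotVal, hΛ]
  | cons r rs ih =>
    rw [List.map_cons, List.prod_cons]
    set W := (rs.map fun r => pauliRotation r.1 (θ r.2)).prod * V with hW
    have h1 : (pauliRotation r.1 (θ r.2) *
        (rs.map fun r => pauliRotation r.1 (θ r.2)).prod * V).conjTranspose * w.mat *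
        (pauliRotation r.1 (θ r.2) * (rs.map fun r => pauliRotation r.1 (θ r.2)).prod * V) =
        W.conjTranspose * ((pauliRotation r.1 (θ r.2)).conjTranspose * w.mat *
          pauliRotation r.1 (θ r.2)) * W := by
      rw [Matrix.mul_assoc (pauliRotation r.1 (θ r.2)), ← hW, Matrix.conjTranspose_mul]
      simp only [Matrix.mul_assoc]
    rw [h1, rotVal]
    split_ifs with h
    · rw [pauliRotation_conj_of_comm h, ih]
    · rw [pauliRotation_conj_of_anticomm h, Matrix.mul_add, Matrix.add_mul, Matrix.mul_smul,
        Matrix.mul_smul, Matrix.smul_mul, Matrix.smul_mul, map_add, map_smul, map_smul, ih, ih]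
      push_cast
      rfl

theorem rotVal_sum {α : Type*} (s : Finset α) (a : α → ℝ) (f : α → PauliWord n → ℝ) (θ : ι → ℝ)
    (rs : List (PauliWord n × ι)) (w : PauliWord n) :
    rotVal θ rs (fun v => ∑ i ∈ s, a i * f i v) w = ∑ i ∈ s, a i * rotVal θ rs (f i) w := by
  induction rs generalizing w with
  | nil => rfl
  | cons r rs ih =>
    simp only [rotVal]
    split_ifs
    · exact ih w
    · rw [ih, ih, Finset.mul_sum, Finset.mul_sum, ← Finset.sum_add_distrib]
      exact Finset.sum_congr rfl fun i _ => by ring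

namespace Circuit

variable (c : Circuit n L)

/-- The rotations of a layer with the indices of their parameters. -/
def rots (i : Fin L) : List (PauliWord n × c.ParamIndex) :=
  List.ofFn fun j => (c.word i j, ⟨i, j⟩)

/-- The Clifford gates of a layer. -/
def gates (i : Fin L) : List (CliffordGate n) := List.ofFn (c.gate i)

/-- The value of a linear functional with values `f` on the Pauli words at the word `w`, evolved
through a layer. -/
def layerVal (θ : c.Params) (i : Fin L) (f : PauliWord n → ℝ) (w : PauliWord n) : ℝ :=
  rotVal θ (c.rots i) (gatesVal (c.gates i) f) w

/-- Matrix elements of the Heisenberg evolution through a layer. -/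
def layerCoeff (θ : c.Params) (i : Fin L) (w v : PauliWord n) : ℝ :=
  c.layerVal θ i (fun u => if u = v then 1 else 0) w

theorem cliffordLayer_eq (i : Fin L) :
    c.cliffordLayer i = ((c.gates i).map CliffordGate.mat).prod := by
  rw [cliffordLayer, gates, List.map_ofFn]
  rfl

theorem layerUnitary_eq (θ : c.Params) (i : Fin L) : c.layerUnitary θ i =
    ((c.rots i).map fun r => pauliRotation r.1 (θ r.2)).prod *
      ((c.gates i).map CliffordGate.mat).prod := by
  rw [layerUnitary, cliffordLayer_eq, rots, List.map_ofFn]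
  rfl

theorem conjTranspose_mul_cliffordLayer (i : Fin L) :
    (c.cliffordLayer i).conjTranspose * c.cliffordLayer i = 1 := by
  rw [cliffordLayer_eq]
  refine List.prod_conjTranspose_mul_self _ fun A hA => ?_
  obtain ⟨g, -, rfl⟩ := List.mem_map.1 hA
  exact g.conjTranspose_mul_mat

theorem conjTranspose_mul_layerUnitary (θ : c.Params) (i : Fin L) :
    (c.layerUnitary θ i).conjTranspose * c.layerUnitary θ i = 1 := by
  rw [layerUnitary_eq, ← cliffordLayer_eq, Matrix.conjTranspose_mul]
  set R := ((c.rots i).map fun r => pauliRotation r.1 (θ r.2)).prod with hR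
  have h : R.conjTranspose * R = 1 := by
    refine List.prod_conjTranspose_mul_self _ fun A hA => ?_
    obtain ⟨r, -, rfl⟩ := List.mem_map.1 hA
    exact conjTranspose_mul_pauliRotation _ _
  calc _ = (c.cliffordLayer i).conjTranspose * (R.conjTranspose * R) * c.cliffordLayer i := by
          simp only [Matrix.mul_assoc]
    _ = 1 := by rw [h, Matrix.mul_one, conjTranspose_mul_cliffordLayer]

theorem apply_conj_layerUnitary (Λ : QMat n →ₗ[ℂ] ℂ) (f : PauliWord n → ℝ)
    (hΛ : ∀ w : PauliWord n, Λ w.mat = f w) (θ : c.Params) (i : Fin L) (w : PauliWord n) :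
    Λ ((c.layerUnitary θ i).conjTranspose * w.mat * c.layerUnitary θ i) =
      (c.layerVal θ i f w : ℂ) := by
  rw [layerUnitary_eq, layerVal]
  refine rotVal_eq_apply Λ _ _ (fun v => ?_) θ _ w
  rw [gates_conj_mat, map_smul, hΛ, gatesVal_eq]
  push_cast
  rfl

theorem layerVal_eq_sum (θ : c.Params) (i : Fin L) (f : PauliWord n → ℝ) (w : PauliWord n) :
    c.layerVal θ i f w = ∑ v, c.layerCoeff θ i w v * f v := by
  have h : gatesVal (c.gates i) f = fun u => ∑ v, f v *
      gatesVal (c.gates i) (fun u => if u = v then 1 else 0) u := by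
    funext u
    simp [gatesVal_eq, mul_comm]
  rw [layerVal, h, rotVal_sum]
  exact Finset.sum_congr rfl fun v _ => mul_comm _ _

/-- On Pauli words the functional `A ↦ 2⁻ⁿ Tr(A v)` is the indicator of `v`, so `layerCoeff` is read
off from it; cyclicity of the trace moves the unitary from one word to the other. -/
theorem trace_layerCoeff (θ : c.Params) (i : Fin L) (w v : PauliWord n) :
    (w.mat * (c.layerUnitary θ i * v.mat * (c.layerUnitary θ i).conjTranspose)).trace =
      2 ^ n * (c.layerCoeff θ i w v : ℂ) := by
  let Λ : QMat n →ₗ[ℂ] ℂ :=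
    ((2 ^ n : ℂ)⁻¹) • (Matrix.traceLinearMap (Bits n) ℂ ℂ ∘ₗ LinearMap.mulRight ℂ v.mat)
  have hΛ : ∀ A, Λ A = (2 ^ n : ℂ)⁻¹ * (A * v.mat).trace := fun A => rfl
  have h := c.apply_conj_layerUnitary Λ (fun u => if u = v then 1 else 0) (fun u => by
    rw [hΛ, PauliWord.trace_mat_mul_mat]
    split_ifs <;> simp) θ i w
  rw [layerCoeff, ← h, hΛ, mul_inv_cancel_left₀ (by simp)]
  simp only [← Matrix.mul_assoc]
  rw [Matrix.trace_mul_comm]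
  simp only [← Matrix.mul_assoc]

theorem sum_layerCoeff_sq (θ : c.Params) (i : Fin L) (w : PauliWord n) :
    ∑ v, c.layerCoeff θ i w v ^ 2 = 1 := by
  set U := c.layerUnitary θ i with hU
  have h1 := PauliWord.sum_trace_mul_trace (U.conjTranspose * w.mat * U)
    (U.conjTranspose * w.mat * U)
  have h2 : ∀ v : PauliWord n, (v.mat * (U.conjTranspose * w.mat * U)).trace =
      2 ^ n * (c.layerCoeff θ i w v : ℂ) := by
    intro v
    rw [← trace_layerCoeff, ← hU]
    rw [← Matrix.mul_assoc, Matrix.trace_mul_comm]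
    simp only [← Matrix.mul_assoc]
    rw [Matrix.trace_mul_comm]
    simp only [← Matrix.mul_assoc]
  have h3 : U * U.conjTranspose = 1 :=
    mul_eq_one_comm.1 (c.conjTranspose_mul_layerUnitary θ i)
  have h4 : U.conjTranspose * w.mat * U * (U.conjTranspose * w.mat * U) = 1 := by
    calc _ = U.conjTranspose * w.mat * (U * U.conjTranspose) * w.mat * U := by
            simp only [Matrix.mul_assoc]
      _ = U.conjTranspose * (w.mat * w.mat) * U := by
        rw [h3, Matrix.mul_one]
        simp only [Matrix.mul_assoc]
      _ = 1 := by
        rw [w.mat_mul_self, Matrix.mul_one]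
        exact c.conjTranspose_mul_layerUnitary θ i
  have h5 : (1 : QMat n).trace = 2 ^ n := by simp [Matrix.trace_one]
  rw [h4, h5] at h1
  simp only [h2] at h1
  have h6 : (2 ^ n : ℂ) * 2 ^ n * ((∑ v, c.layerCoeff θ i w v ^ 2 : ℝ) : ℂ) =
      2 ^ n * 2 ^ n * 1 := by
    rw [mul_one]
    refine Eq.trans ?_ h1
    push_cast
    rw [Finset.mul_sum]
    exact Finset.sum_congr rfl fun v _ => by ring
  have h7 := mul_left_cancel₀ (by simp) h6
  exact_mod_cast h7

end Circuit

/-! ### Noise -/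

theorem depolarize_mat (lam : ℝ) (p : Pauli) :
    depolarize lam p.mat = ((if p = .I then 1 else 1 - lam : ℝ) : ℂ) • p.mat := by
  rw [depolarize, Pauli.trace_mat]
  split_ifs with h
  · subst h
    simp only [Pauli.mat]
    rw [← add_smul]
    congr 1
    push_cast
    ring
  · simp

/-- The noise channel as a linear map. -/
def noiseLinear (lam : ℝ) : QMat n →ₗ[ℂ] QMat n where
  toFun := noise lam
  map_add' A B := by
    simp only [noise, Matrix.add_apply, add_smul, Finset.sum_add_distrib]
  map_smul' a A := by
    simp only [noise, Matrix.smul_apply, smul_assoc, ← Finset.smul_sum, RingHom.id_apply]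

/-- Expanding every tensor factor in matrix units and exchanging product and sum recovers the
defining formula of the channel. -/
theorem noise_tensor (lam : ℝ) (A : Fin n → QubitMat) :
    noise lam (tensor A) = tensor fun j => depolarize lam (A j) := by
  have h : ∀ B : QubitMat, ∀ a b : Fin 2,
      depolarize lam B a b = ∑ t : Fin 2 × Fin 2, B t.1 t.2 *
        depolarize lam (Matrix.single t.1 t.2 1) a b := by
    intro B a b
    rw [Fintype.sum_prod_type]
    fin_cases a <;> fin_cases b <;>
      simp [depolarize, Matrix.trace_fin_two, Matrix.single_apply, Fin.sum_univ_two] <;> ring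
  ext x y
  have h2 : ∀ x y : Bits n, (tensor fun j => depolarize lam (A j)) x y =
      ∑ t : Fin n → Fin 2 × Fin 2, ∏ j, (A j (t j).1 (t j).2 *
        depolarize lam (Matrix.single (t j).1 (t j).2 1) (x j) (y j)) := by
    intro x y
    rw [tensor, Matrix.of_apply]
    refine (Finset.prod_congr rfl fun j _ => h (A j) (x j) (y j)).trans ?_
    rw [Finset.prod_univ_sum, Fintype.piFinset_univ]
  -- A family of index pairs, one per qubit, is the same as a pair of basis labels `u`, `v`.
  rw [h2, ← (Equiv.arrowProdEquivProdArrow (Fin n) (fun _ => Fin 2) (fun _ => Fin 2)).symm.sum_comp,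
    Fintype.sum_prod_type]
  simp only [noise, Matrix.sum_apply, Matrix.smul_apply, tensor, Matrix.of_apply, smul_eq_mul,
    Finset.prod_mul_distrib, Equiv.arrowProdEquivProdArrow]
  rfl

/-- Each Pauli matrix is an eigenvector of the one-qubit channel, with eigenvalue `1` for the
identity and `1 - λ` otherwise; the weight counts the damped factors. -/
theorem noise_mat (lam : ℝ) (w : PauliWord n) :
    noise lam w.mat = (((1 - lam) ^ w.weight : ℝ) : ℂ) • w.mat := by
  rw [PauliWord.mat, noise_tensor]
  simp only [depolarize_mat]
  rw [tensor_smul]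
  congr 1
  rw [← Complex.ofReal_prod, PauliWord.weight, PauliWord.support, Finset.prod_ite,
    Finset.prod_const_one, one_mul, Finset.prod_const]

theorem PauliWord.normMat_eq (w : PauliWord n) :
    w.normMat = ((Real.sqrt 2 : ℂ)⁻¹) ^ n • w.mat := by
  rw [PauliWord.normMat, tensor_smul]
  simp [PauliWord.mat]

theorem noise_smul (lam : ℝ) (a : ℂ) (A : QMat n) : noise lam (a • A) = a • noise lam A :=
  (noiseLinear lam).map_smul a A

/-- Each trace of two normalized words carries two factors `2^(-n/2)` and one factor `2^n`, which
cancel. -/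
theorem inv_sqrt_two_pow : ((Real.sqrt 2 : ℂ)⁻¹) ^ n * ((Real.sqrt 2 : ℂ)⁻¹) ^ n * 2 ^ n = 1 := by
  rw [← mul_pow, inv_sqrt_two_mul_self, ← mul_pow]
  simp

/-! ### Hamiltonian and input state in the Pauli basis -/

/-- The coefficient of a Pauli word in the Hamiltonian. -/
def Hamiltonian.coeff (H : Hamiltonian n) (w : PauliWord n) : ℝ :=
  (H.terms.map fun t => if w = t.1 then t.2 else 0).sum

theorem Hamiltonian.sum_coeff_mul (H : Hamiltonian n) (f : PauliWord n → ℝ) :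
    ∑ w, H.coeff w * f w = (H.terms.map fun t => t.2 * f t.1).sum := by
  unfold Hamiltonian.coeff
  induction H.terms with
  | nil => simp
  | cons t l ih =>
    simp only [List.map_cons, List.sum_cons, add_mul, Finset.sum_add_distrib, ih]
    simp

theorem Hamiltonian.trace_mul (H : Hamiltonian n) (A : QMat n) :
    (H.mat * A).trace = ∑ w, (H.coeff w : ℂ) * (w.mat * A).trace := by
  unfold Hamiltonian.coeff Hamiltonian.mat
  induction H.terms with
  | nil => simp
  | cons t l ih =>
    simp only [List.map_cons, List.sum_cons, Complex.ofReal_add, add_mul, Finset.sum_add_distrib,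
      Matrix.trace_add, ih]
    simp [apply_ite, ite_mul, Matrix.trace_smul]

theorem Hamiltonian.trace_mul_mat (H : Hamiltonian n) (w : PauliWord n) :
    (H.mat * w.mat).trace = 2 ^ n * (H.coeff w : ℂ) := by
  rw [H.trace_mul]
  simp [PauliWord.trace_mat_mul_mat, mul_comm]

theorem Hamiltonian.coeff_eq_of_mem (H : Hamiltonian n) {t : PauliWord n × ℝ} (ht : t ∈ H.terms) :
    H.coeff t.1 = t.2 := by
  obtain ⟨l, hn⟩ := H
  simp only [Hamiltonian.coeff] at ht ⊢
  induction l with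
  | nil => simp at ht
  | cons a l ih =>
    rw [List.map_cons, List.nodup_cons] at hn
    rw [List.map_cons, List.sum_cons]
    rcases List.mem_cons.1 ht with rfl | h
    · rw [if_pos rfl, List.sum_eq_zero, add_zero]
      intro x hx
      obtain ⟨b, hb, rfl⟩ := List.mem_map.1 hx
      exact if_neg fun h : t.1 = b.1 => hn.1 (h ▸ List.mem_map_of_mem hb)
    · rw [if_neg fun h' : t.1 = a.1 => hn.1 (h' ▸ List.mem_map_of_mem h), zero_add, ih hn.2 h]

/-- Since the listed words are distinct, no coefficients merge, and a program can compute the sum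
directly from its input. -/
theorem Hamiltonian.sum_coeff_sq (H : Hamiltonian n) :
    ∑ w, H.coeff w ^ 2 = (H.terms.map fun t => t.2 * t.2).sum := by
  simp only [sq]
  rw [H.sum_coeff_mul]
  congr 1
  exact List.map_congr_left fun t ht => by rw [H.coeff_eq_of_mem ht]

/-- The expectation value of a Pauli word. -/
def InputState.expect (ρ : InputState n) (w : PauliWord n) : ℝ := (w.mat * ρ.mat).trace.re

open scoped ComplexOrder in
theorem InputState.trace_mul (ρ : InputState n) (w : PauliWord n) :
    (w.mat * ρ.mat).trace = (ρ.expect w : ℂ) := by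
  have h : starRingEnd ℂ (w.mat * ρ.mat).trace = (w.mat * ρ.mat).trace := by
    rw [starRingEnd_apply, ← Matrix.trace_conjTranspose, Matrix.conjTranspose_mul,
      w.conjTranspose_mat, Matrix.trace_mul_comm]
    congr 2
    exact ρ.posSemidef.isHermitian
  exact (Complex.conj_eq_iff_re.1 h).symm

open scoped ComplexOrder in
-- For `s = ±1` the Hermitian matrix `B = 1 + s w` satisfies `B² = 2B`, so `0 ≤ Tr(B ρ B) = 2(1 +
-- s⟨w⟩)`.
theorem InputState.expect_sq_le_one (ρ : InputState n) (w : PauliWord n) : ρ.expect w ^ 2 ≤ 1 := by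
  have key : ∀ s : ℝ, s * s = 1 → 0 ≤ 1 + s * ρ.expect w := by
    intro s hs
    have hs' : (s : ℂ) * s = 1 := by exact_mod_cast hs
    set B : QMat n := 1 + (s : ℂ) • w.mat with hB
    have hB1 : B.conjTranspose = B := by
      rw [hB, Matrix.conjTranspose_add, Matrix.conjTranspose_smul, w.conjTranspose_mat,
        Matrix.conjTranspose_one]
      simp
    have hB2 : B * B = (2 : ℂ) • B := by
      simp only [hB, Matrix.add_mul, Matrix.mul_add, Matrix.smul_mul, Matrix.mul_smul,
        Matrix.one_mul, Matrix.mul_one, w.mat_mul_self]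
      rw [smul_add, smul_smul, hs']
      module
    have h1 := (ρ.posSemidef.mul_mul_conjTranspose_same B).trace_nonneg
    rw [hB1, Matrix.trace_mul_comm, ← Matrix.mul_assoc, hB2, Matrix.smul_mul, Matrix.trace_smul, hB,
      Matrix.add_mul, Matrix.one_mul, Matrix.trace_add, ρ.trace_eq_one, Matrix.smul_mul,
      Matrix.trace_smul] at h1
    have h2 := ρ.trace_mul w
    rw [InputState.mat] at h2
    rw [h2, smul_eq_mul, smul_eq_mul] at h1
    have h3 : (0 : ℂ) ≤ ((2 * (1 + s * ρ.expect w) : ℝ) : ℂ) := by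
      push_cast
      exact h1
    have h4 := Complex.zero_le_real.1 h3
    linarith
  have h1 := key 1 (by norm_num)
  have h2 := key (-1) (by norm_num)
  nlinarith

end NoisyVQA
end

/-! ### Path expansions of the cost, and why a path is determined by its trigonometric monomial. -/

noncomputable section

namespace NoisyVQA

variable {n L : ℕ} {ι : Type*}

/-! ### Sums over paths -/

/-- Sum over all paths ending at a given point, of total weight at most `m`. -/
def pathVal {W : Type*} [Fintype W] (wt : W → ℕ) (T : ℕ → W → W → ℝ) (b : W → ℝ) :
    ℕ → W → ℕ → ℝ
  | 0, w, m => if wt w ≤ m then b w else 0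
  | k + 1, w, m => if wt w ≤ m then ∑ v, T k w v * pathVal wt T b k v (m - wt w) else 0

/-- Induction splits off the last point of a path, the one next to the observable. Truncated
subtraction of the weight is harmless behind the test `wt w ≤ m`. -/
theorem sum_paths {W : Type*} [Fintype W] (wt : W → ℕ) (T : ℕ → W → W → ℝ) (a b : W → ℝ)
    (k m : ℕ) :
    (∑ s : Fin (k + 1) → W with ∑ i, wt (s i) ≤ m,
      a (s (Fin.last k)) * (∏ i : Fin k, T i (s i.succ) (s i.castSucc)) * b (s 0)) =
      ∑ w, a w * pathVal wt T b k w m := by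
  induction k generalizing a m with
  | zero =>
    rw [Finset.sum_filter, ← (Equiv.funUnique (Fin 1) W).symm.sum_comp]
    refine Finset.sum_congr rfl fun w _ => ?_
    simp [pathVal]
  | succ k ih =>
    rw [Finset.sum_filter, ← (Fin.snocEquiv fun _ => W).sum_comp, Fintype.sum_prod_type]
    refine Finset.sum_congr rfl fun w _ => ?_
    simp only [Fin.snocEquiv, Equiv.coe_fn_mk, Fin.snoc_last, pathVal]
    split_ifs with h
    · rw [← ih, Finset.mul_sum, Finset.sum_filter]
      refine Finset.sum_congr rfl fun s _ => ?_
      have h1 : (∑ i, wt ((Fin.snoc s w : Fin (k + 2) → W) i) ≤ m) ↔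
          ∑ i, wt (s i) ≤ m - wt w := by
        rw [Fin.sum_univ_castSucc]
        simp only [Fin.snoc_castSucc, Fin.snoc_last]
        omega
      simp only [h1]
      split_ifs
      · rw [Fin.prod_univ_castSucc]
        have h2 : (Fin.snoc s w : Fin (k + 2) → W) 0 = s 0 := by
          rw [← Fin.castSucc_zero, Fin.snoc_castSucc]
        have h3 : ∀ i : Fin k, (Fin.snoc s w : Fin (k + 2) → W) i.castSucc.succ = s i.succ := by
          intro i
          rw [Fin.succ_castSucc, Fin.snoc_castSucc]
        simp only [h2, h3, Fin.snoc_castSucc, Fin.val_castSucc, Fin.val_last, Fin.succ_last,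
          Fin.snoc_last]
        ring
      · rfl
    · rw [mul_zero]
      refine Finset.sum_eq_zero fun s _ => if_neg fun h' => h ?_
      rw [Fin.sum_univ_castSucc] at h'
      simp only [Fin.snoc_last] at h'
      omega

/-- Giving every point weight zero disables the truncation. -/
theorem sum_all_paths {W : Type*} [Fintype W] (T : ℕ → W → W → ℝ) (a b : W → ℝ) (k : ℕ) :
    (∑ s : Fin (k + 1) → W,
      a (s (Fin.last k)) * (∏ i : Fin k, T i (s i.succ) (s i.castSucc)) * b (s 0)) =
      ∑ w, a w * pathVal (fun _ => 0) T b k w 0 := by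
  rw [← sum_paths]
  simp

/-! ### The cost functions as sums over Pauli paths -/

/-- The transition amplitudes of the noiseless circuit (zero beyond the last layer). -/
def Circuit.transition (c : Circuit n L) (θ : c.Params) (k : ℕ) (w v : PauliWord n) : ℝ :=
  if h : k < L then c.layerCoeff θ ⟨k, h⟩ w v else 0

theorem Circuit.transition_val (c : Circuit n L) (θ : c.Params) (i : Fin L) (w v : PauliWord n) :
    c.transition θ i w v = c.layerCoeff θ i w v := by simp [transition]

/-- The contribution of a Pauli path to the noiseless cost function. -/
def pathAmplitude (c : Circuit n L) (H : Hamiltonian n) (ρ : InputState n) (θ : c.Params)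
    (s : PauliPath n L) : ℝ :=
  H.coeff (s (Fin.last L)) * (∏ i : Fin L, c.layerCoeff θ i (s i.succ) (s i.castSucc)) *
    ρ.expect (s 0)

/-- Every word of the path, including the last, meets exactly one layer of noise, so the damping
exponents add up to the full weight. -/
theorem noisyContribution_eq (lam : ℝ) (c : Circuit n L) (H : Hamiltonian n) (ρ : InputState n)
    (θ : c.Params) (s : PauliPath n L) :
    noisyContribution lam c H ρ θ s =
      (((1 - lam) ^ PauliPath.weight s * pathAmplitude c H ρ θ s : ℝ) : ℂ) := by
  set r := 1 - lam with hr
  have h0 := inv_sqrt_two_pow (n := n)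
  set q := ((Real.sqrt 2 : ℂ)⁻¹) ^ n with hq
  have h1 : ∀ i : Fin L, ((s i.succ).normMat * (c.layerUnitary θ i *
      noise lam (s i.castSucc).normMat * (c.layerUnitary θ i).conjTranspose)).trace =
      ((r ^ (s i.castSucc).weight * c.layerCoeff θ i (s i.succ) (s i.castSucc) : ℝ) : ℂ) := by
    intro i
    rw [PauliWord.normMat_eq, PauliWord.normMat_eq, noise_smul, noise_mat]
    simp only [Matrix.smul_mul, Matrix.mul_smul, Matrix.trace_smul, smul_eq_mul, ← hq, ← hr]
    rw [c.trace_layerCoeff]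
    push_cast
    linear_combination ((r : ℂ) ^ (s i.castSucc).weight *
      (c.layerCoeff θ i (s i.succ) (s i.castSucc) : ℂ)) * h0
  rw [noisyContribution, Finset.prod_congr rfl fun i _ => h1 i]
  rw [PauliWord.normMat_eq, PauliWord.normMat_eq, noise_smul, noise_mat]
  simp only [Matrix.smul_mul, Matrix.mul_smul, Matrix.trace_smul, smul_eq_mul, ← hq, ← hr]
  rw [H.trace_mul_mat, ρ.trace_mul, PauliPath.weight, Fin.sum_univ_castSucc, pow_add,
    ← Finset.prod_pow_eq_pow_sum, pathAmplitude]
  push_cast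
  rw [Finset.prod_mul_distrib]
  linear_combination ((r : ℂ) ^ (s (Fin.last L)).weight * H.coeff (s (Fin.last L)) *
    ((∏ i : Fin L, (r : ℂ) ^ (s i.castSucc).weight) *
      ∏ i : Fin L, (c.layerCoeff θ i (s i.succ) (s i.castSucc) : ℂ)) * ρ.expect (s 0)) * h0

theorem truncatedCost_eq_sum (lam : ℝ) (c : Circuit n L) (H : Hamiltonian n) (ρ : InputState n)
    (M : ℕ) (θ : c.Params) : truncatedCost lam c H ρ M θ =
      ((∑ s : PauliPath n L with PauliPath.weight s ≤ M,
        (1 - lam) ^ PauliPath.weight s * pathAmplitude c H ρ θ s : ℝ) : ℂ) := by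
  rw [truncatedCost, Complex.ofReal_sum]
  exact Finset.sum_congr rfl fun s _ => noisyContribution_eq _ _ _ _ _ _

/-- The sum over all paths of weight at most `m` ending at a given word. -/
def noisyPathVal (lam : ℝ) (c : Circuit n L) (ρ : InputState n) (θ : c.Params) :
    ℕ → PauliWord n → ℕ → ℝ :=
  pathVal PauliWord.weight (fun k w v => (1 - lam) ^ w.weight * c.transition θ k w v)
    fun w => (1 - lam) ^ w.weight * ρ.expect w

/-- The damping is regrouped: a transition carries the factor of its later word and the initial
value that of `s 0`. Thus a word is damped exactly when its weight is charged to the budget, as in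
the program. -/
theorem truncatedCost_eq (lam : ℝ) (c : Circuit n L) (H : Hamiltonian n) (ρ : InputState n)
    (M : ℕ) (θ : c.Params) : truncatedCost lam c H ρ M θ =
      ((H.terms.map fun t => t.2 * noisyPathVal lam c ρ θ L t.1 M).sum : ℝ) := by
  rw [truncatedCost_eq_sum, ← H.sum_coeff_mul (fun w => noisyPathVal lam c ρ θ L w M)]
  congr 1
  rw [noisyPathVal, ← sum_paths]
  refine Finset.sum_congr rfl fun s _ => ?_
  simp only [c.transition_val, pathAmplitude]
  rw [PauliPath.weight, Fin.sum_univ_succ, pow_add, ← Finset.prod_pow_eq_pow_sum,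
    Finset.prod_mul_distrib]
  ring

theorem noisyPathVal_zero (lam : ℝ) (c : Circuit n L) (ρ : InputState n) (θ : c.Params)
    (w : PauliWord n) (m : ℕ) : noisyPathVal lam c ρ θ 0 w m =
      if w.weight ≤ m then (1 - lam) ^ w.weight * ρ.expect w else 0 := rfl

theorem noisyPathVal_succ (lam : ℝ) (c : Circuit n L) (ρ : InputState n) (θ : c.Params)
    (i : Fin L) (w : PauliWord n) (m : ℕ) : noisyPathVal lam c ρ θ (i + 1) w m =
      if w.weight ≤ m then (1 - lam) ^ w.weight *
        c.layerVal θ i (fun v => noisyPathVal lam c ρ θ i v (m - w.weight)) w else 0 := by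
  rw [noisyPathVal, pathVal, c.layerVal_eq_sum, Finset.mul_sum]
  simp only [c.transition_val, mul_assoc]

/-- The state before a layer is expanded in the Pauli basis, where the noise is diagonal. Here each
transition carries the damping of its earlier word, because the noise precedes the layer. -/
theorem noisyState_expect (lam : ℝ) (c : Circuit n L) (ρ : InputState n) (θ : c.Params) (k : ℕ)
    (hk : k ≤ L) (w : PauliWord n) : (w.mat * noisyState lam c ρ θ k).trace =
      (pathVal (fun _ => 0) (fun k w v => (1 - lam) ^ v.weight * c.transition θ k w v)
        ρ.expect k w 0 : ℂ) := by
  induction k generalizing w with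
  | zero => simpa [pathVal, noisyState] using ρ.trace_mul w
  | succ k ih =>
    have hk' : k < L := hk
    rw [noisyState, dif_pos hk']
    have h1 := PauliWord.sum_trace_smul (noisyState lam c ρ θ k)
    have h2 := congrArg (noiseLinear lam) h1
    rw [map_sum, map_smul] at h2
    simp only [map_smul] at h2
    change ∑ v : PauliWord n, _ • noise lam v.mat = (2 ^ n : ℂ) • noise lam _ at h2
    have h3 := congrArg (fun A => (w.mat * (c.layerUnitary θ ⟨k, hk'⟩ * A *
      (c.layerUnitary θ ⟨k, hk'⟩).conjTranspose)).trace) h2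
    simp only [Finset.mul_sum, Finset.sum_mul, Matrix.trace_sum, Matrix.mul_smul, Matrix.smul_mul,
      Matrix.trace_smul, noise_mat, c.trace_layerCoeff, ih hk'.le, smul_eq_mul] at h3
    have h4 : (2 ^ n : ℂ) ≠ 0 := by simp
    refine mul_left_cancel₀ h4 (h3.symm.trans ?_)
    simp only [pathVal, Circuit.transition, hk', dif_pos]
    push_cast
    rw [Finset.mul_sum]
    exact Finset.sum_congr rfl fun v _ => by ring

theorem noisyCost_eq_sum (lam : ℝ) (c : Circuit n L) (H : Hamiltonian n) (ρ : InputState n)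
    (θ : c.Params) : noisyCost lam c H ρ θ =
      ((∑ s : PauliPath n L,
        (1 - lam) ^ PauliPath.weight s * pathAmplitude c H ρ θ s : ℝ) : ℂ) := by
  have h1 := PauliWord.sum_trace_smul (noisyState lam c ρ θ L)
  have h2 := congrArg (noiseLinear lam) h1
  rw [map_sum, map_smul] at h2
  simp only [map_smul] at h2
  change ∑ v : PauliWord n, _ • noise lam v.mat = (2 ^ n : ℂ) • noise lam _ at h2
  have h3 := congrArg (fun A => (H.mat * A).trace) h2
  simp only [Finset.mul_sum, Matrix.trace_sum, Matrix.mul_smul, Matrix.trace_smul, noise_mat,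
    noisyState_expect lam c ρ θ L le_rfl, smul_eq_mul, H.trace_mul_mat] at h3
  have h4 : (2 ^ n : ℂ) ≠ 0 := by simp
  refine mul_left_cancel₀ h4 (h3.symm.trans ?_)
  have h5 := sum_all_paths (fun k w v => (1 - lam) ^ v.weight * c.transition θ k w v)
    (fun w => (1 - lam) ^ w.weight * H.coeff w) ρ.expect L
  have h6 : ∑ s : PauliPath n L, (1 - lam) ^ PauliPath.weight s * pathAmplitude c H ρ θ s =
      ∑ s : PauliPath n L, ((1 - lam) ^ (s (Fin.last L)).weight * H.coeff (s (Fin.last L))) *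
        (∏ i : Fin L, ((1 - lam) ^ (s i.castSucc).weight *
          c.transition θ i (s i.succ) (s i.castSucc))) * ρ.expect (s 0) := by
    refine Finset.sum_congr rfl fun s _ => ?_
    simp only [c.transition_val, pathAmplitude]
    rw [PauliPath.weight, Fin.sum_univ_castSucc, pow_add, ← Finset.prod_pow_eq_pow_sum,
      Finset.prod_mul_distrib]
    ring
  rw [h6, h5]
  push_cast
  rw [Finset.mul_sum]
  exact Finset.sum_congr rfl fun v _ => by ring

/-- The squared contributions of all Pauli paths add up to at most the squared coefficients of the
Hamiltonian. -/
theorem sum_pathAmplitude_sq_le (c : Circuit n L) (H : Hamiltonian n) (ρ : InputState n)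
    (θ : c.Params) : ∑ s : PauliPath n L, pathAmplitude c H ρ θ s ^ 2 ≤ ∑ w, H.coeff w ^ 2 := by
  have h1 := sum_all_paths (fun k w v => c.transition θ k w v ^ 2)
    (fun w => H.coeff w ^ 2) (fun w => ρ.expect w ^ 2) L
  -- The squared amplitudes form a path sum again. Its transition rows sum to `1` and its initial
  -- values are at most `1`, so every partial sum is at most `1`.
  have h2 : ∀ k w, pathVal (fun _ => 0) (fun k w v => c.transition θ k w v ^ 2)
      (fun w => ρ.expect w ^ 2) k w 0 ≤ 1 := by
    intro k
    induction k with
    | zero => exact fun w => by simpa [pathVal] using (ρ.expect_sq_le_one w)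
    | succ k ih =>
      intro w
      rw [pathVal, if_pos le_rfl]
      by_cases hk : k < L
      · rw [← c.sum_layerCoeff_sq θ ⟨k, hk⟩ w]
        refine Finset.sum_le_sum fun v _ => ?_
        simp only [Circuit.transition, hk, dif_pos]
        exact mul_le_of_le_one_right (sq_nonneg _) (ih v)
      · simp [Circuit.transition, hk]
  calc _ = ∑ s : PauliPath n L, H.coeff (s (Fin.last L)) ^ 2 *
        (∏ i : Fin L, c.transition θ i (s i.succ) (s i.castSucc) ^ 2) * ρ.expect (s 0) ^ 2 := by
        refine Finset.sum_congr rfl fun s _ => ?_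
        simp only [c.transition_val, pathAmplitude, Finset.prod_pow]
        ring
    _ = _ := h1
    _ ≤ _ := Finset.sum_le_sum fun w _ => mul_le_of_le_one_right (sq_nonneg _) (h2 L w)

/-! ### Dependence of a contribution on the parameters -/

/-- The possible dependences of a Pauli path contribution on one parameter. -/
inductive TrigKind
  | one | cos | sin
  deriving DecidableEq

/-- The function of one parameter. -/
def TrigKind.eval : TrigKind → ℝ → ℝ
  | .one, _ => 1
  | .cos, θ => Real.cos θ
  | .sin, θ => Real.sin θ

/-- The product of the words of all rotations through which a path contributes with a sine. -/
def sinProd (κ : ι → TrigKind) : List (PauliWord n × ι) → PauliWord n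
  | [] => PauliWord.one n
  | r :: rs => if κ r.2 = .sin then r.1.mul (sinProd κ rs) else sinProd κ rs

theorem sinProd_congr {κ κ' : ι → TrigKind} (rs : List (PauliWord n × ι))
    (h : ∀ r ∈ rs, κ r.2 = κ' r.2) : sinProd κ rs = sinProd κ' rs := by
  induction rs with
  | nil => rfl
  | cons r rs ih =>
    rw [sinProd, sinProd, h r (by simp), ih fun r' hr' => h r' (by simp [hr'])]

theorem sinProd_apply_eq_I (κ : ι → TrigKind) (rs : List (PauliWord n × ι)) (j : Fin n)
    (h : ∀ r ∈ rs, r.1 j = .I) : sinProd κ rs j = .I := by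
  induction rs with
  | nil => rfl
  | cons r rs ih =>
    have h1 := ih fun r' hr' => h r' (by simp [hr'])
    rw [sinProd]
    split_ifs
    · rw [PauliWord.mul, h r (by simp), h1]
      rfl
    · exact h1

theorem prod_update_eval [Fintype ι] [DecidableEq ι] (κ : ι → TrigKind) (p : ι)
    (hp : κ p = .one) (k : TrigKind) (θ : ι → ℝ) :
    ∏ q, (Function.update κ p k q).eval (θ q) = k.eval (θ p) * ∏ q, (κ q).eval (θ q) := by
  rw [← Finset.mul_prod_erase _ _ (Finset.mem_univ p),
    ← Finset.mul_prod_erase Finset.univ (fun q => (κ q).eval (θ q)) (Finset.mem_univ p), hp,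
    Function.update_self, TrigKind.eval, one_mul]
  congr 1
  refine Finset.prod_congr rfl fun q hq => ?_
  rw [Function.update_of_ne (Finset.ne_of_mem_erase hq)]

/-- A priori the recursion yields a sum over branches, but `f` detects a single output word, and
different branches end in different words because the rotations have disjoint supports. One monomial
remains; `κ` records it and thereby which rotations branched and the total word they multiplied. -/
theorem rotVal_eq_prod [Fintype ι] [DecidableEq ι] (rs : List (PauliWord n × ι))
    (hd : rs.Pairwise fun r r' => Disjoint r.1.support r'.1.support)
    (hι : (rs.map Prod.snd).Nodup) (hne : ∀ r ∈ rs, r.1.support.Nonempty)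
    (f : PauliWord n → ℝ) (hf : ∀ v w, f v ≠ 0 → f w ≠ 0 → v = w) (w : PauliWord n) :
    ∃ (C : ℝ) (κ : ι → TrigKind), (∀ θ, rotVal θ rs f w = C * ∏ p, (κ p).eval (θ p)) ∧
      (∀ p, p ∉ rs.map Prod.snd → κ p = .one) ∧
      (C ≠ 0 → f (w.mul (sinProd κ rs)) ≠ 0 ∧
        ∀ r ∈ rs, (κ r.2 = .one ↔ r.1.sgn w = 0)) := by
  induction rs generalizing w with
  | nil =>
    refine ⟨f w, fun _ => .one, fun θ => by simp [rotVal, TrigKind.eval], fun _ _ => rfl,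
      fun h => ⟨by simpa [sinProd, PauliWord.mul_one] using h, by simp⟩⟩
  | cons r rs ih =>
    rw [List.pairwise_cons] at hd
    rw [List.map_cons, List.nodup_cons] at hι
    have hne' : ∀ r ∈ rs, r.1.support.Nonempty := fun r' hr' => hne r' (by simp [hr'])
    have hmem : ∀ r' ∈ rs, r'.2 ≠ r.2 := fun r' hr' h => hι.1 (h ▸ List.mem_map_of_mem hr')
    obtain ⟨C₁, κ₁, h₁, ho₁, hC₁⟩ := ih hd.2 hι.2 hne' w
    by_cases hs : r.1.sgn w = 0
    · refine ⟨C₁, κ₁, fun θ => by rw [rotVal, if_pos hs, h₁], fun p hp => ho₁ p ?_, fun hC => ?_⟩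
      · simp only [List.map_cons, List.mem_cons, not_or] at hp
        exact hp.2
      · have hr := ho₁ r.2 hι.1
        rw [sinProd, if_neg (by simp [hr])]
        refine ⟨(hC₁ hC).1, fun r' hr' => ?_⟩
        rcases List.mem_cons.1 hr' with rfl | hr'
        · simp [hr, hs]
        · exact (hC₁ hC).2 r' hr'
    · obtain ⟨C₂, κ₂, h₂, ho₂, hC₂⟩ := ih hd.2 hι.2 hne' (r.1.mul w)
      have hout : ∀ (κ : ι → TrigKind) (k : TrigKind),
          (∀ p, p ∉ rs.map Prod.snd → κ p = .one) →
          ∀ p, p ∉ (r :: rs).map Prod.snd → Function.update κ r.2 k p = .one := by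
        intro κ k hκ p hp
        simp only [List.map_cons, List.mem_cons, not_or] at hp
        rw [Function.update_of_ne hp.1]
        exact hκ p hp.2
      have hprod : ∀ (κ : ι → TrigKind) (k : TrigKind),
          sinProd (Function.update κ r.2 k) rs = sinProd κ rs := fun κ k =>
        sinProd_congr rs fun r' hr' => Function.update_of_ne (hmem r' hr') _ _
      by_cases hz : C₁ = 0
      · refine ⟨r.1.sgn w * C₂, Function.update κ₂ r.2 .sin, fun θ => ?_, hout _ _ ho₂,
          fun hC => ?_⟩
        · rw [rotVal, if_neg hs, h₁, h₂, prod_update_eval κ₂ _ (ho₂ _ hι.1), hz, TrigKind.eval]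
          ring
        · have hC' := hC₂ (right_ne_zero_of_mul hC)
          rw [sinProd, Function.update_self, if_pos rfl, hprod, ← PauliWord.mul_assoc,
            PauliWord.mul_comm w]
          refine ⟨hC'.1, fun r' hr' => ?_⟩
          rcases List.mem_cons.1 hr' with rfl | hr'
          · simp [hs]
          · rw [Function.update_of_ne (hmem r' hr'), hC'.2 r' hr',
              PauliWord.sgn_mul_of_sgn_eq_zero
                (PauliWord.sgn_eq_zero_of_disjoint (hd.1 r' hr').symm)]
      -- If both branches survived, they would end in the same word. At a qubit of `r.1` the other
      -- rotations are trivial, so this would force `r.1` to be the identity there.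
      · have hC₂0 : C₂ = 0 := by
          by_contra hz'
          have h3 := hf _ _ (hC₁ hz).1 (hC₂ hz').1
          obtain ⟨j, hj⟩ := hne r (by simp)
          have hI : ∀ r' ∈ rs, r'.1 j = .I := by
            intro r' hr'
            by_contra hj'
            exact Finset.disjoint_left.1 (hd.1 r' hr') hj (by simpa [PauliWord.support] using hj')
          have h4 := congrFun h3 j
          simp only [PauliWord.mul, sinProd_apply_eq_I _ rs j hI, Pauli.mul_I] at h4
          have h5 : ∀ a b : Pauli, a = b.mul a → b = .I := by decide
          exact absurd (h5 _ _ h4) (by simpa [PauliWord.support] using hj)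
        refine ⟨C₁, Function.update κ₁ r.2 .cos, fun θ => ?_, hout _ _ ho₁, fun hC => ?_⟩
        · rw [rotVal, if_neg hs, h₁, h₂, prod_update_eval κ₁ _ (ho₁ _ hι.1), hC₂0, TrigKind.eval]
          ring
        · rw [sinProd, Function.update_self, if_neg (by simp), hprod]
          refine ⟨(hC₁ hC).1, fun r' hr' => ?_⟩
          rcases List.mem_cons.1 hr' with rfl | hr'
          · simp [hs]
          · rw [Function.update_of_ne (hmem r' hr')]
            exact (hC₁ hC).2 r' hr'

namespace Circuit

variable (c : Circuit n L)

theorem pairwise_rots (i : Fin L) :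
    (c.rots i).Pairwise fun r r' => Disjoint r.1.support r'.1.support := by
  rw [rots, List.pairwise_ofFn]
  intro j j' hj
  exact c.disjoint i (show Sum.inl j ≠ Sum.inl j' by simpa using hj.ne)

theorem nodup_rots (i : Fin L) : ((c.rots i).map Prod.snd).Nodup := by
  rw [rots, List.map_ofFn, List.nodup_ofFn]
  intro j j' h
  simpa using h

/-- The Clifford part is injective on words, so the indicator of `v` pulled back through it still
detects at most one word. -/
theorem layerCoeff_eq_prod (i : Fin L) (w v : PauliWord n) :
    ∃ (C : ℝ) (κ : c.ParamIndex → TrigKind),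
      (∀ θ, c.layerCoeff θ i w v = C * ∏ p, (κ p).eval (θ p)) ∧
      (∀ p, p.1 ≠ i → κ p = .one) ∧
      (C ≠ 0 → v = gatesAct (c.gates i) (w.mul (sinProd κ (c.rots i))) ∧
        ∀ j, (κ ⟨i, j⟩ = .one ↔ (c.word i j).sgn w = 0)) := by
  obtain ⟨C, κ, h1, h2, h3⟩ := rotVal_eq_prod (c.rots i) (c.pairwise_rots i) (c.nodup_rots i)
    (by
      intro r hr
      obtain ⟨j, rfl⟩ := List.mem_ofFn.1 hr
      exact c.word_nontrivial i j)
    (gatesVal (c.gates i) fun u => if u = v then 1 else 0)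
    (by
      intro u u' hu hu'
      rw [gatesVal_eq] at hu hu'
      have h := right_ne_zero_of_mul hu
      have h' := right_ne_zero_of_mul hu'
      simp only [ne_eq, ite_eq_right_iff, one_ne_zero, imp_false, not_not] at h h'
      exact gatesAct_injective _ (h.trans h'.symm)) w
  refine ⟨C, κ, h1, fun p hp => h2 p ?_, fun hC => ?_⟩
  · intro hp'
    obtain ⟨r, hr, rfl⟩ := List.mem_map.1 hp'
    obtain ⟨j, rfl⟩ := List.mem_ofFn.1 hr
    exact hp rfl
  · obtain ⟨h4, h5⟩ := h3 hC
    rw [gatesVal_eq] at h4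
    have h := right_ne_zero_of_mul h4
    simp only [ne_eq, ite_eq_right_iff, one_ne_zero, imp_false, not_not] at h
    exact ⟨h.symm, fun j => h5 _ (List.mem_ofFn.2 ⟨j, rfl⟩)⟩

end Circuit

/-- Each layer depends on its own parameters only, so the monomials of the layers multiply to one
monomial in all parameters. -/
theorem pathAmplitude_eq_prod (c : Circuit n L) (H : Hamiltonian n) (ρ : InputState n)
    (s : PauliPath n L) :
    ∃ (C : ℝ) (κ : c.ParamIndex → TrigKind),
      (∀ θ, pathAmplitude c H ρ θ s = C * ∏ p, (κ p).eval (θ p)) ∧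
      (C ≠ 0 → ∀ i : Fin L,
        s i.castSucc = gatesAct (c.gates i) ((s i.succ).mul (sinProd κ (c.rots i))) ∧
        ∀ j, (κ ⟨i, j⟩ = .one ↔ (c.word i j).sgn (s i.succ) = 0)) := by
  choose C κ h1 h2 h3 using fun i : Fin L =>
    c.layerCoeff_eq_prod i (s i.succ) (s i.castSucc)
  refine ⟨H.coeff (s (Fin.last L)) * (∏ i, C i) * ρ.expect (s 0), fun p => κ p.1 p,
    fun θ => ?_, fun hC i => ?_⟩
  · have h4 : ∏ i, ∏ p, (κ i p).eval (θ p) = ∏ p, (κ p.1 p).eval (θ p) := by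
      rw [Finset.prod_comm]
      refine Finset.prod_congr rfl fun p _ => ?_
      refine Finset.prod_eq_single p.1 (fun i _ hi => ?_) (by simp)
      rw [h2 i p hi.symm, TrigKind.eval]
    simp only [pathAmplitude, h1, Finset.prod_mul_distrib, h4]
    ring
  · have hCi : C i ≠ 0 :=
      Finset.prod_ne_zero_iff.1 (right_ne_zero_of_mul (left_ne_zero_of_mul hC)) i
        (Finset.mem_univ i)
    obtain ⟨h4, h5⟩ := h3 i hCi
    refine ⟨?_, h5⟩
    rw [sinProd_congr (κ' := κ i) (c.rots i)]
    · exact h4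
    · intro r hr
      obtain ⟨j, rfl⟩ := List.mem_ofFn.1 hr
      rfl

/-! ### Paths with the same dependence on the parameters -/

namespace Circuit

variable (c : Circuit n L)

theorem conjTranspose_mul_cliffordUpTo (k : ℕ) :
    (c.cliffordUpTo k).conjTranspose * c.cliffordUpTo k = 1 := by
  induction k with
  | zero => simp [cliffordUpTo]
  | succ k ih =>
    rw [cliffordUpTo]
    split_ifs with h
    · rw [Matrix.conjTranspose_mul, Matrix.mul_assoc, ← Matrix.mul_assoc _ (c.cliffordLayer _),
        c.conjTranspose_mul_cliffordLayer, Matrix.one_mul, ih]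
    · exact ih

/-- Rotations and Clifford gates of the same layer act on different qubits. So it does not matter
that `effectedWord` leaves out the gates of its own layer. -/
theorem gatesAct_word (i : Fin L) (j : Fin (c.numRot i)) :
    (c.cliffordLayer i).conjTranspose * (c.word i j).mat * c.cliffordLayer i =
      (c.word i j).mat := by
  obtain ⟨h1, h2⟩ := gatesAct_eq_self (c.gates i) (c.word i j) (by
    intro g hg
    obtain ⟨k, rfl⟩ := List.mem_ofFn.1 hg
    exact c.disjoint i (show Sum.inl j ≠ Sum.inr k by simp))
  rw [c.cliffordLayer_eq, gates_conj_mat, h1, h2, Complex.ofReal_one, one_smul]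

/-- If the rotation words generate all words, then a sequence of words which is compatible with the
Clifford gates and commutes with all rotations is trivial. -/
theorem eq_one_of_forall_comm (hc : c.Generates) (d : Fin (L + 1) → PauliWord n)
    (h1 : ∀ i : Fin L, d i.castSucc = gatesAct (c.gates i) (d i.succ))
    (h2 : ∀ (i : Fin L) (j), (c.word i j).sgn (d i.succ) = 0) (i : Fin (L + 1)) :
    d i = PauliWord.one n := by
  -- Up to non-zero scalars, all words of the sequence are Clifford transports of `d 0`.
  have key : ∀ k (hk : k < L + 1), ∃ z : ℂ, z ≠ 0 ∧ (c.cliffordUpTo k).conjTranspose *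
      (d ⟨k, hk⟩).mat * c.cliffordUpTo k = z • (d 0).mat := by
    intro k
    induction k with
    | zero => exact fun _ => ⟨1, one_ne_zero, by simp [cliffordUpTo]⟩
    | succ k ih =>
      intro hk
      have hk' : k < L := by omega
      obtain ⟨z, hz, h⟩ := ih (by omega)
      refine ⟨(gatesSign (c.gates ⟨k, hk'⟩) (d ⟨k + 1, hk⟩) : ℂ) * z,
        mul_ne_zero (by exact_mod_cast gatesSign_ne_zero _ _) hz, ?_⟩
      rw [cliffordUpTo, dif_pos hk', Matrix.conjTranspose_mul]
      calc _ = (c.cliffordUpTo k).conjTranspose * ((c.cliffordLayer ⟨k, hk'⟩).conjTranspose *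
            (d ⟨k + 1, hk⟩).mat * c.cliffordLayer ⟨k, hk'⟩) * c.cliffordUpTo k := by
              simp only [Matrix.mul_assoc]
        _ = _ := by
          rw [cliffordLayer_eq, gates_conj_mat]
          have := h1 ⟨k, hk'⟩
          change d ⟨k, _⟩ = gatesAct _ (d ⟨k + 1, _⟩) at this
          rw [← this, Matrix.mul_smul, Matrix.smul_mul, h, smul_smul]
  have hcomm : ∀ p : c.ParamIndex, (d 0).mat * c.effectedWord p = c.effectedWord p * (d 0).mat := by
    rintro ⟨i, j⟩
    obtain ⟨z, hz, h⟩ := key i (by omega)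
    set W := c.cliffordUpTo i with hW
    have hWW : W * W.conjTranspose = 1 := mul_eq_one_comm.1 (c.conjTranspose_mul_cliffordUpTo i)
    have hV : c.cliffordLayer i * (c.cliffordLayer i).conjTranspose = 1 :=
      mul_eq_one_comm.1 (c.conjTranspose_mul_cliffordLayer i)
    -- The hypothesis concerns `d i.succ`. Conjugation with the Clifford gates of layer `i` turns it
    -- into `d i.castSucc` and fixes the rotation word, so commutation carries over.
    have hd : (d i.castSucc).mat * (c.word i j).mat = (c.word i j).mat * (d i.castSucc).mat := by
      have h3 := gates_conj_mat (c.gates i) (d i.succ)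
      rw [← c.cliffordLayer_eq, ← h1] at h3
      have h4 : ((gatesSign (c.gates i) (d i.succ) : ℝ) : ℂ) ≠ 0 := by
        exact_mod_cast gatesSign_ne_zero _ _
      have h5 := PauliWord.mat_comm_of_sgn_eq_zero (h2 i j)
      have h6 : ∀ A B : QMat n, (c.cliffordLayer i).conjTranspose * A * c.cliffordLayer i *
          ((c.cliffordLayer i).conjTranspose * B * c.cliffordLayer i) =
          (c.cliffordLayer i).conjTranspose * (A * B) * c.cliffordLayer i := by
        intro A B
        calc _ = (c.cliffordLayer i).conjTranspose * A *
              (c.cliffordLayer i * (c.cliffordLayer i).conjTranspose) * B * c.cliffordLayer i := by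
                simp only [Matrix.mul_assoc]
          _ = _ := by
            rw [hV, Matrix.mul_one]
            simp only [Matrix.mul_assoc]
      have h7 := h6 (c.word i j).mat (d i.succ).mat
      rw [h5, ← h6, c.gatesAct_word, h3, Matrix.mul_smul, Matrix.smul_mul] at h7
      exact (smul_right_injective _ h4 h7).symm
    have h8 : ∀ A B : QMat n, W.conjTranspose * A * W * (W.conjTranspose * B * W) =
        W.conjTranspose * (A * B) * W := by
      intro A B
      calc _ = W.conjTranspose * A * (W * W.conjTranspose) * B * W := by
              simp only [Matrix.mul_assoc]
        _ = _ := by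
          rw [hWW, Matrix.mul_one]
          simp only [Matrix.mul_assoc]
    change W.conjTranspose * (d i.castSucc).mat * W = z • (d 0).mat at h
    have h9 := h8 (d i.castSucc).mat (c.word i j).mat
    rw [hd, ← h8, h, Matrix.mul_smul, Matrix.smul_mul] at h9
    exact smul_right_injective _ hz h9
  have h0 : d 0 = PauliWord.one n := by
    refine PauliWord.eq_one_of_forall_comm fun w => ?_
    obtain ⟨k, hk⟩ := hc w
    -- The centralizer of `d 0` is a submonoid containing the generators, hence a phase multiple of
    -- every word.
    have hle : Submonoid.closure (Set.range c.effectedWord) ≤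
        Submonoid.centralizer {(d 0).mat} := by
      rw [Submonoid.closure_le]
      rintro _ ⟨p, rfl⟩
      rw [SetLike.mem_coe, Submonoid.mem_centralizer_iff]
      rintro _ rfl
      exact hcomm p
    have h3 := Submonoid.mem_centralizer_iff.1 (hle hk) _ rfl
    rw [Matrix.mul_smul, Matrix.smul_mul] at h3
    exact smul_right_injective _ (pow_ne_zero k Complex.I_ne_zero) h3
  induction i using Fin.induction with
  | zero => exact h0
  | succ i ih =>
    have h3 : gatesAct (c.gates i) (PauliWord.one n) = PauliWord.one n :=
      (gatesAct_eq_self _ _ (by simp [PauliWord.support, PauliWord.one])).1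
    refine gatesAct_injective (c.gates i) ?_
    rw [← h1, ih, h3]

/-- In the wordwise product of the two paths the common sine words cancel, as every word squares to
the identity, so the product evolves by Clifford gates alone. It commutes with every rotation
because both paths branch at the same ones. -/
theorem path_eq_of_kind_eq (hc : c.Generates) (κ : c.ParamIndex → TrigKind) (s s' : PauliPath n L)
    (h : ∀ i : Fin L,
      s i.castSucc = gatesAct (c.gates i) ((s i.succ).mul (sinProd κ (c.rots i))) ∧
      ∀ j, (κ ⟨i, j⟩ = .one ↔ (c.word i j).sgn (s i.succ) = 0))
    (h' : ∀ i : Fin L,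
      s' i.castSucc = gatesAct (c.gates i) ((s' i.succ).mul (sinProd κ (c.rots i))) ∧
      ∀ j, (κ ⟨i, j⟩ = .one ↔ (c.word i j).sgn (s' i.succ) = 0)) : s = s' := by
  funext i
  refine PauliWord.eq_of_mul_eq_one
    (c.eq_one_of_forall_comm hc (fun i => (s i).mul (s' i)) (fun i => ?_) (fun i j => ?_) i)
  · rw [(h i).1, (h' i).1, ← gatesAct_mul]
    congr 1
    funext j
    simp only [PauliWord.mul]
    rw [Pauli.mul_mul_mul_comm, Pauli.mul_self, Pauli.mul_I]
  · exact PauliWord.sgn_mul_eq_zero (((h i).2 j).symm.trans ((h' i).2 j))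

end Circuit

end NoisyVQA
end

/-! ### Orthogonality of paths, mean square error, Chebyshev's inequality, norm of the Hamiltonian.
-/

noncomputable section

namespace NoisyVQA

variable {n L : ℕ}

/-! ### Mean square error of the truncation -/

/-- The uniform distribution on `[-π, π]`. -/
def angleMeasure : MeasureTheory.Measure ℝ :=
  ProbabilityTheory.cond MeasureTheory.volume (Set.Icc (-Real.pi) Real.pi)

instance : MeasureTheory.IsProbabilityMeasure angleMeasure :=
  ProbabilityTheory.cond_isProbabilityMeasure_of_finite
    (by
      rw [Real.volume_Icc, Ne, ENNReal.ofReal_eq_zero, not_le]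
      linarith [Real.pi_pos])
    (by simp)

theorem integral_angleMeasure (f : ℝ → ℝ) (h : ∫ θ in (-Real.pi)..Real.pi, f θ = 0) :
    ∫ θ, f θ ∂angleMeasure = 0 := by
  rw [angleMeasure, ProbabilityTheory.cond, MeasureTheory.integral_smul_measure,
    MeasureTheory.integral_Icc_eq_integral_Ioc,
    ← intervalIntegral.integral_of_le (by linarith [Real.pi_pos]), h, smul_zero]

/-- The functions `1`, `cos`, `sin` are orthogonal over a full period. -/
theorem TrigKind.integral_eval_mul_eval {k k' : TrigKind} (h : k ≠ k') :
    ∫ θ, k.eval θ * k'.eval θ ∂angleMeasure = 0 := by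
  have hsc : ∫ θ in (-Real.pi)..Real.pi, Real.sin θ * Real.cos θ = 0 := by
    rw [integral_sin_mul_cos₁]
    simp
  apply integral_angleMeasure
  cases k <;> cases k' <;> first | exact absurd rfl h | skip
  · simp [TrigKind.eval]
  · simp [TrigKind.eval]
  · simp [TrigKind.eval]
  · simpa only [TrigKind.eval, mul_comm] using hsc
  · simp [TrigKind.eval]
  · exact hsc

instance (c : Circuit n L) : MeasureTheory.IsProbabilityMeasure c.paramMeasure :=
  inferInstanceAs (MeasureTheory.IsProbabilityMeasure
    (MeasureTheory.Measure.pi fun _ : c.ParamIndex => angleMeasure))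

/-- Distinct paths with non-zero constants have distinct monomials, which differ at some parameter.
By independence the integral factorizes, and the factor of that parameter vanishes. -/
theorem integral_pathAmplitude_mul (c : Circuit n L) (hc : c.Generates) (H : Hamiltonian n)
    (ρ : InputState n) {s s' : PauliPath n L} (h : s ≠ s') :
    ∫ θ, pathAmplitude c H ρ θ s * pathAmplitude c H ρ θ s' ∂c.paramMeasure = 0 := by
  obtain ⟨C, κ, h1, h2⟩ := pathAmplitude_eq_prod c H ρ s
  obtain ⟨C', κ', h1', h2'⟩ := pathAmplitude_eq_prod c H ρ s'
  have h3 : ∀ θ, pathAmplitude c H ρ θ s * pathAmplitude c H ρ θ s' =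
      C * C' * ∏ p, ((κ p).eval (θ p) * (κ' p).eval (θ p)) := by
    intro θ
    rw [h1, h1', Finset.prod_mul_distrib]
    ring
  simp only [h3]
  rw [MeasureTheory.integral_const_mul]
  by_cases hC : C = 0
  · simp [hC]
  by_cases hC' : C' = 0
  · simp [hC']
  have hκ : κ ≠ κ' := by
    rintro rfl
    exact h (c.path_eq_of_kind_eq hc κ s s' (h2 hC) (h2' hC'))
  obtain ⟨p, hp⟩ := Function.ne_iff.1 hκ
  have h4 : ∫ θ : c.Params, ∏ p, ((κ p).eval (θ p) * (κ' p).eval (θ p)) ∂c.paramMeasure =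
      ∏ p, ∫ t, (κ p).eval t * (κ' p).eval t ∂angleMeasure :=
    MeasureTheory.integral_fintype_prod_eq_prod
      (μ := fun _ => angleMeasure) (fun p t => (κ p).eval t * (κ' p).eval t)
  rw [h4, Finset.prod_eq_zero (Finset.mem_univ p) (TrigKind.integral_eval_mul_eval hp), mul_zero]

theorem TrigKind.continuous_eval (k : TrigKind) : Continuous k.eval := by
  cases k
  · exact continuous_const
  · exact Real.continuous_cos
  · exact Real.continuous_sin

theorem TrigKind.abs_eval_le_one (k : TrigKind) (θ : ℝ) : |k.eval θ| ≤ 1 := by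
  cases k
  · simp [TrigKind.eval]
  · exact Real.abs_cos_le_one θ
  · exact Real.abs_sin_le_one θ

theorem continuous_pathAmplitude (c : Circuit n L) (H : Hamiltonian n) (ρ : InputState n)
    (s : PauliPath n L) : Continuous fun θ => pathAmplitude c H ρ θ s := by
  obtain ⟨C, κ, h1, -⟩ := pathAmplitude_eq_prod c H ρ s
  simp only [h1]
  exact continuous_const.mul (continuous_finsetProd _ fun p _ =>
    (κ p).continuous_eval.comp (continuous_apply p))

theorem abs_pathAmplitude_le (c : Circuit n L) (H : Hamiltonian n) (ρ : InputState n)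
    (s : PauliPath n L) : ∃ C, ∀ θ, |pathAmplitude c H ρ θ s| ≤ C := by
  obtain ⟨C, κ, h1, -⟩ := pathAmplitude_eq_prod c H ρ s
  refine ⟨|C|, fun θ => ?_⟩
  rw [h1, abs_mul, Finset.abs_prod]
  exact mul_le_of_le_one_right (abs_nonneg _)
    (Finset.prod_le_one (fun _ _ => abs_nonneg _) fun p _ => (κ p).abs_eval_le_one _)

theorem integrable_pathAmplitude_mul (c : Circuit n L) (H : Hamiltonian n) (ρ : InputState n)
    (s s' : PauliPath n L) : MeasureTheory.Integrable
      (fun θ => pathAmplitude c H ρ θ s * pathAmplitude c H ρ θ s') c.paramMeasure := by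
  obtain ⟨C, h⟩ := abs_pathAmplitude_le c H ρ s
  obtain ⟨C', h'⟩ := abs_pathAmplitude_le c H ρ s'
  refine MeasureTheory.Integrable.of_bound (C := C * C')
    ((continuous_pathAmplitude c H ρ s).mul
      (continuous_pathAmplitude c H ρ s')).aestronglyMeasurable
    (Filter.Eventually.of_forall fun θ => ?_)
  rw [Real.norm_eq_abs, abs_mul]
  exact mul_le_mul (h θ) (h' θ) (abs_nonneg _) ((abs_nonneg _).trans (h θ))

/-- The contribution of the discarded paths. -/
def truncationError (lam : ℝ) (c : Circuit n L) (H : Hamiltonian n) (ρ : InputState n) (M : ℕ)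
    (θ : c.Params) : ℝ :=
  ∑ s : PauliPath n L with ¬PauliPath.weight s ≤ M,
    (1 - lam) ^ PauliPath.weight s * pathAmplitude c H ρ θ s

theorem norm_truncatedCost_sub (lam : ℝ) (c : Circuit n L) (H : Hamiltonian n) (ρ : InputState n)
    (M : ℕ) (θ : c.Params) : ‖truncatedCost lam c H ρ M θ - noisyCost lam c H ρ θ‖ =
      |truncationError lam c H ρ M θ| := by
  rw [truncatedCost_eq_sum, noisyCost_eq_sum, ← Complex.ofReal_sub, Complex.norm_real,
    Real.norm_eq_abs, ← Finset.sum_filter_add_sum_filter_not Finset.univ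
      (fun s : PauliPath n L => PauliPath.weight s ≤ M), sub_add_cancel_left, abs_neg]
  rfl

theorem sq_sum_eq {α : Type*} (t : Finset α) (a : α → ℝ) :
    (∑ s ∈ t, a s) ^ 2 = ∑ s ∈ t, ∑ s' ∈ t, a s * a s' := by
  rw [sq, Finset.sum_mul_sum]

theorem integrable_truncationError_sq (lam : ℝ) (c : Circuit n L) (H : Hamiltonian n)
    (ρ : InputState n) (M : ℕ) : MeasureTheory.Integrable
      (fun θ => truncationError lam c H ρ M θ ^ 2) c.paramMeasure := by
  simp only [truncationError, sq_sum_eq]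
  refine MeasureTheory.integrable_finsetSum _ fun s _ =>
    MeasureTheory.integrable_finsetSum _ fun s' _ => ?_
  refine ((integrable_pathAmplitude_mul c H ρ s s').const_mul
    ((1 - lam) ^ PauliPath.weight s * (1 - lam) ^ PauliPath.weight s')).congr
    (Filter.Eventually.of_forall fun θ => ?_)
  simp only
  ring

/-- Orthogonality removes the cross terms. Discarded paths have weight at least `M + 1`, whence the
exponent `2M + 2`. -/
theorem integral_truncationError_sq_le (lam : ℝ) (hl : 0 ≤ lam) (hl' : lam ≤ 1) (c : Circuit n L)
    (hc : c.Generates) (H : Hamiltonian n) (ρ : InputState n) (M : ℕ) :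
    ∫ θ, truncationError lam c H ρ M θ ^ 2 ∂c.paramMeasure ≤
      (1 - lam) ^ (2 * M + 2) * ∑ w, H.coeff w ^ 2 := by
  set r := 1 - lam with hr
  have hr0 : 0 ≤ r := by linarith
  have hr1 : r ≤ 1 := by linarith
  set t := Finset.univ.filter fun s : PauliPath n L => ¬PauliPath.weight s ≤ M with ht
  have h1 : ∫ θ, truncationError lam c H ρ M θ ^ 2 ∂c.paramMeasure =
      ∑ s ∈ t, ∫ θ, (r ^ PauliPath.weight s) ^ 2 * pathAmplitude c H ρ θ s ^ 2
        ∂c.paramMeasure := by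
    have hi : ∀ s s' : PauliPath n L, MeasureTheory.Integrable (fun θ =>
        r ^ PauliPath.weight s * pathAmplitude c H ρ θ s *
          (r ^ PauliPath.weight s' * pathAmplitude c H ρ θ s')) c.paramMeasure := by
      intro s s'
      refine ((integrable_pathAmplitude_mul c H ρ s s').const_mul
        (r ^ PauliPath.weight s * r ^ PauliPath.weight s')).congr
        (Filter.Eventually.of_forall fun θ => ?_)
      simp only
      ring
    simp only [truncationError, sq_sum_eq]
    rw [MeasureTheory.integral_finsetSum _ fun s _ =>
      MeasureTheory.integrable_finsetSum _ fun s' _ => hi s s']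
    refine Finset.sum_congr rfl fun s hs => ?_
    rw [MeasureTheory.integral_finsetSum _ fun s' _ => hi s s',
      Finset.sum_eq_single_of_mem s hs]
    · congr 1
      funext θ
      ring
    · intro s' _ hs'
      have h2 : ∀ θ, r ^ PauliPath.weight s * pathAmplitude c H ρ θ s *
          (r ^ PauliPath.weight s' * pathAmplitude c H ρ θ s') =
          r ^ PauliPath.weight s * r ^ PauliPath.weight s' *
            (pathAmplitude c H ρ θ s * pathAmplitude c H ρ θ s') := fun θ => by ring
      simp only [h2]
      rw [MeasureTheory.integral_const_mul, integral_pathAmplitude_mul c hc H ρ hs'.symm, mul_zero]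
  have hint : ∀ s : PauliPath n L, MeasureTheory.Integrable
      (fun θ => pathAmplitude c H ρ θ s ^ 2) c.paramMeasure := by
    intro s
    simpa only [sq] using integrable_pathAmplitude_mul c H ρ s s
  have h3 : ∀ s ∈ t, ∫ θ, (r ^ PauliPath.weight s) ^ 2 * pathAmplitude c H ρ θ s ^ 2
      ∂c.paramMeasure ≤ r ^ (2 * M + 2) * ∫ θ, pathAmplitude c H ρ θ s ^ 2 ∂c.paramMeasure := by
    intro s hs
    rw [MeasureTheory.integral_const_mul, ← pow_mul]
    refine mul_le_mul_of_nonneg_right (pow_le_pow_of_le_one hr0 hr1 ?_)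
      (MeasureTheory.integral_nonneg fun θ => sq_nonneg _)
    simp only [ht, Finset.mem_filter, not_le] at hs
    omega
  rw [h1]
  calc _ ≤ ∑ s ∈ t, r ^ (2 * M + 2) * ∫ θ, pathAmplitude c H ρ θ s ^ 2 ∂c.paramMeasure :=
        Finset.sum_le_sum h3
    _ = r ^ (2 * M + 2) * ∫ θ, ∑ s ∈ t, pathAmplitude c H ρ θ s ^ 2 ∂c.paramMeasure := by
      rw [MeasureTheory.integral_finsetSum _ fun s _ => hint s, Finset.mul_sum]
    -- The bound on the squared amplitudes is pointwise in `θ`, so it survives averaging over a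
    -- probability measure.
    _ ≤ r ^ (2 * M + 2) * ∫ _, ∑ w, H.coeff w ^ 2 ∂c.paramMeasure := by
      refine mul_le_mul_of_nonneg_left (MeasureTheory.integral_mono
        (MeasureTheory.integrable_finsetSum _ fun s _ => hint s)
        (MeasureTheory.integrable_const _) fun θ => ?_) (pow_nonneg hr0 _)
      exact (Finset.sum_le_sum_of_subset_of_nonneg (Finset.subset_univ _)
        fun s _ _ => sq_nonneg _).trans (sum_pathAmplitude_sq_le c H ρ θ)
    _ = _ := by simp

/-- Markov's inequality for the squared error at the level `ε²`. -/
theorem one_sub_le_measureReal_truncation (lam : ℝ) (hl : 0 ≤ lam) (hl' : lam ≤ 1)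
    (c : Circuit n L) (hc : c.Generates) (H : Hamiltonian n) (ρ : InputState n) (M : ℕ) (ε δ : ℝ)
    (hε : 0 < ε) (hM : (1 - lam) ^ (2 * M + 2) * ∑ w, H.coeff w ^ 2 ≤ ε * ε * δ) :
    1 - δ ≤ c.paramMeasure.real
      {θ | ‖truncatedCost lam c H ρ M θ - noisyCost lam c H ρ θ‖ ≤ ε} := by
  simp only [norm_truncatedCost_sub]
  have h1 := (integral_truncationError_sq_le lam hl hl' c hc H ρ M).trans hM
  have h2 := MeasureTheory.mul_meas_ge_le_integral_of_nonneg (μ := c.paramMeasure)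
    (f := fun θ => truncationError lam c H ρ M θ ^ 2)
    (Filter.Eventually.of_forall fun θ => sq_nonneg _)
    (integrable_truncationError_sq lam c H ρ M) (ε * ε)
  have h3 : c.paramMeasure.real {θ | ε * ε ≤ truncationError lam c H ρ M θ ^ 2} ≤ δ :=
    le_of_mul_le_mul_left (h2.trans h1) (by positivity)
  have h4 : MeasurableSet {θ | |truncationError lam c H ρ M θ| ≤ ε} := by
    refine measurableSet_le (Continuous.measurable ?_) measurable_const
    refine (continuous_finsetSum _ fun s _ => ?_).abs
    exact continuous_const.mul (continuous_pathAmplitude c H ρ s)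
  have h5 := MeasureTheory.probReal_compl_eq_one_sub (μ := c.paramMeasure) h4
  have h6 : c.paramMeasure.real {θ | |truncationError lam c H ρ M θ| ≤ ε}ᶜ ≤
      c.paramMeasure.real {θ | ε * ε ≤ truncationError lam c H ρ M θ ^ 2} := by
    refine MeasureTheory.measureReal_mono fun θ hθ => ?_
    simp only [Set.mem_compl_iff, Set.mem_ofPred_eq, not_le] at hθ ⊢
    rw [← sq_abs]
    nlinarith
  linarith

/-! ### The coefficients of the Hamiltonian are bounded by its norm -/

/-- By orthogonality of the words, `∑ c²` is `2⁻ⁿ` times the squared Hilbert–Schmidt norm, that is,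
the average squared length of the `2ⁿ` columns. Each column is the image of a unit vector. -/
theorem Hamiltonian.sum_coeff_sq_le (H : Hamiltonian n) :
    ∑ w, H.coeff w ^ 2 ≤ H.opNorm ^ 2 := by
  have hH : H.mat.conjTranspose = H.mat := by
    unfold Hamiltonian.mat
    induction H.terms with
    | nil => simp
    | cons t l ih =>
      simp only [List.map_cons, List.sum_cons, Matrix.conjTranspose_add, Matrix.conjTranspose_smul,
        PauliWord.conjTranspose_mat, ih]
      simp
  have h1 : ((∑ y, ∑ x, ‖H.mat x y‖ ^ 2 : ℝ) : ℂ) = ((2 ^ n * ∑ w, H.coeff w ^ 2 : ℝ) : ℂ) := by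
    have h2 : (H.mat * H.mat).trace = ((2 ^ n * ∑ w, H.coeff w ^ 2 : ℝ) : ℂ) := by
      rw [H.trace_mul]
      push_cast
      rw [Finset.mul_sum]
      refine Finset.sum_congr rfl fun w _ => ?_
      rw [Matrix.trace_mul_comm, H.trace_mul_mat]
      ring
    rw [← h2]
    nth_rewrite 2 [← hH]
    simp only [Matrix.trace, Matrix.diag_apply, Matrix.mul_apply, Matrix.conjTranspose_apply]
    push_cast
    refine Finset.sum_congr rfl fun y _ => Finset.sum_congr rfl fun x _ => ?_
    exact (Complex.conj_mul' _).symm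
  have h3 : ∑ y, ∑ x, ‖H.mat x y‖ ^ 2 = 2 ^ n * ∑ w, H.coeff w ^ 2 := by exact_mod_cast h1
  have h4 : ∀ y, ∑ x, ‖H.mat x y‖ ^ 2 ≤ H.opNorm ^ 2 := by
    intro y
    have h5 := (Matrix.toEuclideanCLM (n := Bits n) (𝕜 := ℂ) H.mat).le_opNorm
      (EuclideanSpace.single y 1)
    rw [PiLp.norm_single, norm_one, mul_one] at h5
    have h6 : ‖Matrix.toEuclideanCLM (n := Bits n) (𝕜 := ℂ) H.mat (EuclideanSpace.single y 1)‖ ^ 2 =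
        ∑ x, ‖H.mat x y‖ ^ 2 := by
      rw [EuclideanSpace.norm_sq_eq]
      refine Finset.sum_congr rfl fun x _ => ?_
      congr 2
      rw [Matrix.ofLp_toEuclideanCLM]
      simp
    rw [← h6]
    exact pow_le_pow_left₀ (norm_nonneg _) h5 2
  have h7 : ∑ y : Bits n, ∑ x, ‖H.mat x y‖ ^ 2 ≤ ∑ _y : Bits n, H.opNorm ^ 2 :=
    Finset.sum_le_sum fun y _ => h4 y
  rw [h3, Finset.sum_const, Finset.card_univ] at h7
  have h8 : Fintype.card (Bits n) = 2 ^ n := by simp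
  rw [h8, nsmul_eq_mul] at h7
  push_cast at h7
  exact le_of_mul_le_mul_left h7 (by positivity)

theorem Hamiltonian.opNorm_nonneg (H : Hamiltonian n) : 0 ≤ H.opNorm := norm_nonneg _

end NoisyVQA
end

/-! ### A calculus for running programs, and the program itself. -/

noncomputable section

namespace NoisyVQA

variable {n L : ℕ}

/-! ### Symbolic execution of programs -/

/-- The expression `e` halts, and `Q` holds of its value and its number of steps. -/
def Wp (P : Program) (env : List Val) (e : Expr) (Q : Val → ℕ → Prop) : Prop :=
  ∃ v t, Eval P env e v t ∧ Q v t

/-- The call of function `f` halts, and `Q` holds of its value and its number of steps. -/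
def CallWp (P : Program) (f : ℕ) (v : Val) (Q : Val → ℕ → Prop) : Prop :=
  ∃ body, P[f]? = some body ∧ Wp P [v] body Q

/-- Function `f` maps `v` to `v'` in at most `T` steps. -/
def Computes (P : Program) (f : ℕ) (v v' : Val) (T : ℕ) : Prop :=
  CallWp P f v fun u t => u = v' ∧ t ≤ T

variable {P : Program} {env : List Val} {Q : Val → ℕ → Prop}

-- With this rule and the following ones `simp` runs an expression symbolically, threading the step
-- count through the postcondition. Calls remain as `CallWp` goals, so recursion is treated by
-- induction instead of unfolding.
@[simp ↓] theorem wp_var (i : ℕ) : Wp P env (.var i) Q ↔ Q (env.getD i .nil) 1 := by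
  constructor
  · rintro ⟨v, t, h, hQ⟩
    cases h
    exact hQ
  · exact fun h => ⟨_, _, .var _ _, h⟩

@[simp ↓] theorem wp_const (k : Const) : Wp P env (.const k) Q ↔ Q k.val 1 := by
  constructor
  · rintro ⟨v, t, h, hQ⟩
    cases h
    exact hQ
  · exact fun h => ⟨_, _, .const _ _, h⟩

@[simp ↓] theorem wp_un (o : UnOp) (e : Expr) :
    Wp P env (.un o e) Q ↔ Wp P env e fun v t => Q (o.apply v) (t + 1) := by
  constructor
  · rintro ⟨v, t, h, hQ⟩
    cases h with
    | un _ h => exact ⟨_, _, h, hQ⟩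
  · rintro ⟨v, t, h, hQ⟩
    exact ⟨_, _, .un o h, hQ⟩

@[simp ↓] theorem wp_bin (o : BinOp) (e₁ e₂ : Expr) :
    Wp P env (.bin o e₁ e₂) Q ↔ Wp P env e₁ fun v₁ t₁ => Wp P env e₂ fun v₂ t₂ =>
      Q (o.apply v₁ v₂) (t₁ + t₂ + 1) := by
  constructor
  · rintro ⟨v, t, h, hQ⟩
    cases h with
    | bin _ h₁ h₂ => exact ⟨_, _, h₁, _, _, h₂, hQ⟩
  · rintro ⟨v₁, t₁, h₁, v₂, t₂, h₂, hQ⟩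
    exact ⟨_, _, .bin o h₁ h₂, hQ⟩

instance Val.decidableEqNil : (v : Val) → Decidable (v = .nil)
  | .nil => isTrue rfl
  | .real _ => isFalse nofun
  | .angle _ => isFalse nofun
  | .pair _ _ => isFalse nofun

@[simp ↓] theorem wp_cond (e e₁ e₂ : Expr) :
    Wp P env (.cond e e₁ e₂) Q ↔ Wp P env e fun v t =>
      if v = .nil then Wp P env e₂ fun v₂ t₂ => Q v₂ (t + t₂ + 1)
      else Wp P env e₁ fun v₁ t₁ => Q v₁ (t + t₁ + 1) := by
  constructor
  · rintro ⟨v, t, h, hQ⟩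
    cases h with
    | condTrue h hb h₁ => exact ⟨_, _, h, by simp only [if_neg hb]; exact ⟨_, _, h₁, hQ⟩⟩
    | condFalse h h₂ => exact ⟨_, _, h, by simp only [if_true]; exact ⟨_, _, h₂, hQ⟩⟩
  · rintro ⟨v, t, h, hQ⟩
    split_ifs at hQ with hv
    · obtain ⟨v₂, t₂, h₂, hQ⟩ := hQ
      exact ⟨_, _, .condFalse (hv ▸ h) h₂, hQ⟩
    · obtain ⟨v₁, t₁, h₁, hQ⟩ := hQ
      exact ⟨_, _, .condTrue h hv h₁, hQ⟩

@[simp ↓] theorem wp_bind (e₁ e₂ : Expr) :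
    Wp P env (.bind e₁ e₂) Q ↔ Wp P env e₁ fun v₁ t₁ => Wp P (v₁ :: env) e₂ fun v₂ t₂ =>
      Q v₂ (t₁ + t₂ + 1) := by
  constructor
  · rintro ⟨v, t, h, hQ⟩
    cases h with
    | bind h₁ h₂ => exact ⟨_, _, h₁, _, _, h₂, hQ⟩
  · rintro ⟨v₁, t₁, h₁, v₂, t₂, h₂, hQ⟩
    exact ⟨_, _, .bind h₁ h₂, hQ⟩

@[simp ↓] theorem wp_call (f : ℕ) (e : Expr) :
    Wp P env (.call f e) Q ↔ Wp P env e fun v₁ t₁ => CallWp P f v₁ fun v₂ t₂ =>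
      Q v₂ (t₁ + t₂ + 1) := by
  constructor
  · rintro ⟨v, t, h, hQ⟩
    cases h with
    | call h₁ hf h₂ => exact ⟨_, _, h₁, _, hf, _, _, h₂, hQ⟩
  · rintro ⟨v₁, t₁, h₁, body, hf, v₂, t₂, h₂, hQ⟩
    exact ⟨_, _, .call h₁ hf h₂, hQ⟩

/-- A caller knows the result of a call but only an upper bound for its cost, so its postcondition
has to hold for every admissible count. -/
theorem Computes.callWp {f T : ℕ} {v v' : Val} (h : Computes P f v v' T)
    (hQ : ∀ t ≤ T, Q v' t) : CallWp P f v Q := by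
  obtain ⟨body, hf, u, t, he, rfl, ht⟩ := h
  exact ⟨body, hf, _, t, he, hQ t ht⟩

theorem Computes.intro {f T : ℕ} {body : Expr} {v v' : Val} (hf : P[f]? = some body)
    (h : Wp P [v] body fun u t => u = v' ∧ t ≤ T) : Computes P f v v' T :=
  ⟨body, hf, h⟩

attribute [simp] UnOp.apply BinOp.apply Const.val Val.toReal

@[simp] theorem Val.ofBool_eq_nil (b : Bool) : Val.ofBool b = .nil ↔ b = false := by
  cases b <;> simp [Val.ofBool]

/-! ### Encodings of words -/

theorem encWord_zero (w : PauliWord 0) : encWord w = .nil := rfl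

/-- A Pauli word without its first factor. -/
def PauliWord.tail (w : PauliWord (n + 1)) : PauliWord n := fun j => w j.succ

theorem encWord_succ (w : PauliWord (n + 1)) :
    encWord w = .pair (encPauli (w 0)) (encWord w.tail) := by
  simp only [encWord, List.ofFn_succ, encList]
  rfl

theorem encBits_succ (x : Bits (n + 1)) :
    encBits x = .pair (Val.ofBool (decide (x 0 = 1))) (encBits (Fin.tail x)) := by
  simp only [encBits, List.ofFn_succ, encList]
  rfl

theorem encNat_succ (k : ℕ) : encNat (k + 1) = .pair .nil (encNat k) := rfl

theorem encNat_zero : encNat 0 = .nil := rfl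

/-! ### The program -/

namespace Prog

/-- First component. -/
@[simp] def fst (e : Expr) : Expr := .un .fst e
/-- Second component. -/
@[simp] def snd (e : Expr) : Expr := .un .snd e
/-- Pair. -/
@[simp] def pair (e₁ e₂ : Expr) : Expr := .bin .pair e₁ e₂
/-- Sum. -/
@[simp] def add (e₁ e₂ : Expr) : Expr := .bin .add e₁ e₂
/-- Difference. -/
@[simp] def sub (e₁ e₂ : Expr) : Expr := .bin .sub e₁ e₂
/-- Product. -/
@[simp] def mul (e₁ e₂ : Expr) : Expr := .bin .mul e₁ e₂
/-- Comparison. -/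
@[simp] def lt (e₁ e₂ : Expr) : Expr := .bin .lt e₁ e₂
/-- The constant `nil`. -/
@[simp] def nil : Expr := .const .nil
/-- The constant `0`. -/
@[simp] def zero : Expr := .const .zero
/-- The constant `1`. -/
@[simp] def one : Expr := .const .one

/-- The constant expression of a Pauli matrix. -/
def pauli : Pauli → Expr
  | .I => pair nil nil
  | .X => pair (pair nil nil) nil
  | .Y => pair (pair nil nil) (pair nil nil)
  | .Z => pair nil (pair nil nil)

/-- Case distinction on a variable which holds a Pauli matrix. -/
def casePauli (i : ℕ) (e : Pauli → Expr) : Expr :=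
  .cond (fst (.var i)) (.cond (snd (.var i)) (e .Y) (e .X)) (.cond (snd (.var i)) (e .Z) (e .I))

/-- Case distinction on a variable which holds a bit. -/
def caseBit (e : Expr) (e' : Fin 2 → Expr) : Expr := .cond e (e' 1) (e' 0)

theorem wp_pauli (p : Pauli) (h : ∀ t ≤ 7, Q (encPauli p) t) : Wp P env (pauli p) Q := by
  cases p <;> simpa [pauli, encPauli, Val.ofBool] using h _ (by norm_num)

theorem wp_casePauli (i : ℕ) (e : Pauli → Expr) (p : Pauli) (hp : env.getD i .nil = encPauli p)
    (h : Wp P env (e p) fun v t => Q v (t + 6)) : Wp P env (casePauli i e) Q := by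
  have hadd : ∀ t, 2 + (2 + t + 1) + 1 = t + 6 := fun t => by ring
  cases p <;> simp only [casePauli, wp_cond, wp_un, wp_var, hp, fst, snd, encPauli, UnOp.apply,
    Val.ofBool, if_true, if_false, reduceCtorEq, Nat.reduceAdd, hadd] <;> exact h

/-- Multiplication of a complex number, given as pair of real numbers, with a phase. -/
def mulPhase (e : Expr) : Pauli → Pauli → Expr
  | .X, .Y => pair (sub zero (snd e)) (fst e)
  | .Y, .Z => pair (sub zero (snd e)) (fst e)
  | .Z, .X => pair (sub zero (snd e)) (fst e)
  | .Y, .X => pair (snd e) (sub zero (fst e))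
  | .Z, .Y => pair (snd e) (sub zero (fst e))
  | .X, .Z => pair (snd e) (sub zero (fst e))
  | _, _ => e

/-- The pair of the real and the imaginary part. -/
def encComplex (z : ℂ) : Val := .pair (.real z.re) (.real z.im)

theorem wp_mulPhase (i : ℕ) (p q : Pauli) (z : ℂ) (u : Val)
    (hz : env.getD i .nil = .pair (encComplex z) u)
    (h : ∀ t ≤ 9, Q (encComplex (p.phase q * z)) t) :
    Wp P env (mulPhase (fst (.var i)) p q) Q := by
  cases p <;> cases q <;>
    simpa [mulPhase, hz, encComplex, Pauli.phase, -List.getD_eq_getElem?_getD] using h _ (by norm_num)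

/-- The constant expression of an entry of a Pauli matrix. -/
def entry : Pauli → Fin 2 → Fin 2 → Expr
  | .I, 0, 0 => pair one zero
  | .I, 1, 1 => pair one zero
  | .X, 0, 1 => pair one zero
  | .X, 1, 0 => pair one zero
  | .Y, 0, 1 => pair zero (sub zero one)
  | .Y, 1, 0 => pair zero one
  | .Z, 0, 0 => pair one zero
  | .Z, 1, 1 => pair (sub zero one) zero
  | _, _, _ => pair zero zero

theorem wp_entry (p : Pauli) (x y : Fin 2) (h : ∀ t ≤ 5, Q (encComplex (p.mat x y)) t) :
    Wp P env (entry p x y) Q := by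
  cases p <;> fin_cases x <;> fin_cases y <;>
    simpa [entry, encComplex, Pauli.mat] using h _ (by norm_num)

theorem wp_caseBit (e : Expr) (e' : Fin 2 → Expr) (b : Fin 2)
    (h : Wp P env e fun v t => v = Val.ofBool (decide (b = 1)) ∧
      Wp P env (e' b) fun v' t' => Q v' (t + t' + 1)) : Wp P env (caseBit e e') Q := by
  rw [caseBit, wp_cond]
  obtain ⟨v, t, hv, rfl, h⟩ := h
  refine ⟨_, t, hv, ?_⟩
  have hb : b = 0 ∨ b = 1 := by fin_cases b <;> simp
  rcases hb with rfl | rfl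
  · simpa using h
  · simpa using h

/-- The constant expression of the sign of the conjugation with the Hadamard gate. -/
def hadamardSign : Pauli → Expr
  | .Y => sub zero one
  | _ => one

/-- The constant expression of the sign of the conjugation with the phase gate. -/
def phaseSign : Pauli → Expr
  | .X => sub zero one
  | _ => one

/-- The constant expression of the sign of the conjugation with the CNOT gate. -/
def cnotSign : Pauli → Pauli → Expr
  | .X, .Z => sub zero one
  | .Y, .Y => sub zero one
  | _, _ => one

theorem wp_hadamardSign (p : Pauli) (h : ∀ t ≤ 3, Q (.real p.hadamardSign) t) :
    Wp P env (hadamardSign p) Q := by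
  cases p <;> simpa [hadamardSign, Pauli.hadamardSign] using h _ (by norm_num)

theorem wp_phaseSign (p : Pauli) (h : ∀ t ≤ 3, Q (.real p.phaseSign) t) :
    Wp P env (phaseSign p) Q := by
  cases p <;> simpa [phaseSign, Pauli.phaseSign] using h _ (by norm_num)

theorem wp_cnotSign (p q : Pauli) (h : ∀ t ≤ 3, Q (.real (p.cnotSign q)) t) :
    Wp P env (cnotSign p q) Q := by
  cases p <;> cases q <;> simpa [cnotSign, Pauli.cnotSign] using h _ (by norm_num)

/-- Input: a word `w` and a word `σ`. Output: the phase of `i σ w` and the word `σ w`. -/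
def mulWord : Expr :=
  .cond (fst (.var 0))
    (.bind (.call 1 (pair (snd (fst (.var 0))) (snd (snd (.var 0)))))
      (.bind (fst (fst (.var 1)))
        (.bind (fst (snd (.var 2)))
          (casePauli 0 fun q => casePauli 1 fun p =>
            pair (mulPhase (fst (.var 2)) q p) (pair (pauli (q.mul p)) (snd (.var 2)))))))
    (pair (pair zero one) nil)

/-- Input: a word, the damping factor, a coefficient and a budget. Output: the damped coefficient and
the remaining budget. -/
def deduct : Expr :=
  .cond (fst (.var 0))
    (.bind (fst (fst (.var 0)))
      (.cond (.cond (fst (.var 0)) one (snd (.var 0)))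
        (.call 2 (pair (snd (fst (.var 1))) (pair (fst (snd (.var 1)))
          (pair (mul (fst (snd (snd (.var 1)))) (fst (snd (.var 1))))
            (sub (snd (snd (snd (.var 1)))) one)))))
        (.call 2 (pair (snd (fst (.var 1))) (snd (.var 1))))))
    (snd (snd (.var 0)))

/-- Input: a list of items and the damping factor. Output: the damped items which do not exceed
their budget. -/
def deductItems : Expr :=
  .cond (fst (.var 0))
    (.bind (.call 3 (pair (snd (fst (.var 0))) (snd (.var 0))))
      (.bind (fst (fst (.var 1)))
        (.bind (.call 2 (pair (fst (.var 0)) (pair (snd (.var 2)) (snd (.var 0)))))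
          -- The budget is a real number in the program; a negative remainder means that the word
          -- was too heavy.
          (.cond (lt (snd (.var 0)) zero) (.var 2)
            (pair (pair (fst (.var 1)) (.var 0)) (.var 2))))))
    nil

/-- Input: a list of items and a rotation. Output: the items after the rotation. -/
def rotItems : Expr :=
  .cond (fst (.var 0))
    (.bind (.call 4 (pair (snd (fst (.var 0))) (snd (.var 0))))
      (.bind (fst (fst (.var 1)))
        (.bind (.call 1 (pair (fst (.var 0)) (fst (snd (.var 2)))))
          -- With `<` as the only test, `sgn ≠ 0` is decided as `0 < sgn²`.
          (.cond (lt zero (mul (fst (fst (.var 0))) (fst (fst (.var 0)))))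
            (pair
              (pair (fst (.var 1)) (pair (mul (.un .cos (snd (snd (.var 3)))) (fst (snd (.var 1))))
                (snd (snd (.var 1)))))
              (pair
                (pair (snd (.var 0)) (pair (mul (mul (.un .sin (snd (snd (.var 3))))
                  (fst (fst (.var 0)))) (fst (snd (.var 1)))) (snd (snd (.var 1)))))
                (.var 2)))
            (pair (.var 1) (.var 2))))))
    nil

/-- Input: a word and a Clifford gate. Output: the sign and the word after the gate. -/
def gateWord : Expr :=
  .bind (fst (snd (snd (.var 0))))
    (.bind (.call 6 (pair (.var 0) (fst (.var 1))))
      (.cond (fst (snd (.var 2)))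
        (.cond (snd (fst (snd (.var 2))))
          (.bind (fst (snd (snd (snd (.var 2)))))
            (.bind (.call 6 (pair (.var 0) (fst (.var 3))))
              (casePauli 2 fun p => casePauli 0 fun q =>
                pair (cnotSign p q) (.call 7 (pair (.var 3) (pair
                  (.call 7 (pair (.var 1) (pair (fst (.var 4)) (pauli (p.targetAct q)))))
                  (pauli (p.controlAct q))))))))
          (casePauli 0 fun p => pair (phaseSign p)
            (.call 7 (pair (.var 1) (pair (fst (.var 2)) (pauli p.phaseAct))))))
        (casePauli 0 fun p => pair (hadamardSign p)
          (.call 7 (pair (.var 1) (pair (fst (.var 2)) (pauli p.hadamardAct)))))))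

/-- Input: an index and a list. Output: the entry of the list. -/
def getAt : Expr :=
  .cond (fst (.var 0)) (.call 6 (pair (snd (fst (.var 0))) (snd (snd (.var 0)))))
    (fst (snd (.var 0)))

/-- Input: an index, a list and a new entry. Output: the updated list. -/
def setAt : Expr :=
  .cond (fst (.var 0))
    (pair (fst (fst (snd (.var 0)))) (.call 7 (pair (snd (fst (.var 0)))
      (pair (snd (fst (snd (.var 0)))) (snd (snd (.var 0)))))))
    (pair (snd (snd (.var 0))) (snd (fst (snd (.var 0)))))

/-- Input: a list of items and a Clifford gate. Output: the items after the gate. -/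
def gateItems : Expr :=
  .cond (fst (.var 0))
    (.bind (.call 8 (pair (snd (fst (.var 0))) (snd (.var 0))))
      (.bind (fst (fst (.var 1)))
        (.bind (.call 5 (pair (fst (.var 0)) (snd (.var 2))))
          (pair (pair (snd (.var 0)) (pair (mul (fst (.var 0)) (fst (snd (.var 1))))
            (snd (snd (.var 1))))) (.var 2)))))
    nil

/-- Input: a list of items and a list of rotations. Output: the items after the rotations. -/
def rotsItems : Expr :=
  .cond (snd (.var 0))
    (.call 9 (pair (.call 4 (pair (fst (.var 0)) (fst (snd (.var 0))))) (snd (snd (.var 0)))))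
    (fst (.var 0))

/-- Input: a list of items and a list of Clifford gates. Output: the items after the gates. -/
def gatesItems : Expr :=
  .cond (snd (.var 0))
    (.call 10 (pair (.call 8 (pair (fst (.var 0)) (fst (snd (.var 0))))) (snd (snd (.var 0)))))
    (fst (.var 0))

/-- Input: a list of layers, a list of items and the damping factor. Output: the items after the
layers, starting from the last one. -/
def layersItems : Expr :=
  .cond (fst (.var 0))
    (.bind (.call 3 (pair (.call 11 (pair (snd (fst (.var 0))) (snd (.var 0))))
        (snd (snd (.var 0)))))
      (.call 10 (pair (.call 9 (pair (.var 0) (fst (fst (fst (.var 1))))))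
        (snd (fst (fst (.var 1)))))))
    (fst (snd (.var 0)))

/-- Input: a word and two basis labels. Output: the entry of the matrix of the word. -/
def wordEntry : Expr :=
  .cond (fst (.var 0))
    (.bind (.call 12 (pair (snd (fst (.var 0))) (pair (snd (fst (snd (.var 0))))
        (snd (snd (snd (.var 0)))))))
      (.bind (fst (fst (.var 1)))
        (.bind (casePauli 0 fun p => caseBit (fst (fst (snd (.var 2)))) fun x =>
            caseBit (fst (snd (snd (.var 2)))) fun y => entry p x y)
          (pair
            (sub (mul (fst (.var 0)) (fst (.var 2))) (mul (snd (.var 0)) (snd (.var 2))))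
            (add (mul (fst (.var 0)) (snd (.var 2))) (mul (snd (.var 0)) (fst (.var 2))))))))
    (pair one zero)

/-- Input: a word and a state. Output: the expectation value. -/
def expectation : Expr :=
  .cond (snd (.var 0))
    (.bind (fst (snd (.var 0)))
      (.bind (.call 12 (pair (fst (.var 1)) (pair (snd (fst (.var 0))) (fst (fst (.var 0))))))
        (add (sub (mul (fst (.var 0)) (fst (snd (.var 1)))) (mul (snd (.var 0)) (snd (snd (.var 1)))))
          (.call 13 (pair (fst (.var 2)) (snd (snd (.var 2))))))))
    zero

/-- Input: a list of items and a state. Output: the sum of the expectation values. -/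
def sumItems : Expr :=
  .cond (fst (.var 0))
    (add (mul (fst (snd (fst (fst (.var 0)))))
        (.call 13 (pair (fst (fst (fst (.var 0)))) (snd (.var 0)))))
      (.call 14 (pair (snd (fst (.var 0))) (snd (.var 0)))))
    zero

/-- Input: a Hamiltonian and a budget. Output: the list of items. -/
def initItems : Expr :=
  .cond (fst (.var 0))
    (pair (pair (fst (fst (fst (.var 0)))) (pair (snd (fst (fst (.var 0)))) (snd (.var 0))))
      (.call 15 (pair (snd (fst (.var 0))) (snd (.var 0)))))
    nil

/-- Input: a Hamiltonian. Output: the sum of the squared coefficients. -/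
def sumSq : Expr :=
  .cond (.var 0)
    (add (mul (snd (fst (.var 0))) (snd (fst (.var 0)))) (.call 16 (snd (.var 0))))
    zero

/-- Input: a threshold `T`, a number `x`, a factor `r` and a counter `m`. Output: the counter when
`x` is at most `T`, if `x` is multiplied with `r` in every step. -/
def search : Expr :=
  .cond (lt (fst (.var 0)) (fst (snd (.var 0))))
    (.call 17 (pair (fst (.var 0)) (pair (mul (fst (snd (.var 0))) (fst (snd (snd (.var 0)))))
      (pair (fst (snd (snd (.var 0)))) (add (snd (snd (snd (.var 0)))) one)))))
    (snd (snd (snd (.var 0))))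

/-- The list in variable `i` without its first `k` entries. -/
def input (i : ℕ) : ℕ → Expr
  | 0 => .var i
  | k + 1 => snd (input i k)

/-- The main function. -/
def main : Expr :=
  .bind (sub one (fst (input 0 0)))
    (.bind (mul (.var 0) (.var 0))
      (.bind (.call 17 (pair (mul (mul (fst (input 2 1)) (fst (input 2 1))) (fst (input 2 2)))
          (pair (mul (.var 0) (.call 16 (fst (input 2 5)))) (pair (.var 0) zero))))
        (.bind (.call 11 (pair (fst (input 3 4))
            (pair (.call 15 (pair (fst (input 3 5)) (.var 0))) (.var 2))))
          (.call 14 (pair (.call 3 (pair (.var 0) (.var 3))) (fst (input 4 6)))))))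

end Prog

open Prog in
/-- The classical algorithm: Pauli path summation in the Heisenberg picture. -/
def program : Program :=
  [main, mulWord, deduct, deductItems, rotItems, gateWord, getAt, setAt, gateItems, rotsItems,
    gatesItems, layersItems, wordEntry, expectation, sumItems, initItems, sumSq, search]

end NoisyVQA
end

/-! ### Correctness and cost of the routines for words and lists of items. -/

noncomputable section

namespace NoisyVQA

variable {n L : ℕ}

open Prog

/-! ### Correctness and running time of the program -/

/-- The recursion starts from the complex number `i` at the empty word, so the real part of the
result is `sgn`. -/
theorem computes_mulWord (σ w : PauliWord n) :
    Computes program 1 (.pair (encWord w) (encWord σ))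
      (.pair (encComplex (Complex.I * σ.phase w)) (encWord (σ.mul w))) (100 * n + 10) := by
  induction n with
  | zero =>
    refine Computes.intro rfl ?_
    simp [mulWord, encWord_zero, encComplex, PauliWord.phase]
  | succ n ih =>
    refine Computes.intro rfl ?_
    rw [encWord_succ w, encWord_succ σ]
    simp [mulWord]
    refine (ih σ.tail w.tail).callWp fun t ht => ?_
    refine wp_casePauli _ _ (σ 0) (by simp) (wp_casePauli _ _ (w 0) (by simp) ?_)
    simp
    refine wp_mulPhase _ _ _ (Complex.I * σ.tail.phase w.tail) _ rfl fun t' ht' => ?_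
    refine wp_pauli _ fun t'' ht'' => ?_
    refine ⟨?_, by omega⟩
    rw [encWord_succ (σ.mul w)]
    have h1 : σ.phase w = (σ 0).phase (w 0) * σ.tail.phase w.tail := by
      simp only [PauliWord.phase, Fin.prod_univ_succ]
      rfl
    rw [h1, mul_left_comm]
    exact ⟨rfl, rfl⟩

theorem PauliWord.weight_succ (w : PauliWord (n + 1)) :
    w.weight = (if w 0 = .I then 0 else 1) + w.tail.weight := by
  simp only [PauliWord.weight, PauliWord.support, Finset.card_filter, Fin.sum_univ_succ]
  congr 1
  by_cases h : w 0 = .I <;> simp [h]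

/-- The subtraction is one of real numbers and may become negative; the caller compares the result
with `0`. -/
theorem computes_deduct (w : PauliWord n) (r c b : ℝ) :
    Computes program 2 (.pair (encWord w) (.pair (.real r) (.pair (.real c) (.real b))))
      (.pair (.real (c * r ^ w.weight)) (.real (b - w.weight))) (100 * n + 10) := by
  induction n generalizing c b with
  | zero =>
    refine Computes.intro rfl ?_
    simp [deduct, encWord_zero, PauliWord.weight, PauliWord.support]
  | succ n ih =>
    refine Computes.intro rfl ?_
    have h0 := w.weight_succ
    have h1 := ih w.tail c b
    have h2 := ih w.tail (c * r) (b - 1)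
    rw [encWord_succ w]
    generalize w.weight = k at *
    generalize w.tail = v at *
    generalize w 0 = p at *
    cases p <;> simp [deduct, encPauli]
    · refine h1.callWp fun t ht => ⟨?_, by omega⟩
      simp [h0]
    all_goals
      refine h2.callWp fun t ht => ⟨?_, by omega⟩
      simp [h0]
      exact ⟨by ring, by ring⟩

/-- A summand in the course of the computation: a word, its coefficient, and the weight which the
earlier part of the path may have. -/
structure Item (n : ℕ) where
  word : PauliWord n
  coeff : ℝ
  budget : ℕ

/-- The encoding of an item. -/
def encItem (a : Item n) : Val := .pair (encWord a.word) (.pair (.real a.coeff) (.real a.budget))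

/-- The encoding of a list of items. -/
def encItems (l : List (Item n)) : Val := encList (l.map encItem)

theorem encItems_nil : encItems ([] : List (Item n)) = .nil := rfl

theorem encItems_cons (a : Item n) (l : List (Item n)) :
    encItems (a :: l) = .pair (encItem a) (encItems l) := rfl

/-- Damping of an item. -/
def Item.deduct (r : ℝ) (a : Item n) : List (Item n) :=
  if a.word.weight ≤ a.budget then
    [⟨a.word, a.coeff * r ^ a.word.weight, a.budget - a.word.weight⟩] else []

/-- Rotation of an item. -/
def Item.rot (σ : PauliWord n) (θ : ℝ) (a : Item n) : List (Item n) :=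
  if σ.sgn a.word = 0 then [a] else
    [⟨a.word, Real.cos θ * a.coeff, a.budget⟩,
      ⟨σ.mul a.word, Real.sin θ * σ.sgn a.word * a.coeff, a.budget⟩]

/-- Conjugation of an item with a Clifford gate. -/
def Item.gate (g : CliffordGate n) (a : Item n) : Item n :=
  ⟨g.act a.word, g.sign a.word * a.coeff, a.budget⟩

theorem computes_deductItems (r : ℝ) (l : List (Item n)) :
    Computes program 3 (.pair (encItems l) (.real r)) (encItems (l.flatMap (Item.deduct r)))
      (l.length * (200 * n + 500) + 10) := by
  induction l with
  | nil =>
    refine Computes.intro rfl ?_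
    simp [deductItems, encItems_nil]
  | cons a l ih =>
    refine Computes.intro rfl ?_
    simp [deductItems, encItems_cons, encItem]
    refine ih.callWp fun t ht => ?_
    refine (computes_deduct a.word r a.coeff a.budget).callWp fun t' ht' => ?_
    rw [Item.deduct]
    by_cases h : a.word.weight ≤ a.budget
    · simp [h, encItems_cons, encItem]
      linarith
    · simp [h]
      linarith

theorem computes_rotItems (σ : PauliWord n) (θ : ℝ) (l : List (Item n)) :
    Computes program 4 (.pair (encItems l) (.pair (encWord σ) (.angle θ)))
      (encItems (l.flatMap (Item.rot σ θ))) (l.length * (200 * n + 500) + 10) := by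
  induction l with
  | nil =>
    refine Computes.intro rfl ?_
    simp [rotItems, encItems_nil]
  | cons a l ih =>
    refine Computes.intro rfl ?_
    simp [rotItems, encItems_cons, encItem]
    refine ih.callWp fun t ht => ?_
    refine (computes_mulWord σ a.word).callWp fun t' ht' => ?_
    have hs : (Complex.I * σ.phase a.word).re = σ.sgn a.word := rfl
    simp only [encComplex, hs]
    rw [Item.rot]
    by_cases h : σ.sgn a.word = 0
    · simp [h, encItems_cons, encItem]
      linarith
    · simp [h, encItems_cons, encItem]
      linarith

theorem computes_getAt (k : ℕ) (w : PauliWord n) (hk : k < n) :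
    Computes program 6 (.pair (encNat k) (encWord w)) (encPauli (w ⟨k, hk⟩)) (30 * k + 30) := by
  induction k generalizing n with
  | zero =>
    cases n with
    | zero => omega
    | succ n =>
      refine Computes.intro rfl ?_
      simp [getAt, encNat_zero, encWord_succ]
  | succ k ih =>
    cases n with
    | zero => omega
    | succ n =>
      refine Computes.intro rfl ?_
      simp [getAt, encNat_succ, encWord_succ]
      refine (ih w.tail (by omega)).callWp fun t ht => ⟨rfl, by omega⟩

theorem computes_setAt (k : ℕ) (w : PauliWord n) (hk : k < n) (p : Pauli) :
    Computes program 7 (.pair (encNat k) (.pair (encWord w) (encPauli p)))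
      (encWord (Function.update w ⟨k, hk⟩ p)) (30 * k + 30) := by
  induction k generalizing n with
  | zero =>
    cases n with
    | zero => omega
    | succ n =>
      refine Computes.intro rfl ?_
      rw [encWord_succ (Function.update _ _ _)]
      simp [setAt, encNat_zero, encWord_succ]
      congr 1
  | succ k ih =>
    cases n with
    | zero => omega
    | succ n =>
      refine Computes.intro rfl ?_
      rw [encWord_succ (Function.update _ _ _)]
      simp [setAt, encNat_succ, encWord_succ]
      refine (ih w.tail (by omega)).callWp fun t ht => ⟨?_, by omega⟩
      have h2 : PauliWord.tail (Function.update w ⟨k + 1, hk⟩ p) =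
          Function.update w.tail ⟨k, by omega⟩ p :=
        Fin.tail_update_succ w ⟨k, by omega⟩ p
      rw [h2]

theorem computes_gateWord (w : PauliWord n) (g : CliffordGate n) :
    Computes program 5 (.pair (encWord w) (encGate g))
      (.pair (.real (g.sign w)) (encWord (g.act w))) (150 * n + 300) := by
  refine Computes.intro rfl ?_
  cases g with
  | hadamard a =>
    have ha := a.isLt
    simp [gateWord, encGate, encList, encNat_zero]
    refine (computes_getAt a w ha).callWp fun t ht => ?_
    refine wp_casePauli _ _ (w a) rfl ?_
    simp
    refine wp_hadamardSign _ fun t1 ht1 => ?_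
    refine wp_pauli _ fun t2 ht2 => ?_
    refine (computes_setAt a w ha _).callWp fun t3 ht3 => ⟨⟨rfl, rfl⟩, by omega⟩
  | phase a =>
    have ha := a.isLt
    simp [gateWord, encGate, encList, encNat_zero, encNat_succ 0]
    refine (computes_getAt a w ha).callWp fun t ht => ?_
    refine wp_casePauli _ _ (w a) rfl ?_
    simp
    refine wp_phaseSign _ fun t1 ht1 => ?_
    refine wp_pauli _ fun t2 ht2 => ?_
    refine (computes_setAt a w ha _).callWp fun t3 ht3 => ⟨⟨rfl, rfl⟩, by omega⟩
  | cnot a b hab =>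
    have ha := a.isLt
    have hb := b.isLt
    simp [gateWord, encGate, encList, encNat_zero, encNat_succ 0, encNat_succ 1]
    refine (computes_getAt a w ha).callWp fun t ht => ?_
    refine (computes_getAt b w hb).callWp fun t' ht' => ?_
    refine wp_casePauli _ _ (w a) rfl (wp_casePauli _ _ (w b) rfl ?_)
    simp
    refine wp_cnotSign _ _ fun t1 ht1 => ?_
    refine wp_pauli _ fun t2 ht2 => ?_
    refine (computes_setAt b w hb _).callWp fun t3 ht3 => ?_
    refine wp_pauli _ fun t4 ht4 => ?_
    refine (computes_setAt a _ ha _).callWp fun t5 ht5 => ⟨⟨rfl, rfl⟩, by omega⟩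

theorem computes_gateItems (g : CliffordGate n) (l : List (Item n)) :
    Computes program 8 (.pair (encItems l) (encGate g)) (encItems (l.map (Item.gate g)))
      (l.length * (200 * n + 500) + 10) := by
  induction l with
  | nil =>
    refine Computes.intro rfl ?_
    simp [gateItems, encItems_nil]
  | cons a l ih =>
    refine Computes.intro rfl ?_
    simp [gateItems, encItems_cons, encItem]
    refine ih.callWp fun t ht => ?_
    refine (computes_gateWord a.word g).callWp fun t' ht' => ?_
    simp [Item.gate]
    linarith

end NoisyVQA
end

/-! ### List size, value of the list, and the loops of the algorithm. -/

noncomputable section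

namespace NoisyVQA

variable {n L : ℕ} {ι : Type*}

open Prog

/-! ### Lists of items -/

/-- The items after a list of rotations. -/
def rotsFold (θ : ι → ℝ) : List (PauliWord n × ι) → List (Item n) → List (Item n)
  | [], l => l
  | r :: rs, l => rotsFold θ rs (l.flatMap (Item.rot r.1 (θ r.2)))

/-- The items after a list of Clifford gates. -/
def gatesFold : List (CliffordGate n) → List (Item n) → List (Item n)
  | [], l => l
  | g :: gs, l => gatesFold gs (l.map (Item.gate g))

/-- The items after the given layers, starting from the last one. -/
def layersFold (r : ℝ) (c : Circuit n L) (θ : c.Params) (l : List (Item n)) :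
    List (Fin L) → List (Item n)
  | [] => l
  | i :: is => gatesFold (c.gates i) (rotsFold θ (c.rots i)
      ((layersFold r c θ l is).flatMap (Item.deduct r)))

/-- An upper bound for the number of items after a list of rotations, including the items which may
arise later from the budget. -/
def rotPotential (rs : List (PauliWord n × ι)) (l : List (Item n)) : ℕ :=
  (l.map fun a => 2 ^ (a.budget + rs.countP fun r => r.1.sgn a.word ≠ 0)).sum

/-- An upper bound for the number of items which may arise from the given ones. -/
def potential (l : List (Item n)) : ℕ := (l.map fun a => 2 ^ a.budget).sum

theorem length_le_rotPotential (rs : List (PauliWord n × ι)) (l : List (Item n)) :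
    l.length ≤ rotPotential rs l := by
  induction l with
  | nil => simp
  | cons a l ih =>
    simp only [rotPotential, List.map_cons, List.sum_cons, List.length_cons] at ih ⊢
    have := Nat.one_le_two_pow (n := a.budget + rs.countP fun r => r.1.sgn a.word ≠ 0)
    omega

theorem length_le_potential (l : List (Item n)) : l.length ≤ potential l :=
  length_le_rotPotential ([] : List (PauliWord n × ℕ)) l

/-- An anticommuting rotation replaces one item by two whose exponents are smaller by one, as this
rotation is no longer counted. The others see `σw` as they saw `w`, because their supports are
disjoint from that of `σ`. -/
theorem rotPotential_flatMap_rot (r : PauliWord n × ι) (rs : List (PauliWord n × ι))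
    (h : ∀ r' ∈ rs, Disjoint r.1.support r'.1.support) (θ : ℝ) (l : List (Item n)) :
    rotPotential rs (l.flatMap (Item.rot r.1 θ)) = rotPotential (r :: rs) l := by
  induction l with
  | nil => rfl
  | cons a l ih =>
    simp only [rotPotential] at ih ⊢
    rw [List.flatMap_cons, List.map_append, List.sum_append, ih, List.map_cons, List.sum_cons]
    congr 1
    rw [Item.rot, List.countP_cons]
    by_cases hs : r.1.sgn a.word = 0
    · simp [hs]
    · have hc : (rs.countP fun r' => r'.1.sgn (r.1.mul a.word) ≠ 0) =
          rs.countP fun r' => r'.1.sgn a.word ≠ 0 := by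
        refine List.countP_congr fun r' hr' => ?_
        simp [PauliWord.sgn_mul_of_sgn_eq_zero (PauliWord.sgn_eq_zero_of_disjoint (h r' hr').symm)]
      rw [if_neg hs]
      simp only [List.map_cons, List.map_nil, List.sum_cons, List.sum_nil, hc]
      simp only [ne_eq, hs, not_false_eq_true, decide_true, if_true]
      ring

theorem potential_rotsFold (θ : ι → ℝ) (rs : List (PauliWord n × ι))
    (h : rs.Pairwise fun r r' => Disjoint r.1.support r'.1.support) (l : List (Item n)) :
    potential (rotsFold θ rs l) = rotPotential rs l := by
  induction rs generalizing l with
  | nil => rfl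
  | cons r rs ih =>
    rw [List.pairwise_cons] at h
    rw [rotsFold, ih h.2, rotPotential_flatMap_rot r rs h.1]

theorem potential_gatesFold (gs : List (CliffordGate n)) (l : List (Item n)) :
    potential (gatesFold gs l) = potential l := by
  induction gs generalizing l with
  | nil => rfl
  | cons g gs ih =>
    rw [gatesFold, ih, potential, List.map_map]
    rfl

/-- Every anticommuting rotation meets the support of `w`, and no two rotations share a qubit. `A`
contains all qubits of the support which the remaining rotations can still meet; each anticommuting
rotation uses up at least one. -/
theorem countP_le_card (rs : List (PauliWord n × ι))
    (h : rs.Pairwise fun r r' => Disjoint r.1.support r'.1.support) (w : PauliWord n)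
    (A : Finset (Fin n)) (hA : ∀ r ∈ rs, Disjoint r.1.support (w.support \ A)) :
    (rs.countP fun r => r.1.sgn w ≠ 0) ≤ A.card := by
  induction rs generalizing A with
  | nil => simp
  | cons r rs ih =>
    rw [List.pairwise_cons] at h
    rw [List.countP_cons]
    by_cases hs : r.1.sgn w = 0
    · simpa [hs] using ih h.2 A fun r' hr' => hA r' (by simp [hr'])
    · have h1 := ih h.2 (A \ r.1.support) fun r' hr' => by
        rw [Finset.disjoint_left]
        intro j hj hj'
        simp only [Finset.mem_sdiff, not_and, not_not] at hj'
        by_cases hjA : j ∈ A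
        · exact Finset.disjoint_left.1 (h.1 r' hr') (hj'.2 hjA) hj
        · exact Finset.disjoint_left.1 (hA r' (by simp [hr'])) hj
            (Finset.mem_sdiff.2 ⟨hj'.1, hjA⟩)
      have h2 : ∃ j, j ∈ r.1.support ∧ j ∈ w.support := by
        by_contra! h2
        exact hs (PauliWord.sgn_eq_zero_of_disjoint (Finset.disjoint_left.2 h2))
      obtain ⟨j, hj, hjw⟩ := h2
      have hjA : j ∈ A := by
        by_contra hjA
        exact Finset.disjoint_left.1 (hA r (by simp)) hj (Finset.mem_sdiff.2 ⟨hjw, hjA⟩)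
      have h3 : (A \ r.1.support).card < A.card :=
        Finset.card_lt_card ⟨Finset.sdiff_subset, fun h' => (Finset.mem_sdiff.1 (h' hjA)).2 hj⟩
      simp only [ne_eq, hs, not_false_eq_true, decide_true, if_true]
      exact (Nat.succ_le_succ h1).trans h3

/-- The weight deducted from the budget pays for all branchings of the coming layer, of which there
are at most as many. -/
theorem rotPotential_flatMap_deduct (rs : List (PauliWord n × ι))
    (h : rs.Pairwise fun r r' => Disjoint r.1.support r'.1.support) (r : ℝ) (l : List (Item n)) :
    rotPotential rs (l.flatMap (Item.deduct r)) ≤ potential l := by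
  induction l with
  | nil => exact le_rfl
  | cons a l ih =>
    simp only [rotPotential, potential] at ih ⊢
    rw [List.flatMap_cons, List.map_append, List.sum_append, List.map_cons, List.sum_cons]
    refine Nat.add_le_add ?_ ih
    rw [Item.deduct]
    split_ifs with hw
    · simp only [List.map_cons, List.map_nil, List.sum_cons, List.sum_nil, add_zero]
      have h1 := countP_le_card rs h a.word a.word.support (by simp)
      refine Nat.pow_le_pow_right (by norm_num) ?_
      rw [← PauliWord.weight] at h1
      omega
    · simp

theorem potential_flatMap_deduct (r : ℝ) (l : List (Item n)) :
    potential (l.flatMap (Item.deduct r)) ≤ potential l :=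
  rotPotential_flatMap_deduct ([] : List (PauliWord n × ℕ)) List.Pairwise.nil r l

theorem potential_layersFold (r : ℝ) (c : Circuit n L) (θ : c.Params) (l : List (Item n))
    (is : List (Fin L)) : potential (layersFold r c θ l is) ≤ potential l := by
  induction is with
  | nil => exact le_rfl
  | cons i is ih =>
    rw [layersFold, potential_gatesFold, potential_rotsFold _ _ (c.pairwise_rots i)]
    exact (rotPotential_flatMap_deduct _ (c.pairwise_rots i) _ _).trans ih

/-! ### The value of a list of items -/

/-- The sum of the values of the words, weighted with the coefficients. -/
def itemsVal (f : ℕ → PauliWord n → ℝ) (l : List (Item n)) : ℝ :=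
  (l.map fun a => a.coeff * f a.budget a.word).sum

theorem itemsVal_flatMap (f g : ℕ → PauliWord n → ℝ) (F : Item n → List (Item n))
    (h : ∀ a, itemsVal f (F a) = a.coeff * g a.budget a.word) (l : List (Item n)) :
    itemsVal f (l.flatMap F) = itemsVal g l := by
  induction l with
  | nil => rfl
  | cons a l ih =>
    have h1 := h a
    simp only [itemsVal] at ih h1 ⊢
    rw [List.flatMap_cons, List.map_append, List.sum_append, List.map_cons, List.sum_cons, ih, h1]

/-- `rotsFold` pushes words forward and `rotVal` pulls the functional back; the two are dual,
rotation by rotation. -/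
theorem itemsVal_rotsFold (θ : ι → ℝ) (rs : List (PauliWord n × ι)) (f : ℕ → PauliWord n → ℝ)
    (l : List (Item n)) :
    itemsVal f (rotsFold θ rs l) = itemsVal (fun m => rotVal θ rs (f m)) l := by
  induction rs generalizing l with
  | nil => rfl
  | cons r rs ih =>
    rw [rotsFold, ih]
    refine itemsVal_flatMap _ _ _ (fun a => ?_) l
    rw [Item.rot, rotVal]
    split_ifs
    · simp [itemsVal]
    · simp only [itemsVal, List.map_cons, List.map_nil, List.sum_cons, List.sum_nil]
      ring

theorem itemsVal_gatesFold (gs : List (CliffordGate n)) (f : ℕ → PauliWord n → ℝ)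
    (l : List (Item n)) :
    itemsVal f (gatesFold gs l) = itemsVal (fun m => gatesVal gs (f m)) l := by
  induction gs generalizing l with
  | nil => rfl
  | cons g gs ih =>
    rw [gatesFold, ih, itemsVal, itemsVal, List.map_map]
    congr 1
    refine List.map_congr_left fun a _ => ?_
    simp only [Function.comp, Item.gate, gatesVal]
    ring

theorem itemsVal_layer (lam : ℝ) (c : Circuit n L) (ρ : InputState n) (θ : c.Params) (i : Fin L)
    (l : List (Item n)) :
    itemsVal (fun m w => noisyPathVal lam c ρ θ i w m) (gatesFold (c.gates i)
      (rotsFold θ (c.rots i) (l.flatMap (Item.deduct (1 - lam))))) =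
      itemsVal (fun m w => noisyPathVal lam c ρ θ (i + 1) w m) l := by
  rw [itemsVal_gatesFold, itemsVal_rotsFold]
  refine itemsVal_flatMap _ _ _ (fun a => ?_) l
  rw [Item.deduct, noisyPathVal_succ]
  split_ifs
  · simp only [itemsVal, List.map_cons, List.map_nil, List.sum_cons, List.sum_nil,
      Circuit.layerVal]
    ring
  · simp [itemsVal]

/-- Loop invariant: once the layers from `k` on are processed, evaluating the list with the path
sums of the first `k` layers still gives the initial value. -/
theorem itemsVal_layersFold (lam : ℝ) (c : Circuit n L) (ρ : InputState n) (θ : c.Params)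
    (l : List (Item n)) (k : ℕ) (hk : k ≤ L) :
    itemsVal (fun m w => noisyPathVal lam c ρ θ k w m)
      (layersFold (1 - lam) c θ l ((List.finRange L).drop k)) =
      itemsVal (fun m w => noisyPathVal lam c ρ θ L w m) l := by
  induction hk using Nat.decreasingInduction with
  | self => rw [List.drop_of_length_le (by simp), layersFold]
  | of_succ k hk ih =>
    rw [List.drop_eq_getElem_cons (by simpa using hk), layersFold, List.getElem_finRange]
    exact (itemsVal_layer lam c ρ θ ⟨k, hk⟩ _).trans ih

theorem itemsVal_expect (lam : ℝ) (c : Circuit n L) (ρ : InputState n) (θ : c.Params)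
    (l : List (Item n)) :
    itemsVal (fun _ w => ρ.expect w) (l.flatMap (Item.deduct (1 - lam))) =
      itemsVal (fun m w => noisyPathVal lam c ρ θ 0 w m) l := by
  refine itemsVal_flatMap _ _ _ (fun a => ?_) l
  rw [Item.deduct, noisyPathVal_zero]
  split_ifs
  · simp only [itemsVal, List.map_cons, List.map_nil, List.sum_cons, List.sum_nil]
    ring
  · simp [itemsVal]

/-! ### The remaining functions of the program -/

/-- The encoding of a rotation. -/
def encRot (θ : ι → ℝ) (r : PauliWord n × ι) : Val := .pair (encWord r.1) (.angle (θ r.2))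

theorem encLayer_eq (c : Circuit n L) (θ : c.Params) (i : Fin L) :
    encLayer c θ i = .pair (encList ((c.rots i).map (encRot θ)))
      (encList ((c.gates i).map encGate)) := by
  rw [encLayer, Circuit.rots, Circuit.gates, List.map_ofFn, List.map_ofFn]
  rfl

/-- The potential is invariant under rotations and bounds the length, so `B` bounds the list at
every intermediate stage. -/
theorem computes_rotsItems (θ : ι → ℝ) (rs : List (PauliWord n × ι))
    (h : rs.Pairwise fun r r' => Disjoint r.1.support r'.1.support) (l : List (Item n)) (B : ℕ)
    (hB : rotPotential rs l ≤ B) :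
    Computes program 9 (.pair (encItems l) (encList (rs.map (encRot θ))))
      (encItems (rotsFold θ rs l)) (rs.length * (B * (200 * n + 500) + 50) + 10) := by
  induction rs generalizing l with
  | nil =>
    refine Computes.intro rfl ?_
    simp [rotsItems, encList, rotsFold]
  | cons r rs ih =>
    rw [List.pairwise_cons] at h
    have hl : l.length * (200 * n + 500) ≤ B * (200 * n + 500) :=
      Nat.mul_le_mul_right _ ((length_le_rotPotential _ l).trans hB)
    rw [← rotPotential_flatMap_rot r rs h.1 (θ r.2)] at hB
    refine Computes.intro rfl ?_
    simp [rotsItems, encList, encRot]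
    refine (computes_rotItems r.1 (θ r.2) l).callWp fun t ht => ?_
    refine (ih h.2 _ hB).callWp fun t' ht' => ⟨rfl, ?_⟩
    rw [add_mul]
    omega

theorem computes_gatesItems (gs : List (CliffordGate n)) (l : List (Item n)) (B : ℕ)
    (hB : l.length ≤ B) :
    Computes program 10 (.pair (encItems l) (encList (gs.map encGate)))
      (encItems (gatesFold gs l)) (gs.length * (B * (200 * n + 500) + 50) + 10) := by
  induction gs generalizing l with
  | nil =>
    refine Computes.intro rfl ?_
    simp [gatesItems, encList, gatesFold]
  | cons g gs ih =>
    have hl : l.length * (200 * n + 500) ≤ B * (200 * n + 500) := Nat.mul_le_mul_right _ hB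
    refine Computes.intro rfl ?_
    simp [gatesItems, encList]
    refine (computes_gateItems g l).callWp fun t ht => ?_
    refine (ih _ ((List.length_map _).trans_le hB)).callWp fun t' ht' => ⟨rfl, ?_⟩
    rw [add_mul]
    omega

/-- Choosing one qubit from each set is injective. This limits the gates per layer, so their number
does not enter the time bound separately. -/
theorem card_le_of_disjoint {k : ℕ} (S : Fin k → Finset (Fin n)) (hne : ∀ j, (S j).Nonempty)
    (hd : ∀ i j, i ≠ j → Disjoint (S i) (S j)) : k ≤ n := by
  choose f hf using hne
  have hinj : Function.Injective f := by
    intro i j hij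
    by_contra h
    exact Finset.disjoint_left.1 (hd i j h) (hf i) (hij ▸ hf j)
  simpa using Fintype.card_le_of_injective f hinj

theorem Circuit.length_rots_le (c : Circuit n L) (i : Fin L) : (c.rots i).length ≤ n := by
  rw [Circuit.rots, List.length_ofFn]
  exact card_le_of_disjoint _ (c.word_nontrivial i) fun j j' hj =>
    c.disjoint i (show Sum.inl j ≠ Sum.inl j' by simpa using hj)

theorem Circuit.length_gates_le (c : Circuit n L) (i : Fin L) : (c.gates i).length ≤ n := by
  rw [Circuit.gates, List.length_ofFn]
  refine card_le_of_disjoint (fun k => (c.gate i k).support) (fun k => ?_) fun j j' hj =>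
    c.disjoint i (show Sum.inr j ≠ Sum.inr j' by simpa using hj)
  cases c.gate i k <;> simp [CliffordGate.support]

theorem computes_layersItems (r : ℝ) (c : Circuit n L) (θ : c.Params) (l : List (Item n))
    (is : List (Fin L)) (B : ℕ) (hB : potential l ≤ B) :
    Computes program 11 (.pair (encList (is.map (encLayer c θ))) (.pair (encItems l) (.real r)))
      (encItems (layersFold r c θ l is))
      (is.length * ((2 * n + 1) * (B * (200 * n + 500) + 50) + 100) + 10) := by
  induction is with
  | nil =>
    refine Computes.intro rfl ?_
    simp [layersItems, encList, layersFold]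
  | cons i is ih =>
    refine Computes.intro rfl ?_
    simp [layersItems, encList, encLayer_eq]
    refine ih.callWp fun t ht => ?_
    have h1 := (potential_layersFold r c θ l is).trans hB
    have h2 := (rotPotential_flatMap_deduct (c.rots i) (c.pairwise_rots i) r _).trans h1
    have h3 : (layersFold r c θ l is).length * (200 * n + 500) ≤ B * (200 * n + 500) :=
      Nat.mul_le_mul_right _ ((length_le_potential _).trans h1)
    refine (computes_deductItems r _).callWp fun t1 ht1 => ?_
    refine (computes_rotsItems θ (c.rots i) (c.pairwise_rots i) _ B h2).callWp fun t2 ht2 => ?_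
    have h4 : (rotsFold θ (c.rots i) ((layersFold r c θ l is).flatMap (Item.deduct r))).length ≤ B :=
      ((length_le_potential _).trans_eq (potential_rotsFold θ _ (c.pairwise_rots i) _)).trans h2
    refine (computes_gatesItems (c.gates i) _ B h4).callWp fun t3 ht3 => ⟨rfl, ?_⟩
    obtain ⟨K, hK⟩ : ∃ K, B * (200 * n + 500) = K := ⟨_, rfl⟩
    rw [hK] at ht2 ht3 h3 ht ⊢
    have h5 := Nat.mul_le_mul_right (K + 50) (c.length_rots_le i)
    have h6 := Nat.mul_le_mul_right (K + 50) (c.length_gates_le i)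
    -- A layer takes at most `n` passes for rotations, `n` for Clifford gates and one for the
    -- damping.
    have h7 : (2 * n + 1) * (K + 50) = n * (K + 50) + n * (K + 50) + K + 50 := by ring
    rw [h7, add_mul]
    rw [h7] at ht
    generalize is.length * _ = k at *
    omega

theorem computes_wordEntry (w : PauliWord n) (x y : Bits n) :
    Computes program 12 (.pair (encWord w) (.pair (encBits x) (encBits y)))
      (encComplex (w.mat x y)) (100 * n + 10) := by
  induction n with
  | zero =>
    refine Computes.intro rfl ?_
    simp [wordEntry, encWord_zero, encComplex, PauliWord.mat, tensor]
  | succ n ih =>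
    refine Computes.intro rfl ?_
    rw [encWord_succ, encBits_succ, encBits_succ]
    simp [wordEntry]
    refine (ih w.tail (Fin.tail x) (Fin.tail y)).callWp fun t ht => ?_
    refine wp_casePauli _ _ (w 0) rfl ?_
    refine wp_caseBit _ _ (x 0) ?_
    simp
    refine wp_caseBit _ _ (y 0) ?_
    simp
    refine wp_entry _ _ _ fun t' ht' => ?_
    have h1 : w.mat x y = (w 0).mat (x 0) (y 0) * w.tail.mat (Fin.tail x) (Fin.tail y) := by
      simp only [PauliWord.mat, tensor, Matrix.of_apply, Fin.prod_univ_succ]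
      rfl
    simp [h1, encComplex]
    omega

/-- Only the listed entries contribute to the trace, each paired with the transposed entry of the
word. -/
theorem InputState.expect_eq (ρ : InputState n) (w : PauliWord n) :
    ρ.expect w = (ρ.entries.map fun e => (w.mat e.1.2 e.1.1 * e.2).re).sum := by
  rw [InputState.expect, InputState.mat, entriesMat]
  induction ρ.entries with
  | nil => simp
  | cons e l ih =>
    rw [List.map_cons, List.sum_cons, Matrix.mul_add, Matrix.trace_add, Complex.add_re, ih,
      List.map_cons, List.sum_cons, Matrix.trace_mul_single]
    rfl

/-- The encoding of an entry of the density matrix. -/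
def encEntry (e : (Bits n × Bits n) × ℂ) : Val :=
  .pair (.pair (encBits e.1.1) (encBits e.1.2)) (.pair (.real e.2.re) (.real e.2.im))

theorem computes_expectation (w : PauliWord n) (l : List ((Bits n × Bits n) × ℂ)) :
    Computes program 13 (.pair (encWord w) (encList (l.map encEntry)))
      (.real (l.map fun e => (w.mat e.1.2 e.1.1 * e.2).re).sum)
      (l.length * (100 * n + 100) + 10) := by
  induction l with
  | nil =>
    refine Computes.intro rfl ?_
    simp [expectation, encList]
  | cons e l ih =>
    refine Computes.intro rfl ?_
    simp [expectation, encList, encEntry]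
    refine (computes_wordEntry w e.1.2 e.1.1).callWp fun t ht => ?_
    simp [encComplex]
    refine ih.callWp fun t' ht' => ?_
    simp
    linarith

theorem computes_sumItems (ρ : InputState n) (l : List (Item n)) :
    Computes program 14 (.pair (encItems l) (encState ρ))
      (.real (itemsVal (fun _ w => ρ.expect w) l))
      (l.length * (ρ.entries.length * (100 * n + 100) + 50) + 10) := by
  induction l with
  | nil =>
    refine Computes.intro rfl ?_
    simp [sumItems, encItems_nil, itemsVal]
  | cons a l ih =>
    refine Computes.intro rfl ?_
    simp [sumItems, encItems_cons, encItem]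
    refine (computes_expectation a.word ρ.entries).callWp fun t ht => ?_
    simp
    refine ih.callWp fun t' ht' => ?_
    simp [itemsVal, ρ.expect_eq]
    rw [add_mul]
    generalize l.length * _ = k at *
    omega

/-- The items at the beginning of the computation. -/
def initialItems (M : ℕ) (l : List (PauliWord n × ℝ)) : List (Item n) :=
  l.map fun t => ⟨t.1, t.2, M⟩

/-- The encoding of a term of the Hamiltonian. -/
def encTerm (t : PauliWord n × ℝ) : Val := .pair (encWord t.1) (.real t.2)

theorem computes_initItems (M : ℕ) (l : List (PauliWord n × ℝ)) :
    Computes program 15 (.pair (encList (l.map encTerm)) (.real M)) (encItems (initialItems M l))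
      (l.length * 50 + 10) := by
  induction l with
  | nil =>
    refine Computes.intro rfl ?_
    simp [initItems, encList, initialItems, encItems_nil]
  | cons a l ih =>
    refine Computes.intro rfl ?_
    simp [initItems, encList, encTerm]
    refine ih.callWp fun t' ht' => ?_
    simp [initialItems, encItems_cons, encItem]
    omega

theorem computes_sumSq (l : List (PauliWord n × ℝ)) :
    Computes program 16 (encList (l.map encTerm)) (.real (l.map fun t => t.2 * t.2).sum)
      (l.length * 50 + 10) := by
  induction l with
  | nil =>
    refine Computes.intro rfl ?_
    simp [sumSq, encList]
  | cons a l ih =>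
    refine Computes.intro rfl ?_
    simp [sumSq, encList, encTerm]
    refine ih.callWp fun t' ht' => ?_
    simp
    omega

/-- The hypotheses say that `M` is the first index at which the threshold is met; `k` is the number
of rounds left. -/
theorem computes_search (T S r : ℝ) (M : ℕ) (hM : S * r ^ M ≤ T) (hm : ∀ m < M, T < S * r ^ m)
    (k m : ℕ) (h : m + k = M) :
    Computes program 17 (.pair (.real T) (.pair (.real (S * r ^ m)) (.pair (.real r) (.real m))))
      (.real M) (k * 50 + 50) := by
  induction k generalizing m with
  | zero =>
    obtain rfl : m = M := h
    refine Computes.intro rfl ?_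
    simp [search, hM.not_gt]
  | succ k ih =>
    refine Computes.intro rfl ?_
    have h1 := hm m (by omega)
    have h2 := ih (m + 1) (by omega)
    rw [pow_succ, ← mul_assoc] at h2
    push_cast at h2
    simp [search, h1]
    refine h2.callWp fun t ht => ⟨rfl, by omega⟩

end NoisyVQA
end

/-! ### The complete algorithm and its polynomial time bound. -/

noncomputable section

namespace NoisyVQA

variable {n L : ℕ}

open Prog

/-! ### The complete algorithm -/

/-- An upper bound for the number of steps, in terms of the numbers of qubits, layers, Pauli words
of the Hamiltonian, entries of the state, and an upper bound for `2 ^ M`. -/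
def timeBound {R : Type*} [CommSemiring R] (n L h e x : R) : R :=
  (x * 50 + 50) + (h * 50 + 10) + (h * 50 + 10) +
    (L * ((2 * n + 1) * (h * x * (200 * n + 500) + 50) + 100) + 10) +
    (h * x * (200 * n + 500) + 10) + (h * x * (e * (100 * n + 100) + 50) + 10) + 300

/-- The bound is a semiring expression, needed over `ℕ` for step counts, over `ℝ` for estimates and
over polynomials for `timePolynomial`; homomorphisms connect the three. -/
theorem map_timeBound {R R' F : Type*} [CommSemiring R] [CommSemiring R'] [FunLike F R R']
    [RingHomClass F R R'] (f : F) (n L h e x : R) :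
    f (timeBound n L h e x) = timeBound (f n) (f L) (f h) (f e) (f x) := by
  simp only [timeBound, map_add, map_mul, map_ofNat, map_one]

theorem timeBound_mono {n L h h' e e' x x' : ℝ} (hn : 0 ≤ n) (hL : 0 ≤ L) (hh : 0 ≤ h) (he : 0 ≤ e)
    (hx : 0 ≤ x) (hh' : h ≤ h') (he' : e ≤ e') (hx' : x ≤ x') :
    timeBound n L h e x ≤ timeBound n L h' e' x' := by
  have h1 : h * x ≤ h' * x' := mul_le_mul hh' hx' hx (hh.trans hh')
  have h2 : 0 ≤ h * x := mul_nonneg hh hx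
  have h3 : 0 ≤ h' * x' := h2.trans h1
  unfold timeBound
  gcongr

theorem potential_initialItems (M : ℕ) (l : List (PauliWord n × ℝ)) :
    potential (initialItems M l) = l.length * 2 ^ M := by
  simp [potential, initialItems, Function.comp_def]

theorem itemsVal_initialItems (f : ℕ → PauliWord n → ℝ) (M : ℕ) (l : List (PauliWord n × ℝ)) :
    itemsVal f (initialItems M l) = (l.map fun t => t.2 * f M t.1).sum := by
  rw [itemsVal, initialItems, List.map_map]
  rfl

/-- The output of the algorithm with truncation at weight `M`. -/
theorem computes_main (lam ε δ : ℝ) (c : Circuit n L) (H : Hamiltonian n) (ρ : InputState n)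
    (θ : c.Params) (M : ℕ)
    (hM : (1 - lam) ^ (2 * M + 2) * ∑ w, H.coeff w ^ 2 ≤ ε * ε * δ)
    (hm : ∀ m < M, ε * ε * δ < (1 - lam) ^ (2 * m + 2) * ∑ w, H.coeff w ^ 2) :
    Computes program 0 (encInput lam ε δ c H ρ θ)
      (.real (H.terms.map fun t => t.2 * noisyPathVal lam c ρ θ L t.1 M).sum)
      (timeBound n L H.terms.length ρ.entries.length (2 ^ M)) := by
  set r := 1 - lam with hr
  -- The search starts at `r² ∑ c²` and multiplies by `r²`, so the counter `m` stands for the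
  -- exponent `2m + 2`.
  have hpow : ∀ m, r * r * (H.terms.map fun t => t.2 * t.2).sum * (r * r) ^ m =
      r ^ (2 * m + 2) * ∑ w, H.coeff w ^ 2 := by
    intro m
    rw [H.sum_coeff_sq, pow_add, pow_mul, sq]
    ring
  have h17 := computes_search (ε * ε * δ) (r * r * (H.terms.map fun t => t.2 * t.2).sum) (r * r) M
    (by rw [hpow]; exact hM) (fun m h => by rw [hpow]; exact hm m h) M 0 (zero_add M)
  rw [pow_zero, mul_one, Nat.cast_zero] at h17
  set l₀ := initialItems M H.terms with hl₀
  set l₁ := layersFold r c θ l₀ (List.finRange L) with hl₁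
  have hval : itemsVal (fun _ w => ρ.expect w) (l₁.flatMap (Item.deduct r)) =
      (H.terms.map fun t => t.2 * noisyPathVal lam c ρ θ L t.1 M).sum := by
    have h1 := itemsVal_layersFold lam c ρ θ l₀ 0 (Nat.zero_le L)
    rw [List.drop_zero, hl₀, itemsVal_initialItems] at h1
    rw [hr, itemsVal_expect lam c ρ θ]
    exact h1
  have hpot : potential l₁ ≤ H.terms.length * 2 ^ M :=
    (potential_layersFold r c θ l₀ _).trans_eq (potential_initialItems M H.terms)
  have hlen₁ := (length_le_potential l₁).trans hpot
  have hlen₂ := ((length_le_potential _).trans (potential_flatMap_deduct r l₁)).trans hpot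
  have hlayers : List.ofFn (fun i => encLayer c θ i) = (List.finRange L).map (encLayer c θ) :=
    List.ofFn_eq_map
  have hH : encHamiltonian H = encList (H.terms.map encTerm) := rfl
  refine Computes.intro rfl ?_
  rw [encInput, hlayers, hH]
  simp [main, Prog.input, encList]
  refine (computes_sumSq H.terms).callWp fun t₁ ht₁ => ?_
  simp
  refine h17.callWp fun t₂ ht₂ => ?_
  refine (computes_initItems M H.terms).callWp fun t₃ ht₃ => ?_
  refine (computes_layersItems r c θ l₀ (List.finRange L) (H.terms.length * 2 ^ M)
    (potential_initialItems M H.terms).le).callWp fun t₄ ht₄ => ?_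
  refine (computes_deductItems r l₁).callWp fun t₅ ht₅ => ?_
  refine (computes_sumItems ρ _).callWp fun t₆ ht₆ => ?_
  refine ⟨by rw [hval], ?_⟩
  have h5 := Nat.mul_le_mul_right (200 * n + 500) hlen₁
  have h6 := Nat.mul_le_mul_right (ρ.entries.length * (100 * n + 100) + 50) hlen₂
  -- The search takes about `M` rounds, which the bound in terms of `2 ^ M` absorbs.
  have h7 : M ≤ 2 ^ M := Nat.lt_two_pow_self.le
  rw [List.length_finRange] at ht₄
  rw [timeBound]
  omega

/-- The two additional steps are reading the input variable and the call of the main function. -/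
theorem Computes.runs {P : Program} {v v' : Val} {T : ℕ} (h : Computes P 0 v v' T) :
    ∃ t ≤ T + 2, P.Runs v v' t := by
  obtain ⟨body, hf, u, t, he, rfl, ht⟩ := h
  exact ⟨1 + t + 1, by omega, .call (.var _ 0) hf he⟩

/-- The truncation weight is logarithmic in the other parameters. -/
theorem two_pow_le {r ε δ S N : ℝ} {κ M : ℕ} (hr0 : 0 ≤ r) (hr1 : r < 1) (hκ : r ^ κ < 1 / 2)
    (hε : 0 < ε) (hδ : 0 < δ) (hN : 0 ≤ N) (hS : S ≤ N ^ 2)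
    (hm : ∀ m < M, ε * ε * δ < r ^ (2 * m + 2) * S) :
    (2 : ℝ) ^ M ≤ 1 + (1 / ε * (1 / Real.sqrt δ) * N) ^ κ := by
  have hs : 0 < Real.sqrt δ := Real.sqrt_pos.2 hδ
  have hy : 0 ≤ 1 / ε * (1 / Real.sqrt δ) * N := by positivity
  -- For `M = 0` the summand `1` suffices; otherwise minimality is used at `M - 1 = m`.
  rcases M with _ | m
  · rw [pow_zero]
    linarith [pow_nonneg hy κ]
  have h1 := hm m (Nat.lt_succ_self m)
  have h2 : (ε * Real.sqrt δ) ^ 2 < (r ^ (m + 1) * N) ^ 2 := by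
    calc (ε * Real.sqrt δ) ^ 2 = ε * ε * δ := by
          rw [mul_pow, Real.sq_sqrt hδ.le]
          ring
      _ < r ^ (2 * m + 2) * S := h1
      _ ≤ r ^ (2 * m + 2) * N ^ 2 := mul_le_mul_of_nonneg_left hS (pow_nonneg hr0 _)
      _ = (r ^ (m + 1) * N) ^ 2 := by ring
  have h3 : ε * Real.sqrt δ < r ^ (m + 1) * N :=
    lt_of_pow_lt_pow_left₀ 2 (by positivity) h2
  -- The value `r = 0`, that is `λ = 1`, is incompatible with `M > 0`.
  have hr : 0 < r := by
    rcases hr0.eq_or_lt with h | h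
    · rw [← h, zero_pow (Nat.succ_ne_zero m), zero_mul] at h3
      exact absurd h3 (not_lt.2 (by positivity))
    · exact h
  have h4 : 1 ≤ r ^ (m + 1) * (1 / ε * (1 / Real.sqrt δ) * N) := by
    have h5 : r ^ (m + 1) * (1 / ε * (1 / Real.sqrt δ) * N) =
        r ^ (m + 1) * N / (ε * Real.sqrt δ) := by
      field_simp
    rw [h5, one_le_div (by positivity)]
    exact h3.le
  -- The `κ`-th power turns decay at rate `r` into decay at rate `1/2`.
  have h6 : 1 ≤ (r ^ κ) ^ (m + 1) * (1 / ε * (1 / Real.sqrt δ) * N) ^ κ := by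
    rw [pow_right_comm, ← mul_pow]
    exact one_le_pow₀ h4
  have h7 : (r ^ κ) ^ (m + 1) ≤ (1 / 2) ^ (m + 1) := pow_le_pow_left₀ (by positivity) hκ.le _
  have h8 : 1 ≤ (1 / 2 : ℝ) ^ (m + 1) * (1 / ε * (1 / Real.sqrt δ) * N) ^ κ :=
    h6.trans (mul_le_mul_of_nonneg_right h7 (pow_nonneg hy _))
  have h9 : (2 : ℝ) ^ (m + 1) * (1 / 2) ^ (m + 1) = 1 := by
    rw [← mul_pow]
    norm_num
  calc (2 : ℝ) ^ (m + 1) ≤ 2 ^ (m + 1) * ((1 / 2 : ℝ) ^ (m + 1) *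
        (1 / ε * (1 / Real.sqrt δ) * N) ^ κ) := le_mul_of_one_le_right (by positivity) h8
    _ = (1 / ε * (1 / Real.sqrt δ) * N) ^ κ := by rw [← mul_assoc, h9, one_mul]
    _ ≤ _ := by linarith

/-- The least admissible `M` is taken: it is the one the search finds, and its minimality limits the
running time. -/
theorem exists_truncation {r T S : ℝ} (hr0 : 0 ≤ r) (hr1 : r < 1) (hT : 0 < T) (hS : 0 ≤ S) :
    ∃ M : ℕ, r ^ (2 * M + 2) * S ≤ T ∧ ∀ m < M, T < r ^ (2 * m + 2) * S := by
  classical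
  have h : ∃ M : ℕ, r ^ (2 * M + 2) * S ≤ T := by
    -- The denominator `S + 1` also covers `S = 0`.
    obtain ⟨M, hM⟩ := exists_pow_lt_of_lt_one (show 0 < T / (S + 1) by positivity) hr1
    refine ⟨M, ?_⟩
    rw [lt_div_iff₀ (by positivity)] at hM
    have h1 : r ^ (2 * M + 2) ≤ r ^ M := pow_le_pow_of_le_one hr0 hr1.le (by omega)
    have h2 : r ^ (2 * M + 2) * S ≤ r ^ M * S := mul_le_mul_of_nonneg_right h1 hS
    have h3 : 0 ≤ r ^ M := pow_nonneg hr0 M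
    linarith
  exact ⟨Nat.find h, Nat.find_spec h, fun m hm => not_le.1 (Nat.find_min h hm)⟩

/-- The polynomial bound for the number of steps. -/
def timePolynomial (sparsity : Polynomial ℕ) (κ : ℕ) : MvPolynomial (Fin 5) ℕ :=
  timeBound (MvPolynomial.X 0) (MvPolynomial.X 1) (Polynomial.aeval (MvPolynomial.X 0) sparsity)
    (Polynomial.aeval (MvPolynomial.X 0) sparsity)
    (1 + (MvPolynomial.X 2 * MvPolynomial.X 3 * MvPolynomial.X 4) ^ κ) + 2

theorem aeval_timePolynomial (sparsity : Polynomial ℕ) (κ n : ℕ) (L a b N : ℝ) :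
    MvPolynomial.aeval (![(n : ℝ), L, a, b, N] : Fin 5 → ℝ) (timePolynomial sparsity κ) =
      timeBound (n : ℝ) L (sparsity.eval n : ℕ) (sparsity.eval n : ℕ) (1 + (a * b * N) ^ κ) + 2 := by
  have h : MvPolynomial.aeval (![(n : ℝ), L, a, b, N] : Fin 5 → ℝ)
      (Polynomial.aeval (MvPolynomial.X 0 : MvPolynomial (Fin 5) ℕ) sparsity) =
      ((sparsity.eval n : ℕ) : ℝ) := by
    rw [← Polynomial.aeval_algHom_apply, MvPolynomial.aeval_X]
    exact Polynomial.aeval_algebraMap_apply ℝ n sparsity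
  rw [timePolynomial, map_add, map_timeBound, h, map_add, map_pow, map_mul, map_mul]
  simp only [MvPolynomial.aeval_X, map_one, map_ofNat]
  rfl

end NoisyVQA

end

theorem theorem1 :
    ∃ P : NoisyVQA.Program,
      ∀ lam : ℝ, 0 < lam → lam ≤ 1 →
      ∀ sparsity : Polynomial ℕ,
      ∃ Q : MvPolynomial (Fin 5) ℕ,
      ∀ (n L : ℕ) (c : NoisyVQA.Circuit n L) (H : NoisyVQA.Hamiltonian n)
        (ρ : NoisyVQA.InputState n),
        c.Generates →
        H.terms.length ≤ sparsity.eval n →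
        ρ.entries.length ≤ sparsity.eval n →
        ∀ ε δ : ℝ, 0 < ε → 0 < δ → δ ≤ 1 →
        ∃ M : ℕ,
          (∀ θ : c.Params, ∃ (out : ℝ) (t : ℕ),
            P.Runs (NoisyVQA.encInput lam ε δ c H ρ θ) (NoisyVQA.Val.real out) t ∧
            (out : ℂ) = NoisyVQA.truncatedCost lam c H ρ M θ ∧
            (t : ℝ) ≤ MvPolynomial.aeval
              (![(n : ℝ), (L : ℝ), 1 / ε, 1 / Real.sqrt δ, H.opNorm] : Fin 5 → ℝ) Q) ∧
          1 - δ ≤ c.paramMeasure.real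
            {θ | ‖NoisyVQA.truncatedCost lam c H ρ M θ - NoisyVQA.noisyCost lam c H ρ θ‖ ≤ ε} := by
  refine ⟨NoisyVQA.program, fun lam hlam hlam1 sparsity => ?_⟩
  have hr0 : 0 ≤ 1 - lam := by linarith
  have hr1 : 1 - lam < 1 := by linarith
  -- The degree of the time polynomial in `1/ε`, `1/√δ` and `‖H‖` is governed by `κ`, which depends
  -- on `λ` only.
  obtain ⟨κ, hκ⟩ := exists_pow_lt_of_lt_one (show (0 : ℝ) < 1 / 2 by norm_num) hr1
  refine ⟨NoisyVQA.timePolynomial sparsity κ, fun n L c H ρ hc hH hρ ε δ hε hδ _ => ?_⟩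
  -- The threshold uses `∑ c²`, which the program computes from its input; the operator norm enters
  -- only the analysis.
  obtain ⟨M, hM, hm⟩ := NoisyVQA.exists_truncation hr0 hr1
    (show 0 < ε * ε * δ by positivity) (show 0 ≤ ∑ w, H.coeff w ^ 2 by positivity)
  refine ⟨M, fun θ => ?_, NoisyVQA.one_sub_le_measureReal_truncation lam hlam.le hlam1 c hc H ρ M
    ε δ hε hM⟩
  obtain ⟨t, ht, hrun⟩ := (NoisyVQA.computes_main lam ε δ c H ρ θ M hM hm).runs
  refine ⟨_, t, hrun, (NoisyVQA.truncatedCost_eq lam c H ρ M θ).symm, ?_⟩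
  have h2M := NoisyVQA.two_pow_le hr0 hr1 hκ hε hδ H.opNorm_nonneg H.sum_coeff_sq_le hm
  rw [NoisyVQA.aeval_timePolynomial]
  calc (t : ℝ) ≤ ((NoisyVQA.timeBound n L H.terms.length ρ.entries.length (2 ^ M) + 2 : ℕ) : ℝ) := by
        exact_mod_cast ht
    _ = NoisyVQA.timeBound (n : ℝ) L H.terms.length ρ.entries.length (2 ^ M) + 2 := by
        have h := NoisyVQA.map_timeBound (Nat.castRingHom ℝ) n L H.terms.length ρ.entries.length
          (2 ^ M)
        simp only [Nat.coe_castRingHom, Nat.cast_pow, Nat.cast_ofNat] at h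
        rw [Nat.cast_add, Nat.cast_ofNat, ← h]
    _ ≤ _ := by
        have := NoisyVQA.timeBound_mono (n := n) (L := L) (Nat.cast_nonneg n) (Nat.cast_nonneg L)
          (Nat.cast_nonneg H.terms.length) (Nat.cast_nonneg ρ.entries.length)
          (show (0 : ℝ) ≤ 2 ^ M by positivity) (Nat.cast_le.2 hH) (Nat.cast_le.2 hρ) h2M
        linarith
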